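/- Let $\xi_0,\xi_1,\dots$ be i.i.d. exponential random variables of parameter $1$, let $P_n(z)=\sum_{j=0}^n\xi_jz^j$, and let $L_n=\frac1n\sum_{i=1}^n\delta_{z_i}$ be the empirical measure of the complex zeros $z_1,\dots,z_n$ of $P_n$ (counted with multiplicity), $n\ge1$. For a closed set $S\subset\mathbb C$ let $\mathcal M_1(S)\subset\mathcal M_1(\mathbb C)$ be the set of Borel probability measures on $\mathbb C$ carried by $S$, with the topology of weak convergence; let $\mathbb R_-=(-\infty,0]$. Let $\mathcal P\subset\mathcal M_1(\mathbb C)$ be the weak closure of the set of empirical measures of zeros of nonconstant polynomials all of whose coefficients are real and strictly positive, and define $I:\mathcal M_1(\mathbb C)\to[0,\infty]$ by $$I(\mu)=\int\log|1-z|\,d\mu(z)-\tfrac12\iint\log|z-w|\,d\mu(z)d\mu(w)\quad(\mu\in\mathcal P),\qquad I(\mu)=\infty\quad(\mu\notin\mathcal P),$$ where the right-hand side is understood as $\frac12\iint\big(\log|1-z|+\log|1-w|-\log|z-w|\big)d\mu(z)d\mu(w)\in(-\infty,\infty]$. Put $I_R=\inf_{\mu\in\mathcal M_1(\mathbb R_-)}I(\mu)$.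 Then $\mathbb P(L_n\in\mathcal M_1(\mathbb R_-))>0$ for all $n\ge1$, and, conditioned on $L_n\in\mathcal M_1(\mathbb R_-)$, the random measures $L_n$ satisfy the large deviation principle in $\mathcal M_1(\mathbb R_-)$ with speed $n^2$ and good rate function $J(\mu)=I(\mu)-I_R$. That is, $J$ is nonnegative and lower semicontinuous on $\mathcal M_1(\mathbb R_-)$, its level sets $\{J\le M\}$, $M\in\mathbb R$, are compact, and for every open $O\subset\mathcal M_1(\mathbb R_-)$ and every closed $F\subset\mathcal M_1(\mathbb R_-)$, $$\liminf_{n\to\infty}\frac1{n^2}\log\mathbb P\big(L_n\in O\mid L_n\in\mathcal M_1(\mathbb R_-)\big)\ge-\inf_OJ,\qquad \limsup_{n\to\infty}\frac1{n^2}\log\mathbb P\big(L_n\in F\mid L_n\in\mathcal M_1(\mathbb R_-)\big)\le-\inf_FJ.$$ Moreover there is exactly one $\mu_R\in\mathcal M_1(\mathbb R_-)$ with $I(\mu_R)=I_R$, and, conditioned on $L_n\in\mathcal M_1(\mathbb R_-)$, and likewise conditioned on $L_n\in\mathcal M_1(\mathbb R)$, $L_n$ converges weakly to $\mu_R$ in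 probability: for every weakly open $U\subset\mathcal M_1(\mathbb C)$ containing $\mu_R$, the conditional probability of $\{L_n\in U\}$ tends to $1$ as $n\to\infty$. -/

import Mathlib

open MeasureTheory ProbabilityTheory Filter Topology Polynomial
open scoped ENNReal

noncomputable section

namespace RandomZeros

/-- The complex zeros of a real polynomial, counted with multiplicity, each with mass
`1 / #zeros`. -/
def zeroMeasure (p : ℝ[X]) : Measure ℂ :=
  ((p.aroots ℂ).card : ℝ≥0∞)⁻¹ • ((p.aroots ℂ).map Measure.dirac).sum

theorem multiset_sum_dirac_univ (s : Multiset ℂ) :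
    (s.map Measure.dirac).sum Set.univ = (s.card : ℝ≥0∞) := by
  induction s using Multiset.induction_on with
  | empty => simp
  | cons a s ih => simp [ih, add_comm]

theorem isProbabilityMeasure_zeroMeasure {p : ℝ[X]} (hp : p.natDegree ≠ 0) :
    IsProbabilityMeasure (zeroMeasure p) := by
  have hcard : (p.aroots ℂ).card = p.natDegree := by
    have := (IsAlgClosed.splits (p.map (algebraMap ℝ ℂ))).natDegree_eq_card_roots
    rw [Polynomial.natDegree_map] at this
    exact this.symm
  constructor
  rw [zeroMeasure, Measure.smul_apply, multiset_sum_dirac_univ, hcard, smul_eq_mul]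
  exact ENNReal.inv_mul_cancel (by exact_mod_cast hp) (ENNReal.natCast_ne_top _)

/-- The empirical measure of zeros `μ_p`, as a point of `M₁(ℂ)`. A polynomial of degree `0` has
no empirical measure; the value `δ₀` there is a convention. -/
def empiricalMeasure (p : ℝ[X]) : ProbabilityMeasure ℂ :=
  if hp : p.natDegree ≠ 0 then ⟨zeroMeasure p, isProbabilityMeasure_zeroMeasure hp⟩
  else ⟨Measure.dirac 0, inferInstance⟩

/-- Nonconstant polynomials all of whose coefficients (up to the degree) are real and positive. -/
def polPos : Set ℝ[X] :=
  {p | p.natDegree ≠ 0 ∧ ∀ k ≤ p.natDegree, 0 < p.coeff k}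

/-- The weak closure `𝒫` in `M₁(ℂ)` of the empirical measures of polynomials with positive
coefficients. -/
def classP : Set (ProbabilityMeasure ℂ) := closure (empiricalMeasure '' polPos)

/-- Lebesgue integral of an extended real valued function, `∫ g⁺ - ∫ g⁻`. -/
def eintegral {α : Type*} [MeasurableSpace α] (μ : Measure α) (g : α → EReal) : EReal :=
  ((∫⁻ x, (g x).toENNReal ∂μ : ℝ≥0∞) : EReal) - ((∫⁻ x, (-g x).toENNReal ∂μ : ℝ≥0∞) : EReal)

/-- `f(z,w) = log|1-z| + log|1-w| - log|z-w|`, with `log 0 = -∞`; so `f(z,z) = +∞` for `z ≠ 1`. -/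
def logKernel (z w : ℂ) : EReal :=
  ENNReal.log ‖1 - z‖ₑ + ENNReal.log ‖1 - w‖ₑ - ENNReal.log ‖z - w‖ₑ

open Classical in
/-- `I(μ) = ∫ log|1-z| dμ(z) - ½ ∬ log|z-w| dμ(z)dμ(w)` on `𝒫`, understood as
`½ ∬ f(z,w) dμ(z)dμ(w)`, and `∞` off `𝒫`. -/
def rateI (μ : ProbabilityMeasure ℂ) : EReal :=
  if μ ∈ classP then
    eintegral ((μ : Measure ℂ).prod (μ : Measure ℂ)) (fun q => logKernel q.1 q.2) / 2
  else ⊤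

/-- The real line inside `ℂ`. -/
def realLine : Set ℂ := Set.range ((↑) : ℝ → ℂ)

/-- `ℝ₋ = ℝ \ (0,∞)` inside `ℂ`. -/
def negLine : Set ℂ := ((↑) : ℝ → ℂ) '' Set.Iic 0

/-- `M₁(S)` as a subset of `M₁(ℂ)`. -/
def probOn (S : Set ℂ) : Set (ProbabilityMeasure ℂ) :=
  {μ | (μ : Measure ℂ) Sᶜ = 0}

/-- `I_R`, the infimum of `I` over `M₁(ℝ₋)`. -/
def infRate : EReal := ⨅ μ ∈ probOn negLine, rateI μ

/-- A good rate function: lower semicontinuous, nonnegative, with compact level sets. -/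
def IsGoodRateFunction {E : Type*} [TopologicalSpace E] (J : E → EReal) : Prop :=
  LowerSemicontinuous J ∧ (∀ x, 0 ≤ J x) ∧ ∀ M : ℝ, IsCompact {x | J x ≤ (M : EReal)}

/-- The large deviation principle with speed `a n` and good rate function `J`, for laws given by
the probabilities `Q n A` of the sets `A ⊆ E`. -/
def SatisfiesLDP {E : Type*} [TopologicalSpace E] (Q : ℕ → Set E → ℝ≥0∞) (a : ℕ → ℝ)
    (J : E → EReal) : Prop :=
  IsGoodRateFunction J ∧
  (∀ O : Set E, IsOpen O →
    -(⨅ x ∈ O, J x) ≤ liminf (fun n => ENNReal.log (Q n O) / ((a n : ℝ) : EReal)) atTop) ∧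
  (∀ F : Set E, IsClosed F →
    limsup (fun n => ENNReal.log (Q n F) / ((a n : ℝ) : EReal)) atTop ≤ -(⨅ x ∈ F, J x))

/-- `P_n(z) = ∑_{j=0}^n ξ_j z^j`. -/
def randomPoly {Ω : Type*} (ξ : ℕ → Ω → ℝ) (n : ℕ) (ω : Ω) : ℝ[X] :=
  ∑ j ∈ Finset.range (n + 1), C (ξ j ω) * X ^ j

/-- `L_n`, the empirical measure of the zeros of `P_n`. -/
def empL {Ω : Type*} (ξ : ℕ → Ω → ℝ) (n : ℕ) (ω : Ω) : ProbabilityMeasure ℂ :=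
  empiricalMeasure (randomPoly ξ n ω)

/-- `ℙ(L_n ∈ A | L_n ∈ M₁(S))`. -/
def condProb {Ω : Type*} [MeasurableSpace Ω] (P : Measure Ω) (ξ : ℕ → Ω → ℝ) (S : Set ℂ) (n : ℕ)
    (A : Set (ProbabilityMeasure ℂ)) : ℝ≥0∞ :=
  (ProbabilityTheory.cond P {ω | empL ξ n ω ∈ probOn S}) {ω | empL ξ n ω ∈ A}

end RandomZeros

end

noncomputable section

namespace RandomZeros

/-! ### The coordinates `(S, y)` on real-rooted polynomials -/

/-! Positive coefficients force real zeros to be negative, so a real-rooted `P_n` is `S ∏ (1 - yᵢ +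
yᵢ X)` with `yᵢ = 1 / (1 - zᵢ)` in `(0, 1)` and `S = P_n(1)` the sum of the coefficients. The
Jacobian of `(S, y) ↦` coefficients is `S ^ n` times the Vandermonde product of `y`
(`abs_det_jacobianMatrix`), and the joint density of the coefficients is `exp (-S)`. Integrating out
`S` leaves `n! ∫ ∏_{i<j} |yⱼ - yᵢ| dy` over increasing configurations (`measure_event_eq_gasMass`):
a logarithmic gas on the compact interval `[0, 1]`, without external field. Real and negative zeros
give the same event up to a null set.

The substitution `y = 1 / (1 - z)` turns the kernel of `I` into `-log |y - y'|`, so on `M₁(ℝ₋)` the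
rate `I` is half the logarithmic energy of the image measure (`rateI_eq`). Push-forward embeds
`M₁(ℝ₋)` into the compact space `M₁([0, 1])`, with image the measures not charging `0`. Finite
energy excludes atoms, so nothing relevant is lost at `0` and exponential tightness comes for free.

For the upper bound the kernel is truncated, which makes the energy continuous, and compactness
supplies one truncation level for a whole closed set (`eventually_gasMass_le_exp`). For the lower
bound an i.i.d. sample from `ν` has, with positive probability, an empirical measure near `ν` and
nearly the right energy; a box of comparable configurations around it has volume `exp (-o(n²))`
(`eventually_exp_le_gasMass`). Applying both to the whole space controls the normalising constant.

Uniqueness of the minimiser is strict convexity: with `x = (1 + cos θ) / 2`, formally `-log |x - y|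
= 2 log 2 + ∑ (2 / k) Tₖ(2x - 1) Tₖ(2y - 1)`, so the energy is a constant plus a positive definite
quadratic form in the Chebyshev moments (`energy_minimizer_unique`). An upper bound on the
complement of a neighbourhood of the minimiser then gives convergence in probability. -/

/-- `∏ (1 - yᵢ + yᵢ X)`, the polynomial with value `1` at `1` and zeros `1 - 1 / yᵢ`. -/
def bernoulliPoly {n : ℕ} (y : Fin n → ℝ) : ℝ[X] := ∏ i, (C (1 - y i) + C (y i) * X)

theorem natDegree_prod_linear_le {n : ℕ} (y : Fin n → ℝ) (s : Finset (Fin n)) :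
    (∏ i ∈ s, (C (1 - y i) + C (y i) * X)).natDegree ≤ s.card := by
  refine (natDegree_prod_le _ _).trans ?_
  calc ∑ i ∈ s, (C (1 - y i) + C (y i) * X).natDegree ≤ ∑ i ∈ s, 1 := by
        refine Finset.sum_le_sum fun i _ => ?_
        rw [add_comm]; exact natDegree_linear_le
    _ = s.card := by simp

theorem natDegree_bernoulliPoly_le {n : ℕ} (y : Fin n → ℝ) : (bernoulliPoly y).natDegree ≤ n := by
  have h := natDegree_prod_linear_le y Finset.univ
  rwa [Finset.card_univ, Fintype.card_fin] at h

theorem eval_bernoulliPoly {n : ℕ} (y : Fin n → ℝ) (t : ℝ) :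
    (bernoulliPoly y).eval t = ∏ i, (1 - y i + y i * t) := by
  simp [bernoulliPoly, eval_prod]

theorem coeff_prod_linear_pos {n : ℕ} {y : Fin n → ℝ} (hy : ∀ i, y i ∈ Set.Ioo (0 : ℝ) 1)
    (s : Finset (Fin n)) :
    ∀ k ≤ s.card, 0 < (∏ i ∈ s, (C (1 - y i) + C (y i) * X)).coeff k := by
  induction s using Finset.induction_on with
  | empty => intro k hk; simp at hk; simp [hk]
  | insert a s ha ih =>
    intro k hk
    rw [Finset.card_insert_of_notMem ha] at hk
    rw [Finset.prod_insert ha, add_mul, coeff_add, coeff_C_mul, mul_assoc, coeff_C_mul]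
    have h1 := (hy a).1
    have h2 : 0 < 1 - y a := by linarith [(hy a).2]
    cases k with
    | zero => simpa using mul_pos h2 (ih 0 (Nat.zero_le _))
    | succ k =>
      rw [coeff_X_mul]
      have h3 := ih k (by omega)
      rcases Nat.lt_or_ge s.card (k + 1) with h | h
      · rw [coeff_eq_zero_of_natDegree_lt ((natDegree_prod_linear_le y s).trans_lt h)]
        simpa using mul_pos h1 h3
      · exact add_pos (mul_pos h2 (ih _ h)) (mul_pos h1 h3)

theorem coeff_bernoulliPoly_pos {n : ℕ} {y : Fin n → ℝ} (hy : ∀ i, y i ∈ Set.Ioo (0 : ℝ) 1)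
    {k : ℕ} (hk : k ≤ n) : 0 < (bernoulliPoly y).coeff k :=
  coeff_prod_linear_pos hy Finset.univ k (by simpa using hk)

/-- The coefficients of `v₀ ∏ (1 - yᵢ + yᵢ X)` where `v = (v₀, y)`. -/
def coeffMap (n : ℕ) (v : Fin (n + 1) → ℝ) : Fin (n + 1) → ℝ :=
  fun k => v 0 * (bernoulliPoly (Fin.tail v)).coeff k

/-- The polynomials whose coefficients are the columns of the Jacobian matrix of `coeffMap`. -/
def jacobianPoly (n : ℕ) (v : Fin (n + 1) → ℝ) : Fin (n + 1) → ℝ[X] :=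
  Fin.cons (bernoulliPoly (Fin.tail v)) fun i =>
    C (v 0) * (X - 1) * ∏ j ∈ {i}ᶜ, (C (1 - v j.succ) + C (v j.succ) * X)

/-- The Jacobian matrix of `coeffMap`. -/
def jacobianMatrix (n : ℕ) (v : Fin (n + 1) → ℝ) : Matrix (Fin (n + 1)) (Fin (n + 1)) ℝ :=
  Matrix.of fun k c => (jacobianPoly n v c).coeff k

theorem natDegree_jacobianPoly_le (n : ℕ) (v : Fin (n + 1) → ℝ) (c : Fin (n + 1)) :
    (jacobianPoly n v c).natDegree ≤ n := by
  refine Fin.cases ?_ (fun i => ?_) c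
  · exact natDegree_bernoulliPoly_le _
  · have h1 := natDegree_prod_linear_le (Fin.tail v) {i}ᶜ
    have h2 : (C (v 0) * (X - 1 : ℝ[X])).natDegree ≤ 1 :=
      (natDegree_C_mul_le _ _).trans (by simpa using (natDegree_X_sub_C_le (1 : ℝ)))
    have h3 : ({i}ᶜ : Finset (Fin n)).card = n - 1 := by simp [Finset.card_compl]
    have : 0 < n := i.pos
    simp only [jacobianPoly, Fin.cons_succ]
    refine natDegree_mul_le.trans ?_
    simp only [Fin.tail] at h1
    omega

/-- Multiplying by a Vandermonde matrix converts coefficients into values at the nodes. The nodes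
are free: fixed ones serve to differentiate `coeffMap`, the zeros themselves to compute the
determinant. -/
theorem vandermonde_mul_jacobianMatrix (n : ℕ) (v t : Fin (n + 1) → ℝ) :
    Matrix.vandermonde t * jacobianMatrix n v =
      Matrix.of fun k c => (jacobianPoly n v c).eval (t k) := by
  ext k c
  rw [Matrix.mul_apply, Matrix.of_apply,
    eval_eq_sum_range' (Nat.lt_succ_of_le (natDegree_jacobianPoly_le n v c)),
    Finset.sum_range]
  exact Finset.sum_congr rfl fun i _ => by
    simp [Matrix.vandermonde_apply, jacobianMatrix, mul_comm]

theorem vandermonde_mulVec_coeffMap (n : ℕ) (v t : Fin (n + 1) → ℝ) :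
    (Matrix.vandermonde t).mulVec (coeffMap n v) =
      fun k => v 0 * ∏ i : Fin n, (1 - v i.succ + v i.succ * t k) := by
  ext k
  have h := eval_bernoulliPoly (Fin.tail v) (t k)
  rw [eval_eq_sum_range' (Nat.lt_succ_of_le (natDegree_bernoulliPoly_le _)),
    Finset.sum_range] at h
  change _ = v 0 * ∏ i : Fin n, (1 - Fin.tail v i + Fin.tail v i * t k)
  rw [← h, Finset.mul_sum, Matrix.mulVec, dotProduct]
  exact Finset.sum_congr rfl fun i _ => by
    simp only [Matrix.vandermonde_apply, coeffMap]; ring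

/-- Values at `n + 1` fixed nodes are explicit products, easy to differentiate; the invertible
Vandermonde matrix then carries the derivative back to the coefficients. -/
theorem hasFDerivAt_coeffMap (n : ℕ) (v : Fin (n + 1) → ℝ) :
    HasFDerivAt (coeffMap n)
      (LinearMap.toContinuousLinearMap (Matrix.toLin' (jacobianMatrix n v))) v := by
  set t : Fin (n + 1) → ℝ := fun k => (k : ℝ) with ht
  set V := Matrix.vandermonde t
  have hV : IsUnit V.det := by
    rw [isUnit_iff_ne_zero, Matrix.det_vandermonde_ne_zero_iff]
    intro a b h
    simp only [ht] at h
    exact Fin.ext (by exact_mod_cast h)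
  have hW : HasFDerivAt (fun v : Fin (n + 1) → ℝ => V.mulVec (coeffMap n v))
      (LinearMap.toContinuousLinearMap (Matrix.toLin' (V * jacobianMatrix n v))) v := by
    have h1 : (fun v : Fin (n + 1) → ℝ => V.mulVec (coeffMap n v)) =
        fun v k => v 0 * ∏ i : Fin n, (1 - v i.succ + v i.succ * t k) := by
      funext v; exact vandermonde_mulVec_coeffMap n v t
    rw [h1, hasFDerivAt_pi']
    intro k
    have hp : ∀ c : Fin (n + 1), HasFDerivAt (fun v : Fin (n + 1) → ℝ => v c)
        (ContinuousLinearMap.proj (R := ℝ) (φ := fun _ : Fin (n + 1) => ℝ) c) v :=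
      fun c => (ContinuousLinearMap.proj (R := ℝ) (φ := fun _ : Fin (n + 1) => ℝ) c).hasFDerivAt
    have h2 := (hp 0).mul (HasFDerivAt.finsetProd (u := Finset.univ)
      (fun (i : Fin n) _ => ((hp i.succ).const_sub 1).add ((hp i.succ).mul_const (t k))))
    refine h2.congr_fderiv ?_
    ext h
    rw [vandermonde_mul_jacobianMatrix]
    simp [Matrix.mulVec, dotProduct, Fin.sum_univ_succ, jacobianPoly, eval_prod,
      bernoulliPoly, Fin.tail, Finset.mul_sum, Finset.compl_eq_univ_sdiff,
      Finset.sdiff_singleton_eq_erase]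
    rw [add_comm]
    congr 1
    exact Finset.sum_congr rfl fun i _ => by ring
  have h3 := ((LinearMap.toContinuousLinearMap (Matrix.toLin' V⁻¹)).hasFDerivAt).comp v hW
  have h4 : (LinearMap.toContinuousLinearMap (Matrix.toLin' V⁻¹)) ∘
      (fun v : Fin (n + 1) → ℝ => V.mulVec (coeffMap n v)) = coeffMap n := by
    funext w
    simp [Matrix.nonsing_inv_mul V hV]
  rw [h4] at h3
  refine h3.congr_fderiv ?_
  ext h : 1
  simp [Matrix.nonsing_inv_mul_cancel_left _ _ hV]

/-- Evaluated at `1` and at the zeros `1 - 1 / yᵢ`, the Jacobian columns form a diagonal matrix, so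
the determinant is a quotient of explicit products. -/
theorem abs_det_jacobianMatrix {n : ℕ} {v : Fin (n + 1) → ℝ}
    (hy : ∀ i : Fin n, v i.succ ≠ 0) (hinj : Function.Injective (Fin.tail v)) :
    |(jacobianMatrix n v).det| =
      |v 0| ^ n * ∏ i : Fin n, ∏ j ∈ Finset.Ioi i, |v j.succ - v i.succ| := by
  set z : Fin (n + 1) → ℝ := Fin.cons 1 fun i => 1 - 1 / v i.succ with hz
  have hzd : ∀ i j : Fin n, z j.succ - z i.succ = (v j.succ - v i.succ) / (v i.succ * v j.succ) := by
    intro i j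
    simp only [hz, Fin.cons_succ]
    have := hy i
    have := hy j
    field_simp
    ring
  have hne : ∀ i j : Fin n, i ≠ j → v j.succ - v i.succ ≠ 0 := fun i j hij h =>
    hij (hinj (by simp only [Fin.tail]; linarith))
  have hE : Matrix.vandermonde z * jacobianMatrix n v = Matrix.diagonal
      (Fin.cons 1 fun i => v 0 * (-1 / v i.succ) *
        ∏ j ∈ {i}ᶜ, ((v i.succ - v j.succ) / v i.succ)) := by
    rw [vandermonde_mul_jacobianMatrix]
    ext k c
    refine Fin.cases ?_ (fun k => ?_) k <;> refine Fin.cases ?_ (fun c => ?_) c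
    · simp [jacobianPoly, eval_bernoulliPoly, hz]
    · simp [jacobianPoly, hz, (Fin.succ_ne_zero _).symm]
    · simp only [jacobianPoly, eval_bernoulliPoly, hz, Matrix.of_apply, Fin.cons_succ,
        Fin.cons_zero, Fin.tail]
      rw [Matrix.diagonal_apply_ne _ (Fin.succ_ne_zero _)]
      refine Finset.prod_eq_zero (Finset.mem_univ k) ?_
      have := hy k
      field_simp
      ring
    · simp only [jacobianPoly, hz, Matrix.of_apply, Fin.cons_succ]
      by_cases hkc : k = c
      · subst hkc
        rw [Matrix.diagonal_apply_eq]
        simp only [Fin.cons_succ, eval_mul, eval_C, eval_sub, eval_X, eval_one, eval_prod, eval_add]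
        have := hy k
        congr 1
        · ring
        · refine Finset.prod_congr rfl fun j _ => ?_
          field_simp
          ring
      · rw [Matrix.diagonal_apply_ne _ (by simpa using hkc), eval_mul, eval_prod]
        refine mul_eq_zero_of_right _ (Finset.prod_eq_zero (i := k) (by simpa using hkc) ?_)
        simp only [eval_mul, eval_C, eval_X, eval_add]
        have := hy k
        field_simp
        ring
  have hdet := congrArg (fun M => |Matrix.det M|) hE
  simp only [Matrix.det_mul, Matrix.det_diagonal, Matrix.det_vandermonde, abs_mul,
    Fin.prod_univ_succ, Fin.prod_Ioi_succ, Fin.prod_Ioi_zero, Fin.cons_zero, Fin.cons_succ,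
    one_mul, Finset.prod_mul_distrib] at hdet
  -- Pairing `(i, j)` with `(j, i)` leaves one Vandermonde product in `z` times one in `y`; the
  -- former cancels against the determinant on the left.
  rw [← Finset.prod_prod_Ioi_mul_eq_prod_prod_off_diag
    (fun j i : Fin n => (v i.succ - v j.succ) / v i.succ)] at hdet
  have hA : ∏ i : Fin n, (z i.succ - z 0) = ∏ i : Fin n, (-1 / v i.succ) :=
    Finset.prod_congr rfl fun i _ => by simp [hz]; ring
  have hB : |∏ i : Fin n, ∏ j ∈ Finset.Ioi i,
      ((v i.succ - v j.succ) / v i.succ * ((v j.succ - v i.succ) / v j.succ))| =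
      |∏ i : Fin n, ∏ j ∈ Finset.Ioi i, (z j.succ - z i.succ)| *
        ∏ i : Fin n, ∏ j ∈ Finset.Ioi i, |v j.succ - v i.succ| := by
    simp only [Finset.abs_prod, ← Finset.prod_mul_distrib]
    refine Finset.prod_congr rfl fun i _ => Finset.prod_congr rfl fun j _ => ?_
    rw [hzd, ← abs_mul, ← abs_neg]
    congr 1
    ring
  have hA0 : |∏ i : Fin n, (-1 / v i.succ)| ≠ 0 :=
    abs_ne_zero.2 (Finset.prod_ne_zero_iff.2 fun i _ => div_ne_zero (by norm_num) (hy i))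
  have hB0 : |∏ i : Fin n, ∏ j ∈ Finset.Ioi i, (z j.succ - z i.succ)| ≠ 0 := by
    refine abs_ne_zero.2 (Finset.prod_ne_zero_iff.2 fun i _ => Finset.prod_ne_zero_iff.2
      fun j hj => ?_)
    rw [hzd]
    exact div_ne_zero (hne i j (Finset.mem_Ioi.1 hj).ne) (mul_ne_zero (hy i) (hy j))
  rw [hA] at hdet
  refine mul_left_cancel₀ (mul_ne_zero hA0 hB0) ?_
  rw [hdet, hB, Finset.prod_const, Finset.card_univ, Fintype.card_fin, abs_pow]
  ring

/-- Two equal `y`'s give two equal columns. This makes polynomials with a multiple zero negligible.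
-/
theorem det_jacobianMatrix_eq_zero {n : ℕ} {v : Fin (n + 1) → ℝ}
    (hinj : ¬ Function.Injective (Fin.tail v)) : (jacobianMatrix n v).det = 0 := by
  obtain ⟨i, j, hij, hne⟩ := Function.not_injective_iff.1 hinj
  refine Matrix.det_zero_of_column_eq (i := i.succ) (j := j.succ) (by simpa using hne) fun k => ?_
  simp only [jacobianMatrix, jacobianPoly, Matrix.of_apply, Fin.cons_succ]
  congr 2
  refine Finset.prod_bij' (fun k _ => Equiv.swap i j k) (fun k _ => Equiv.swap i j k)
    (fun k hk => ?_) (fun k hk => ?_) (by simp) (by simp) (fun k hk => ?_)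
  · simp only [Finset.mem_compl, Finset.mem_singleton] at hk ⊢
    rwa [Equiv.swap_apply_eq_iff, Equiv.swap_apply_right]
  · simp only [Finset.mem_compl, Finset.mem_singleton] at hk ⊢
    rwa [Equiv.swap_apply_eq_iff, Equiv.swap_apply_left]
  · have : v (Equiv.swap i j k).succ = v k.succ := by
      simp only [Finset.mem_compl, Finset.mem_singleton] at hk
      by_cases hkj : k = j
      · subst hkj; rw [Equiv.swap_apply_right]; exact hij
      · rw [Equiv.swap_apply_of_ne_of_ne hk hkj]
    rw [this]

/-! ### Zeros -/

/-- The polynomial with coefficients `c₀, …, cₙ`. -/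
def polyOfCoeffs {n : ℕ} (c : Fin (n + 1) → ℝ) : ℝ[X] := ∑ k, C (c k) * X ^ (k : ℕ)

theorem coeff_polyOfCoeffs {n : ℕ} (c : Fin (n + 1) → ℝ) (k : Fin (n + 1)) :
    (polyOfCoeffs c).coeff k = c k := by
  simp only [polyOfCoeffs, finsetSum_coeff, coeff_C_mul, coeff_X_pow]
  rw [Finset.sum_eq_single k]
  · simp
  · intro b _ hb
    rw [if_neg (fun h => hb (Fin.ext h.symm)), mul_zero]
  · simp

theorem natDegree_polyOfCoeffs_le {n : ℕ} (c : Fin (n + 1) → ℝ) :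
    (polyOfCoeffs c).natDegree ≤ n :=
  natDegree_sum_le_of_forall_le _ _ fun k _ =>
    (natDegree_C_mul_X_pow_le _ _).trans (Nat.lt_succ_iff.1 k.2)

theorem natDegree_polyOfCoeffs {n : ℕ} {c : Fin (n + 1) → ℝ} (hc : c (Fin.last n) ≠ 0) :
    (polyOfCoeffs c).natDegree = n :=
  le_antisymm (natDegree_polyOfCoeffs_le c) (le_natDegree_of_ne_zero (by
    have := coeff_polyOfCoeffs c (Fin.last n)
    rw [Fin.val_last] at this
    rwa [this]))

theorem polyOfCoeffs_eq_of_coeff {n : ℕ} {c : Fin (n + 1) → ℝ} {p : ℝ[X]} (hp : p.natDegree ≤ n)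
    (h : ∀ k : Fin (n + 1), c k = p.coeff k) : polyOfCoeffs c = p := by
  ext k
  rcases Nat.lt_or_ge n k with hk | hk
  · rw [coeff_eq_zero_of_natDegree_lt (hp.trans_lt hk),
      coeff_eq_zero_of_natDegree_lt ((natDegree_polyOfCoeffs_le c).trans_lt hk)]
  · have := coeff_polyOfCoeffs c ⟨k, Nat.lt_succ_of_le hk⟩
    rw [h] at this
    exact this

theorem polyOfCoeffs_coeffMap (n : ℕ) (v : Fin (n + 1) → ℝ) :
    polyOfCoeffs (coeffMap n v) = C (v 0) * bernoulliPoly (Fin.tail v) :=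
  polyOfCoeffs_eq_of_coeff ((natDegree_C_mul_le _ _).trans (natDegree_bernoulliPoly_le _))
    fun k => by simp [coeffMap]

theorem bernoulliPoly_eq_prod_X_sub_C {n : ℕ} {y : Fin n → ℝ} (hy : ∀ i, y i ≠ 0) :
    bernoulliPoly y = C (∏ i, y i) * ∏ i, (X - C (1 - 1 / y i)) := by
  rw [map_prod, ← Finset.prod_mul_distrib]
  refine Finset.prod_congr rfl fun i _ => ?_
  rw [mul_sub, ← C_mul, mul_sub, mul_one_div_cancel (hy i), mul_one]
  simp only [map_sub, map_one]
  ring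

theorem aroots_C_mul_bernoulliPoly {n : ℕ} {s : ℝ} (hs : s ≠ 0) {y : Fin n → ℝ}
    (hy : ∀ i, y i ≠ 0) :
    (C s * bernoulliPoly y).aroots ℂ =
      Finset.univ.val.map fun i => ((1 - 1 / y i : ℝ) : ℂ) := by
  rw [bernoulliPoly_eq_prod_X_sub_C hy, ← mul_assoc, ← C_mul, aroots_def, Polynomial.map_mul,
    map_C, roots_C_mul]
  · rw [Polynomial.map_prod]
    simp only [Polynomial.map_sub, map_X, map_C]
    rw [roots_prod _ _ (Finset.prod_ne_zero_iff.2 fun i _ => X_sub_C_ne_zero _)]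
    simp only [roots_X_sub_C, Multiset.bind_singleton, Complex.coe_algebraMap]
  · simpa [Finset.prod_eq_zero_iff, hs] using hy

theorem roots_C_mul_bernoulliPoly {n : ℕ} {s : ℝ} (hs : s ≠ 0) {y : Fin n → ℝ}
    (hy : ∀ i, y i ≠ 0) :
    (C s * bernoulliPoly y).roots = Finset.univ.val.map fun i => 1 - 1 / y i := by
  rw [bernoulliPoly_eq_prod_X_sub_C hy, ← mul_assoc, ← C_mul, roots_C_mul]
  · rw [roots_prod _ _ (Finset.prod_ne_zero_iff.2 fun i _ => X_sub_C_ne_zero _)]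
    simp only [roots_X_sub_C, Multiset.bind_singleton]
  · simpa [Finset.prod_eq_zero_iff, hs] using hy

/-- Increasing configurations of `n` distinct points in `(0, 1)`. -/
def configs (n : ℕ) : Set (Fin n → ℝ) := {y | StrictMono y ∧ ∀ i, y i ∈ Set.Ioo (0 : ℝ) 1}

/-- Coordinates `(S, y)` with `S > 0` and `y` a configuration. -/
def coordDomain (n : ℕ) : Set (Fin (n + 1) → ℝ) := {v | 0 < v 0 ∧ Fin.tail v ∈ configs n}

/-- The value at `1` recovers `S`; the roots recover the set of the `yᵢ`, and a strictly increasing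
sequence is determined by its range. -/
theorem injOn_coeffMap (n : ℕ) : Set.InjOn (coeffMap n) (coordDomain n) := by
  rintro v ⟨hv0, hv, hv1⟩ w ⟨hw0, hw, hw1⟩ h
  have h1 := congrArg polyOfCoeffs h
  rw [polyOfCoeffs_coeffMap, polyOfCoeffs_coeffMap] at h1
  have h2 := congrArg (eval 1) h1
  simp [eval_bernoulliPoly] at h2
  have h3 := congrArg roots h1
  rw [roots_C_mul_bernoulliPoly hv0.ne' fun i => (hv1 i).1.ne',
    roots_C_mul_bernoulliPoly hw0.ne' fun i => (hw1 i).1.ne'] at h3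
  have h4 : Set.range (Fin.tail v) = Set.range (Fin.tail w) := by
    have h5 := congrArg (fun s => {x | x ∈ Multiset.map (fun r : ℝ => 1 / (1 - r)) s}) h3
    simpa [Set.ext_iff] using h5
  have h6 := (StrictMono.range_inj hv hw).1 h4
  rw [← Fin.cons_self_tail v, ← Fin.cons_self_tail w, h2, h6]

/-- Evaluation at `1`. Because of this the product of exponential densities depends on `S` alone. -/
theorem sum_coeffMap (n : ℕ) (v : Fin (n + 1) → ℝ) : ∑ k, coeffMap n v k = v 0 := by
  have h := eval_bernoulliPoly (Fin.tail v) 1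
  rw [eval_eq_sum_range' (Nat.lt_succ_of_le (natDegree_bernoulliPoly_le _)),
    Finset.sum_range] at h
  simp at h
  simp [coeffMap, ← Finset.mul_sum, h]

theorem coeffMap_pos {n : ℕ} {v : Fin (n + 1) → ℝ} (h0 : 0 < v 0)
    (hv : ∀ i, Fin.tail v i ∈ Set.Ioo (0 : ℝ) 1) (k : Fin (n + 1)) : 0 < coeffMap n v k :=
  mul_pos h0 (coeff_bernoulliPoly_pos hv (Nat.lt_succ_iff.1 k.2))

/-- A polynomial with positive coefficients and real zeros comes from some `(S, y)`. -/
theorem exists_coeffMap_eq {n : ℕ} {c : Fin (n + 1) → ℝ} (hc : ∀ k, 0 < c k)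
    (hr : ∀ z ∈ (polyOfCoeffs c).aroots ℂ, z ∈ realLine) :
    ∃ v : Fin (n + 1) → ℝ, 0 < v 0 ∧ Monotone (Fin.tail v) ∧
      (∀ i, Fin.tail v i ∈ Set.Ioo (0 : ℝ) 1) ∧ coeffMap n v = c := by
  set p := polyOfCoeffs c with hp
  have hdeg : p.natDegree = n := natDegree_polyOfCoeffs (hc _).ne'
  set s : Multiset ℝ := (p.aroots ℂ).map Complex.re with hs
  have hmap : s.map ((↑) : ℝ → ℂ) = p.aroots ℂ := by
    rw [hs, Multiset.map_map]
    conv_rhs => rw [← Multiset.map_id (p.aroots ℂ)]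
    refine Multiset.map_congr rfl fun z hz => ?_
    obtain ⟨x, rfl⟩ := hr z hz
    simp
  have hfac : p = C p.leadingCoeff * (s.map fun r => X - C r).prod := by
    apply Polynomial.map_injective (algebraMap ℝ ℂ) (algebraMap ℝ ℂ).injective
    have h1 := (IsAlgClosed.splits (p.map (algebraMap ℝ ℂ))).eq_prod_roots
    rw [h1, Polynomial.map_mul, map_C, leadingCoeff_map, Polynomial.map_multiset_prod,
      Multiset.map_map]
    congr 2
    rw [← aroots_def, ← hmap, Multiset.map_map]
    refine Multiset.map_congr rfl fun x _ => ?_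
    simp
  have hcard : s.card = n := by
    have h1 := (IsAlgClosed.splits (p.map (algebraMap ℝ ℂ))).natDegree_eq_card_roots
    rw [natDegree_map, hdeg] at h1
    rw [hs, Multiset.card_map]
    exact h1.symm
  -- At `r ≥ 0` a polynomial with positive coefficients is positive.
  have hneg : ∀ r ∈ s, r < 0 := by
    intro r hrs
    by_contra hr0
    have h1 : p.eval r = 0 := by
      rw [hfac, eval_mul, eval_multiset_prod, Multiset.map_map]
      refine mul_eq_zero_of_right _ (Multiset.prod_eq_zero ?_)
      exact Multiset.mem_map.2 ⟨r, hrs, by simp⟩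
    have h2 : 0 < p.eval r := by
      rw [hp, polyOfCoeffs, eval_finsetSum]
      refine Finset.sum_pos' (fun k _ => ?_) ⟨0, Finset.mem_univ _, ?_⟩
      · simp only [eval_mul, eval_C, eval_pow, eval_X]
        exact mul_nonneg (hc k).le (pow_nonneg (not_lt.1 hr0) _)
      · simpa using hc 0
    exact h2.ne' h1
  set l : List ℝ := (s.map fun r => 1 / (1 - r)).sort (· ≤ ·) with hl
  have hll : l.length = n := by rw [hl, Multiset.length_sort, Multiset.card_map, hcard]
  set y : Fin n → ℝ := fun i => l.get (i.cast hll.symm) with hy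
  have hymap : Finset.univ.val.map y = s.map fun r => 1 / (1 - r) := by
    have h1 : ((l : List ℝ) : Multiset ℝ) = s.map fun r => 1 / (1 - r) := Multiset.sort_eq _ _
    rw [← h1]
    have h2 : List.ofFn y = l := by
      refine List.ext_get (by simp [hll]) fun i h1 h2 => by simp [hy]
    rw [← h2, Fin.univ_val_map]
  have hy01 : ∀ i, y i ∈ Set.Ioo (0 : ℝ) 1 := by
    intro i
    have h1 : y i ∈ Finset.univ.val.map y := Multiset.mem_map.2 ⟨i, by simp, rfl⟩
    rw [hymap] at h1
    obtain ⟨r, hrs, hre⟩ := Multiset.mem_map.1 h1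
    have := hneg r hrs
    rw [← hre]
    refine ⟨by apply one_div_pos.2; linarith, ?_⟩
    rw [div_lt_one (by linarith)]
    linarith
  have hymono : Monotone y := by
    intro i j hij
    have : l.Pairwise (· ≤ ·) := Multiset.pairwise_sort _ _
    exact this.rel_get_of_le (by simpa using hij)
  have hsmap : Finset.univ.val.map (fun i => 1 - 1 / y i) = s := by
    have h1 := congrArg (Multiset.map fun t : ℝ => 1 - 1 / t) hymap
    rw [Multiset.map_map, Multiset.map_map] at h1
    rw [show (fun i => 1 - 1 / y i) = (fun t : ℝ => 1 - 1 / t) ∘ y from rfl, h1]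
    conv_rhs => rw [← Multiset.map_id s]
    exact Multiset.map_congr rfl fun r _ => by simp
  have hprod : 0 < ∏ i, y i := Finset.prod_pos fun i _ => (hy01 i).1
  have hlc : 0 < p.leadingCoeff := by
    have := coeff_polyOfCoeffs c (Fin.last n)
    rw [Fin.val_last] at this
    rw [leadingCoeff, hdeg, hp, this]
    exact hc _
  -- The leading coefficient of `bernoulliPoly y` is `∏ yᵢ`, which dictates `S`.
  refine ⟨Fin.cons (p.leadingCoeff / ∏ i, y i) y, div_pos hlc hprod, by simpa using hymono,
    by simpa using hy01, ?_⟩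
  have hfin : polyOfCoeffs (coeffMap n (Fin.cons (p.leadingCoeff / ∏ i, y i) y)) = p := by
    rw [polyOfCoeffs_coeffMap, Fin.cons_zero, Fin.tail_cons,
      bernoulliPoly_eq_prod_X_sub_C fun i => (hy01 i).1.ne', ← mul_assoc, ← C_mul,
      div_mul_cancel₀ _ hprod.ne']
    conv_rhs => rw [hfac, ← hsmap, Multiset.map_map]
    rfl
  ext k
  exact (coeff_polyOfCoeffs _ k).symm.trans
    ((congrArg (fun q => q.coeff k) hfin).trans (coeff_polyOfCoeffs c k))

/-! ### Products of densities -/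

theorem lintegral_pi_prod {n : ℕ} (f : Fin n → ℝ → ℝ≥0∞) (hf : ∀ i, Measurable (f i)) :
    ∫⁻ x : Fin n → ℝ, ∏ i, f i (x i) = ∏ i, ∫⁻ t, f i t := by
  induction n with
  | zero => simp [volume_pi]
  | succ n ih =>
    have h := (volume_preserving_piFinSuccAbove (fun _ : Fin (n + 1) => ℝ) 0).symm
    rw [← h.lintegral_comp_emb (MeasurableEquiv.measurableEmbedding _)]
    simp only [MeasurableEquiv.piFinSuccAbove_symm_apply, Fin.insertNthEquiv_apply,
      Fin.insertNth_zero', Fin.prod_univ_succ, Fin.cons_zero, Fin.cons_succ]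
    rw [← ih (fun i => f i.succ) fun i => hf _, Measure.volume_eq_prod]
    exact lintegral_prod_mul (hf 0).aemeasurable
      (Finset.measurable_fun_prod _ fun (i : Fin n) _ => (hf i.succ).comp (measurable_pi_apply i)).aemeasurable

theorem pi_withDensity_eq {n : ℕ} {f : ℝ → ℝ≥0∞} (hf : Measurable f)
    [SigmaFinite (volume.withDensity f)] :
    Measure.pi (fun _ : Fin n => (volume : Measure ℝ).withDensity f) =
      (volume : Measure (Fin n → ℝ)).withDensity fun x => ∏ i, f (x i) := by
  refine Measure.pi_eq fun s hs => ?_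
  rw [withDensity_apply _ (MeasurableSet.univ_pi hs), ← lintegral_indicator (MeasurableSet.univ_pi hs)]
  have : ∀ x : Fin n → ℝ, (Set.univ.pi s).indicator (fun x => ∏ i, f (x i)) x =
      ∏ i, (s i).indicator f (x i) := by
    intro x
    by_cases hx : x ∈ Set.univ.pi s
    · rw [Set.indicator_of_mem hx]
      exact Finset.prod_congr rfl fun i _ => (Set.indicator_of_mem (hx i trivial) f).symm
    · rw [Set.indicator_of_notMem hx]
      simp only [Set.mem_univ_pi, not_forall] at hx
      obtain ⟨i, hi⟩ := hx
      exact (Finset.prod_eq_zero (Finset.mem_univ i) (Set.indicator_of_notMem hi f)).symm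
  simp_rw [this]
  rw [lintegral_pi_prod _ fun i => hf.indicator (hs i)]
  exact Finset.prod_congr rfl fun i _ => by
    rw [lintegral_indicator (hs i), withDensity_apply _ (hs i)]

theorem map_vec_eq_withDensity {Ω : Type*} [MeasurableSpace Ω] {P : Measure Ω}
    [IsProbabilityMeasure P] {ξ : ℕ → Ω → ℝ} (hmeas : ∀ j, Measurable (ξ j))
    (hlaw : ∀ j, HasLaw (ξ j) (expMeasure 1) P) (hindep : iIndepFun ξ P) (m : ℕ) :
    P.map (fun ω (k : Fin m) => ξ k ω) =
      (volume : Measure (Fin m → ℝ)).withDensity fun x => ∏ i, exponentialPDF 1 (x i) := by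
  have h1 : iIndepFun (fun k : Fin m => ξ k) P := hindep.precomp Fin.val_injective
  have h2 := (iIndepFun_iff_map_fun_eq_pi_map (fun k : Fin m => (hmeas k).aemeasurable)).1 h1
  have h3 : IsProbabilityMeasure ((volume : Measure ℝ).withDensity (exponentialPDF 1)) :=
    isProbabilityMeasure_expMeasure one_pos
  rw [h2, ← pi_withDensity_eq (f := exponentialPDF 1)
    (measurable_exponentialPDFReal 1).ennreal_ofReal]
  congr 1
  funext k
  exact (hlaw k).map_eq

theorem ae_pos_of_exp {Ω : Type*} [MeasurableSpace Ω] {P : Measure Ω}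
    {X : Ω → ℝ} (hlaw : HasLaw X (expMeasure 1) P) : ∀ᵐ ω ∂P, 0 < X ω := by
  have h : ∀ᵐ x ∂(expMeasure 1), 0 < x := by
    rw [ae_iff]
    simp only [not_lt]
    change (volume.withDensity (exponentialPDF 1)) (Set.Iic 0) = 0
    rw [withDensity_apply _ measurableSet_Iic, setLIntegral_congr Iio_ae_eq_Iic.symm]
    exact lintegral_exponentialPDF_of_nonpos le_rfl
  rw [← hlaw.map_eq] at h
  exact ae_of_ae_map hlaw.aemeasurable h

theorem prod_exponentialPDF {n : ℕ} {x : Fin n → ℝ} (hx : ∀ i, 0 < x i) :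
    ∏ i, exponentialPDF 1 (x i) = ENNReal.ofReal (Real.exp (-∑ i, x i)) := by
  rw [← Finset.sum_neg_distrib, Real.exp_sum, ENNReal.ofReal_prod_of_nonneg fun i _ => (Real.exp_pos _).le]
  refine Finset.prod_congr rfl fun i _ => ?_
  rw [exponentialPDF_of_nonneg (hx i).le]
  simp

/-! ### Volume of images under `coeffMap` -/

theorem measurableSet_configs (n : ℕ) : MeasurableSet (configs n) := by
  have : configs n = (⋂ i, ⋂ j, {y : Fin n → ℝ | i < j → y i < y j}) ∩
      ⋂ i, {y | y i ∈ Set.Ioo (0 : ℝ) 1} := by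
    ext y; simp [configs, StrictMono]
  rw [this]
  refine (MeasurableSet.iInter fun i => MeasurableSet.iInter fun j => ?_).inter
    (MeasurableSet.iInter fun i => measurable_pi_apply i measurableSet_Ioo)
  by_cases h : i < j
  · simpa [h] using measurableSet_lt (measurable_pi_apply i) (measurable_pi_apply j)
  · simp [h]

/-- The Vandermonde product `∏_{i<j} |yⱼ - yᵢ|`. -/
def vdm {n : ℕ} (y : Fin n → ℝ) : ℝ := ∏ i, ∏ j ∈ Finset.Ioi i, |y j - y i|

theorem vdm_nonneg {n : ℕ} (y : Fin n → ℝ) : 0 ≤ vdm y :=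
  Finset.prod_nonneg fun _ _ => Finset.prod_nonneg fun _ _ => abs_nonneg _

theorem measurable_vdm (n : ℕ) : Measurable (vdm : (Fin n → ℝ) → ℝ) := by
  unfold vdm
  fun_prop

theorem measurable_tail (n : ℕ) : Measurable (Fin.tail : (Fin (n + 1) → ℝ) → (Fin n → ℝ)) :=
  measurable_pi_lambda _ fun i => measurable_pi_apply i.succ

theorem lintegral_pow_mul_exp_neg (n : ℕ) :
    ∫⁻ t in Set.Ioi (0 : ℝ), ENNReal.ofReal (t ^ n * Real.exp (-t)) = n.factorial := by
  have h1 := Real.Gamma_eq_integral (s := n + 1) (by positivity)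
  have h2 := Real.GammaIntegral_convergent (s := n + 1) (by positivity)
  rw [Real.Gamma_nat_eq_factorial] at h1
  simp only [add_sub_cancel_right, Real.rpow_natCast] at h1 h2
  have h3 : ∀ t : ℝ, Real.exp (-t) * t ^ n = t ^ n * Real.exp (-t) := fun t => mul_comm _ _
  simp only [h3] at h1 h2
  rw [← ofReal_integral_eq_lintegral_ofReal h2, ← h1, ENNReal.ofReal_natCast]
  filter_upwards [ae_restrict_mem measurableSet_Ioi] with t ht
  exact mul_nonneg (pow_nonneg (Set.mem_Ioi.1 ht).le _) (Real.exp_pos _).le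

theorem measurableSet_coord {n : ℕ} {B : Set (Fin n → ℝ)} (hB : MeasurableSet B) :
    MeasurableSet {v : Fin (n + 1) → ℝ | 0 < v 0 ∧ Fin.tail v ∈ B} :=
  (measurableSet_lt measurable_const (measurable_pi_apply 0)).inter (measurable_tail n hB)

theorem coord_subset_coordDomain {n : ℕ} {B : Set (Fin n → ℝ)} (hBc : B ⊆ configs n) :
    {v : Fin (n + 1) → ℝ | 0 < v 0 ∧ Fin.tail v ∈ B} ⊆ coordDomain n :=
  fun _ hv => ⟨hv.1, hBc hv.2⟩

/-- By the change of variables formula the integrand is `S ^ n exp (-S)` times the Vandermonde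
product of `y`; it factorises, and the `S`-integral is `Γ(n + 1) = n!`. -/
theorem lintegral_image_coeffMap {n : ℕ} {B : Set (Fin n → ℝ)} (hB : MeasurableSet B)
    (hBc : B ⊆ configs n) :
    ∫⁻ x in coeffMap n '' {v | 0 < v 0 ∧ Fin.tail v ∈ B}, ∏ i, exponentialPDF 1 (x i) =
      n.factorial * ∫⁻ y in B, ENNReal.ofReal (vdm y) := by
  set D : Set (Fin (n + 1) → ℝ) := {v | 0 < v 0 ∧ Fin.tail v ∈ B} with hD
  have hDm : MeasurableSet D := measurableSet_coord hB
  rw [lintegral_image_eq_lintegral_abs_det_fderiv_mul volume hDm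
    (fun v _ => (hasFDerivAt_coeffMap n v).hasFDerivWithinAt)
    ((injOn_coeffMap n).mono (coord_subset_coordDomain hBc))]
  have h1 : ∀ v ∈ D, ENNReal.ofReal |(LinearMap.toContinuousLinearMap
      (Matrix.toLin' (jacobianMatrix n v))).det| * ∏ i, exponentialPDF 1 (coeffMap n v i) =
      ENNReal.ofReal (v 0 ^ n * Real.exp (-v 0)) * ENNReal.ofReal (vdm (Fin.tail v)) := by
    intro v hv
    have hc := hBc hv.2
    rw [prod_exponentialPDF (coeffMap_pos hv.1 hc.2), sum_coeffMap, LinearMap.det_toContinuousLinearMap,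
      LinearMap.det_toLin', abs_det_jacobianMatrix (fun i => (hc.2 i).1.ne') hc.1.injective,
      ← ENNReal.ofReal_mul (by positivity), ← ENNReal.ofReal_mul
        (mul_nonneg (pow_nonneg hv.1.le _) (Real.exp_pos _).le), abs_of_pos hv.1]
    congr 1
    simp only [vdm, Fin.tail]
    ring
  rw [setLIntegral_congr_fun hDm h1, ← lintegral_indicator hDm]
  have h2 := (volume_preserving_piFinSuccAbove (fun _ : Fin (n + 1) => ℝ) 0).symm
  rw [← h2.lintegral_comp_emb (MeasurableEquiv.measurableEmbedding _)]
  have h3 : ∀ q : ℝ × (Fin n → ℝ), D.indicator (fun v => ENNReal.ofReal (v 0 ^ n * Real.exp (-v 0)) *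
      ENNReal.ofReal (vdm (Fin.tail v)))
        ((MeasurableEquiv.piFinSuccAbove (fun _ : Fin (n + 1) => ℝ) 0).symm q) =
      (Set.Ioi 0).indicator (fun t => ENNReal.ofReal (t ^ n * Real.exp (-t))) q.1 *
        B.indicator (fun y => ENNReal.ofReal (vdm y)) q.2 := by
    rintro ⟨t, y⟩
    have hcons : (MeasurableEquiv.piFinSuccAbove (fun _ : Fin (n + 1) => ℝ) 0).symm (t, y) =
        Fin.cons t y := Fin.insertNth_zero' t y
    have hmem : (Fin.cons t y : Fin (n + 1) → ℝ) ∈ D ↔ t ∈ Set.Ioi 0 ∧ y ∈ B := by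
      simp [hD]
    rw [hcons]
    by_cases ht : t ∈ Set.Ioi (0 : ℝ)
    · by_cases hyB : y ∈ B
      · rw [Set.indicator_of_mem (hmem.2 ⟨ht, hyB⟩), Set.indicator_of_mem ht,
          Set.indicator_of_mem hyB, Fin.cons_zero, Fin.tail_cons]
      · rw [Set.indicator_of_notMem (fun h => hyB (hmem.1 h).2), Set.indicator_of_notMem hyB,
          mul_zero]
    · rw [Set.indicator_of_notMem (fun h => ht (hmem.1 h).1), Set.indicator_of_notMem ht, zero_mul]
  simp_rw [h3]
  rw [Measure.volume_eq_prod, lintegral_prod_mul, lintegral_indicator measurableSet_Ioi,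
    lintegral_indicator hB, lintegral_pow_mul_exp_neg]
  · exact (Measurable.indicator (by fun_prop) measurableSet_Ioi).aemeasurable
  · exact ((measurable_vdm n).ennreal_ofReal.indicator hB).aemeasurable

theorem measurableSet_image_coeffMap {n : ℕ} {B : Set (Fin n → ℝ)} (hB : MeasurableSet B)
    (hBc : B ⊆ configs n) : MeasurableSet (coeffMap n '' {v | 0 < v 0 ∧ Fin.tail v ∈ B}) :=
  measurable_image_of_fderivWithin (measurableSet_coord hB)
    (fun v _ => (hasFDerivAt_coeffMap n v).hasFDerivWithinAt)
    ((injOn_coeffMap n).mono (coord_subset_coordDomain hBc))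

/-- Sard's theorem: the Jacobian determinant vanishes on these points. -/
theorem volume_image_coeffMap_not_injective (n : ℕ) :
    volume (coeffMap n '' {v | ¬ Function.Injective (Fin.tail v)}) = 0 := by
  refine addHaar_image_eq_zero_of_det_fderivWithin_eq_zero volume
    (fun v _ => (hasFDerivAt_coeffMap n v).hasFDerivWithinAt) fun v hv => ?_
  rw [LinearMap.det_toContinuousLinearMap, LinearMap.det_toLin', det_jacobianMatrix_eq_zero hv]

/-! ### The map to the unit interval -/

/-- On `ℝ₋` this is `z ↦ 1 / (1 - z)`. -/
def toUnit (z : ℂ) : unitInterval :=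
  ⟨1 / (1 + |z.re|), by positivity, by
    rw [div_le_one (by positivity)]; linarith [abs_nonneg z.re]⟩

/-- The absolute value in `toUnit` serves only to have a continuous map on all of `ℂ`, so that
`pushUnit` is continuous on `M₁(ℂ)`. -/
theorem continuous_toUnit : Continuous toUnit := by
  refine Continuous.subtype_mk (Continuous.div continuous_const (by fun_prop) fun z => ?_) _
  positivity

/-- The push-forward of a measure under `toUnit`. -/
def pushUnit (μ : ProbabilityMeasure ℂ) : ProbabilityMeasure unitInterval :=
  μ.map continuous_toUnit.aemeasurable

theorem continuous_pushUnit : Continuous pushUnit :=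
  ProbabilityMeasure.continuous_map continuous_toUnit

/-- The point of the unit interval closest to `t`. -/
def clampUnit (t : ℝ) : unitInterval := Set.projIcc 0 1 zero_le_one t

theorem coe_clampUnit {t : ℝ} (ht : t ∈ Set.Icc (0 : ℝ) 1) : (clampUnit t : ℝ) = t := by
  rw [clampUnit, Set.projIcc_of_mem _ ht]

theorem toUnit_one_sub_inv {t : ℝ} (ht : t ∈ Set.Ioc (0 : ℝ) 1) :
    toUnit ((1 - 1 / t : ℝ) : ℂ) = clampUnit t := by
  apply Subtype.ext
  rw [coe_clampUnit ⟨ht.1.le, ht.2⟩]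
  have h1 : 1 - 1 / t ≤ 0 := by
    have := one_le_one_div ht.1 ht.2
    linarith
  simp only [toUnit, Complex.ofReal_re, abs_of_nonpos h1]
  rw [neg_sub, add_sub_cancel, one_div_one_div]

/-- The empirical measure of `n` points in the unit interval; `δ₀` for `n = 0`. -/
def unitEmp (n : ℕ) (y : Fin n → unitInterval) : ProbabilityMeasure unitInterval :=
  if h : n ≠ 0 then ⟨(n : ℝ≥0∞)⁻¹ • ∑ i, Measure.dirac (y i), ⟨by
    rw [Measure.smul_apply, Measure.finsetSum_apply]
    simp [ENNReal.inv_mul_cancel (Nat.cast_ne_zero.2 h) (ENNReal.natCast_ne_top n)]⟩⟩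
  else ⟨Measure.dirac 0, inferInstance⟩

theorem coe_unitEmp {n : ℕ} (hn : n ≠ 0) (y : Fin n → unitInterval) :
    (unitEmp n y : Measure unitInterval) = (n : ℝ≥0∞)⁻¹ • ∑ i, Measure.dirac (y i) := by
  exact congrArg ProbabilityMeasure.toMeasure (dif_pos hn)

theorem integral_unitEmp {n : ℕ} (hn : n ≠ 0) (y : Fin n → unitInterval)
    (f : C(unitInterval, ℝ)) :
    ∫ x, f x ∂(unitEmp n y : Measure unitInterval) = (n : ℝ)⁻¹ * ∑ i, f (y i) := by
  rw [coe_unitEmp hn, integral_smul_measure, integral_finsetSum_measure]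
  · simp
  · intro i _
    exact integrable_dirac (by simp)

theorem continuous_unitEmp (n : ℕ) : Continuous (unitEmp n) := by
  rcases eq_or_ne n 0 with rfl | hn
  · exact continuous_of_discreteTopology
  · rw [ProbabilityMeasure.continuous_iff_forall_continuousMap_continuous_integral]
    intro f
    simp only [integral_unitEmp hn]
    fun_prop

theorem continuous_unitEmp_clampUnit (n : ℕ) :
    Continuous fun y : Fin n → ℝ => unitEmp n fun i => clampUnit (y i) :=
  (continuous_unitEmp n).comp (continuous_pi fun i => continuous_projIcc.comp (continuous_apply i))

/-! ### Zeros of polynomials with positive coefficients -/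

theorem coe_empiricalMeasure {p : ℝ[X]} (hp : p.natDegree ≠ 0) :
    (empiricalMeasure p : Measure ℂ) = zeroMeasure p := by
  exact congrArg ProbabilityMeasure.toMeasure (dif_pos hp)

theorem natDegree_C_mul_bernoulliPoly {n : ℕ} {s : ℝ} (hs : 0 < s) {y : Fin n → ℝ}
    (hy : ∀ i, y i ∈ Set.Ioo (0 : ℝ) 1) : (C s * bernoulliPoly y).natDegree = n := by
  rw [natDegree_C_mul hs.ne']
  exact le_antisymm (natDegree_bernoulliPoly_le y)
    (le_natDegree_of_ne_zero (coeff_bernoulliPoly_pos hy le_rfl).ne')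

theorem coe_empiricalMeasure_bernoulliPoly {n : ℕ} (hn : n ≠ 0) {s : ℝ} (hs : 0 < s)
    {y : Fin n → ℝ} (hy : ∀ i, y i ∈ Set.Ioo (0 : ℝ) 1) :
    (empiricalMeasure (C s * bernoulliPoly y) : Measure ℂ) =
      (n : ℝ≥0∞)⁻¹ • ∑ i, Measure.dirac ((1 - 1 / y i : ℝ) : ℂ) := by
  rw [coe_empiricalMeasure (by rwa [natDegree_C_mul_bernoulliPoly hs hy]), zeroMeasure,
    aroots_C_mul_bernoulliPoly hs.ne' fun i => (hy i).1.ne', Multiset.map_map, Multiset.card_map]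
  simp only [Finset.card_val, Finset.card_univ, Fintype.card_fin]
  rfl

theorem pushUnit_empiricalMeasure_bernoulliPoly {n : ℕ} (hn : n ≠ 0) {s : ℝ} (hs : 0 < s)
    {y : Fin n → ℝ} (hy : ∀ i, y i ∈ Set.Ioo (0 : ℝ) 1) :
    pushUnit (empiricalMeasure (C s * bernoulliPoly y)) = unitEmp n fun i => clampUnit (y i) := by
  apply ProbabilityMeasure.toMeasure_injective
  rw [pushUnit, ProbabilityMeasure.toMeasure_map, coe_empiricalMeasure_bernoulliPoly hn hs hy,
    coe_unitEmp hn, Measure.map_smul, Measure.map_finset_sum continuous_toUnit.aemeasurable]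
  congr 1
  refine Finset.sum_congr rfl fun i _ => ?_
  rw [Measure.map_dirac' continuous_toUnit.measurable, toUnit_one_sub_inv ⟨(hy i).1, (hy i).2.le⟩]

theorem empiricalMeasure_mem_probOn {p : ℝ[X]} (hp : p.natDegree ≠ 0) {S : Set ℂ}
    (hS : MeasurableSet S) :
    empiricalMeasure p ∈ probOn S ↔ ∀ z ∈ p.aroots ℂ, z ∈ S := by
  have hcard : ∀ s : Multiset ℂ, (s.map Measure.dirac).sum Sᶜ = 0 ↔ ∀ z ∈ s, z ∈ S := by
    intro s
    induction s using Multiset.induction_on with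
    | empty => simp
    | cons a s ih => simp [ih, hS.compl]
  change (empiricalMeasure p : Measure ℂ) Sᶜ = 0 ↔ _
  rw [coe_empiricalMeasure hp, zeroMeasure, Measure.smul_apply, smul_eq_mul, mul_eq_zero, hcard]
  simp

theorem isClosed_realLine : IsClosed realLine := Complex.isometry_ofReal.isClosedEmbedding.isClosed_range

theorem isClosed_negLine : IsClosed negLine :=
  Complex.isometry_ofReal.isClosedEmbedding.isClosedMap _ isClosed_Iic

theorem negLine_subset_realLine : negLine ⊆ realLine := Set.image_subset_range _ _

theorem one_sub_inv_mem_negLine {t : ℝ} (ht : t ∈ Set.Ioc (0 : ℝ) 1) :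
    ((1 - 1 / t : ℝ) : ℂ) ∈ negLine := by
  refine ⟨_, ?_, rfl⟩
  have := one_le_one_div ht.1 ht.2
  simp only [Set.mem_Iic]
  linarith

theorem empiricalMeasure_bernoulliPoly_mem {n : ℕ} (hn : n ≠ 0) {s : ℝ} (hs : 0 < s)
    {y : Fin n → ℝ} (hy : ∀ i, y i ∈ Set.Ioo (0 : ℝ) 1) :
    empiricalMeasure (C s * bernoulliPoly y) ∈ probOn negLine := by
  rw [empiricalMeasure_mem_probOn (by rwa [natDegree_C_mul_bernoulliPoly hs hy])
    isClosed_negLine.measurableSet, aroots_C_mul_bernoulliPoly hs.ne' fun i => (hy i).1.ne']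
  intro z hz
  obtain ⟨i, -, rfl⟩ := Multiset.mem_map.1 hz
  exact one_sub_inv_mem_negLine ⟨(hy i).1, (hy i).2.le⟩

/-- Configurations whose empirical measure lies in `A`. -/
def configsIn (n : ℕ) (A : Set (ProbabilityMeasure unitInterval)) : Set (Fin n → ℝ) :=
  configs n ∩ {y | unitEmp n (fun i => clampUnit (y i)) ∈ A}

theorem measurableSet_configsIn_of_isOpen {n : ℕ} {A : Set (ProbabilityMeasure unitInterval)}
    (hA : IsOpen A) : MeasurableSet (configsIn n A) :=
  (measurableSet_configs n).inter (hA.preimage (continuous_unitEmp_clampUnit n)).measurableSet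

theorem measurableSet_configsIn_of_isClosed {n : ℕ} {A : Set (ProbabilityMeasure unitInterval)}
    (hA : IsClosed A) : MeasurableSet (configsIn n A) :=
  (measurableSet_configs n).inter (hA.preimage (continuous_unitEmp_clampUnit n)).measurableSet

theorem randomPoly_eq_polyOfCoeffs {Ω : Type*} (ξ : ℕ → Ω → ℝ) (n : ℕ) (ω : Ω) :
    randomPoly ξ n ω = polyOfCoeffs fun k : Fin (n + 1) => ξ k ω := by
  rw [randomPoly, polyOfCoeffs, Finset.sum_range]

/-- Allowing any closed `S` between `ℝ₋` and `ℝ` handles both conditionings at once, since the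
right-hand side does not involve `S`. The hypothesis `hinj` excludes multiple zeros, so that the
ordered `yᵢ` increase strictly. -/
theorem empiricalMeasure_mem_iff {n : ℕ} (hn : n ≠ 0) {S : Set ℂ} (hS : IsClosed S)
    (hS1 : negLine ⊆ S) (hS2 : S ⊆ realLine) (A : Set (ProbabilityMeasure unitInterval))
    {c : Fin (n + 1) → ℝ} (hc : ∀ k, 0 < c k)
    (hinj : c ∉ coeffMap n '' {v | ¬ Function.Injective (Fin.tail v)}) :
    (empiricalMeasure (polyOfCoeffs c) ∈ probOn S ∧
      pushUnit (empiricalMeasure (polyOfCoeffs c)) ∈ A) ↔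
    c ∈ coeffMap n '' {v | 0 < v 0 ∧ Fin.tail v ∈ configsIn n A} := by
  constructor
  · rintro ⟨h1, h2⟩
    rw [empiricalMeasure_mem_probOn (by rwa [natDegree_polyOfCoeffs (hc _).ne']) hS.measurableSet]
      at h1
    obtain ⟨v, hv0, hvm, hv1, rfl⟩ := exists_coeffMap_eq hc fun z hz => hS2 (h1 z hz)
    have hvi : Function.Injective (Fin.tail v) := by
      by_contra h
      exact hinj ⟨v, h, rfl⟩
    rw [polyOfCoeffs_coeffMap, pushUnit_empiricalMeasure_bernoulliPoly hn hv0 hv1] at h2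
    exact ⟨v, ⟨hv0, ⟨hvm.strictMono_of_injective hvi, hv1⟩, h2⟩, rfl⟩
  · rintro ⟨v, ⟨hv0, ⟨hvm, hv1⟩, h2⟩, rfl⟩
    rw [polyOfCoeffs_coeffMap, pushUnit_empiricalMeasure_bernoulliPoly hn hv0 hv1]
    refine ⟨?_, h2⟩
    exact measure_mono_null (Set.compl_subset_compl.2 hS1)
      (empiricalMeasure_bernoulliPoly_mem hn hv0 hv1)

/-- The probability that all zeros are real and their images in the unit interval have
empirical measure in `A`. -/
def gasMass (n : ℕ) (A : Set (ProbabilityMeasure unitInterval)) : ℝ≥0∞ :=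
  n.factorial * ∫⁻ y in configsIn n A, ENNReal.ofReal (vdm y)

/-! ### The law of the zeros as a logarithmic gas -/

section Law

variable {Ω : Type*} [MeasurableSpace Ω] {P : Measure Ω} [IsProbabilityMeasure P]
  {ξ : ℕ → Ω → ℝ}

theorem event_ae_eq (hmeas : ∀ j, Measurable (ξ j))
    (hlaw : ∀ j, HasLaw (ξ j) (expMeasure 1) P) (hindep : iIndepFun ξ P)
    {n : ℕ} (hn : n ≠ 0) {S : Set ℂ} (hS : IsClosed S)
    (hS1 : negLine ⊆ S) (hS2 : S ⊆ realLine) (A : Set (ProbabilityMeasure unitInterval)) :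
    {ω | empL ξ n ω ∈ probOn S ∧ pushUnit (empL ξ n ω) ∈ A} =ᵐ[P]
      (fun ω (k : Fin (n + 1)) => ξ k ω) ⁻¹'
        (coeffMap n '' {v | 0 < v 0 ∧ Fin.tail v ∈ configsIn n A}) := by
  have hpos : ∀ᵐ ω ∂P, ∀ k : Fin (n + 1), 0 < ξ k ω :=
    ae_all_iff.2 fun k => ae_pos_of_exp (hlaw k)
  have hvm : Measurable fun ω (k : Fin (n + 1)) => ξ k ω :=
    measurable_pi_lambda _ fun k => hmeas k
  have hnull : ∀ᵐ ω ∂P, (fun k : Fin (n + 1) => ξ k ω) ∉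
      coeffMap n '' {v | ¬ Function.Injective (Fin.tail v)} := by
    refine ae_of_ae_map hvm.aemeasurable (p := fun c => c ∉ _) ?_
    rw [map_vec_eq_withDensity hmeas hlaw hindep]
    refine (withDensity_absolutelyContinuous _ _).ae_le ?_
    exact measure_eq_zero_iff_ae_notMem.1 (volume_image_coeffMap_not_injective n)
  filter_upwards [hpos, hnull] with ω h1 h2
  have := empiricalMeasure_mem_iff hn hS hS1 hS2 A h1 h2
  rw [← randomPoly_eq_polyOfCoeffs] at this
  exact propext this

theorem measure_event_eq_gasMass (hmeas : ∀ j, Measurable (ξ j))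
    (hlaw : ∀ j, HasLaw (ξ j) (expMeasure 1) P) (hindep : iIndepFun ξ P)
    {n : ℕ} (hn : n ≠ 0) {S : Set ℂ} (hS : IsClosed S)
    (hS1 : negLine ⊆ S) (hS2 : S ⊆ realLine) {A : Set (ProbabilityMeasure unitInterval)}
    (hA : MeasurableSet (configsIn n A)) :
    P {ω | empL ξ n ω ∈ probOn S ∧ pushUnit (empL ξ n ω) ∈ A} = gasMass n A := by
  have hvm : Measurable fun ω (k : Fin (n + 1)) => ξ k ω :=
    measurable_pi_lambda _ fun k => hmeas k
  have himg := measurableSet_image_coeffMap hA Set.inter_subset_left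
  rw [measure_congr (event_ae_eq hmeas hlaw hindep hn hS hS1 hS2 A), ← Measure.map_apply hvm himg,
    map_vec_eq_withDensity hmeas hlaw hindep, withDensity_apply _ himg,
    lintegral_image_coeffMap hA Set.inter_subset_left, gasMass]

/-- Being almost surely equal to the preimage of a measurable image suffices for conditioning, so no
measurability of `empL` is needed. -/
theorem nullMeasurableSet_event (hmeas : ∀ j, Measurable (ξ j))
    (hlaw : ∀ j, HasLaw (ξ j) (expMeasure 1) P) (hindep : iIndepFun ξ P)
    {n : ℕ} (hn : n ≠ 0) {S : Set ℂ} (hS : IsClosed S)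
    (hS1 : negLine ⊆ S) (hS2 : S ⊆ realLine) :
    NullMeasurableSet {ω | empL ξ n ω ∈ probOn S} P := by
  have hvm : Measurable fun ω (k : Fin (n + 1)) => ξ k ω :=
    measurable_pi_lambda _ fun k => hmeas k
  have h1 := event_ae_eq hmeas hlaw hindep hn hS hS1 hS2 Set.univ
  simp only [Set.mem_univ, and_true] at h1
  exact ((hvm (measurableSet_image_coeffMap (measurableSet_configsIn_of_isOpen isOpen_univ)
    Set.inter_subset_left)).nullMeasurableSet).congr h1.symm

end Law

/-! ### Logarithmic energy on the unit interval -/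

/-- The kernel `-log |x - y|` on the unit interval. -/
def unitKernel (q : unitInterval × unitInterval) : ℝ≥0∞ :=
  (-ENNReal.log (edist q.1 q.2)).toENNReal

theorem continuous_unitKernel : Continuous unitKernel :=
  EReal.continuous_toENNReal.comp
    (continuous_neg.comp (ENNReal.continuous_log.comp (continuous_fst.edist continuous_snd)))

/-- The logarithmic energy `∬ -log |x - y| dν dν`. -/
def energy (ν : ProbabilityMeasure unitInterval) : ℝ≥0∞ :=
  ∫⁻ q, unitKernel q ∂((ν : Measure unitInterval).prod (ν : Measure unitInterval))

/-- The energy for the kernel truncated at height `M`. -/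
def truncEnergy (M : ℕ) (ν : ProbabilityMeasure unitInterval) : ℝ≥0∞ :=
  ∫⁻ q, min (unitKernel q) M ∂((ν : Measure unitInterval).prod (ν : Measure unitInterval))

/-- The truncated kernel is bounded and continuous, and `ν ↦ ν ⊗ ν` is weakly continuous. -/
theorem continuous_truncEnergy (M : ℕ) : Continuous (truncEnergy M) := by
  have hlt : ∀ q, min (unitKernel q) (M : ℝ≥0∞) ≠ ∞ := fun q =>
    ((min_le_right _ _).trans_lt (ENNReal.natCast_lt_top M)).ne
  let f : C(unitInterval × unitInterval, NNReal) :=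
    ⟨fun q => (min (unitKernel q) (M : ℝ≥0∞)).toNNReal, by
      refine continuous_iff_continuousAt.2 fun q => ?_
      exact (ENNReal.tendsto_toNNReal (hlt q)).comp
        (continuous_unitKernel.min continuous_const).continuousAt⟩
  have h := (ProbabilityMeasure.continuous_lintegral_continuousMap f).comp
    (ProbabilityMeasure.continuous_prod.comp
      (Continuous.prodMk continuous_id continuous_id :
        Continuous fun ν : ProbabilityMeasure unitInterval => (ν, ν)))
  refine h.congr fun ν => ?_
  refine lintegral_congr fun q => ?_
  exact ENNReal.coe_toNNReal (hlt q)

theorem energy_eq_iSup (ν : ProbabilityMeasure unitInterval) :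
    energy ν = ⨆ M, truncEnergy M ν := by
  have hmono : Monotone fun (M : ℕ) q => min (unitKernel q) (M : ℝ≥0∞) := fun M N h q =>
    min_le_min le_rfl (by exact_mod_cast h)
  simp only [energy, truncEnergy]
  rw [← lintegral_iSup (fun M => continuous_unitKernel.measurable.min measurable_const) hmono]
  refine lintegral_congr fun q => ?_
  rw [← inf_iSup_eq, ENNReal.iSup_natCast, inf_top_eq]

theorem lowerSemicontinuous_energy : LowerSemicontinuous energy := by
  have : energy = fun ν => ⨆ M, truncEnergy M ν := funext energy_eq_iSup
  rw [this]
  exact lowerSemicontinuous_iSup fun M => (continuous_truncEnergy M).lowerSemicontinuous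

theorem truncEnergy_mono (ν : ProbabilityMeasure unitInterval) :
    Monotone fun M => truncEnergy M ν := fun M N h =>
  lintegral_mono fun q => min_le_min le_rfl (by exact_mod_cast h)

/-- An atom at `x` would give `(x, x)` positive mass, and the kernel is infinite there. The main use
is at `x = 0`, which represents the missing point `-∞` of `ℝ₋`. -/
theorem measure_singleton_eq_zero_of_energy_ne_top {ν : ProbabilityMeasure unitInterval}
    (h : energy ν ≠ ∞) (x : unitInterval) : (ν : Measure unitInterval) {x} = 0 := by
  have h1 := ae_lt_top continuous_unitKernel.measurable h
  have h2 : ((ν : Measure unitInterval).prod (ν : Measure unitInterval)) ({x} ×ˢ {x}) = 0 := by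
    refine measure_mono_null ?_ (ae_iff.1 h1)
    rintro ⟨a, b⟩ ⟨ha, hb⟩
    simp only [Set.mem_singleton_iff] at ha hb
    subst ha; subst hb
    simp [unitKernel]
  rw [Measure.prod_prod] at h2
  exact mul_self_eq_zero.1 h2

/-! ### Measures on the negative half-line and on the unit interval -/

/-- The inverse `y ↦ 1 - 1 / y` of `toUnit` on the negative half-line. -/
def ofUnit (y : unitInterval) : ℂ := ((1 - 1 / (y : ℝ) : ℝ) : ℂ)

theorem measurable_ofUnit : Measurable ofUnit := by
  unfold ofUnit
  fun_prop

theorem toUnit_ofUnit {y : unitInterval} (hy : y ≠ 0) : toUnit (ofUnit y) = y := by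
  have hy0 : 0 < (y : ℝ) := lt_of_le_of_ne y.2.1 fun h => hy (Subtype.ext h.symm)
  rw [ofUnit, toUnit_one_sub_inv ⟨hy0, y.2.2⟩]
  exact Subtype.ext (coe_clampUnit y.2)

theorem ofUnit_toUnit {z : ℂ} (hz : z ∈ negLine) : ofUnit (toUnit z) = z := by
  obtain ⟨x, hx, rfl⟩ := hz
  simp only [ofUnit, toUnit, Complex.ofReal_re, abs_of_nonpos (Set.mem_Iic.1 hx)]
  congr 1
  rw [one_div_one_div]
  ring

theorem ofUnit_mem_negLine {y : unitInterval} (hy : y ≠ 0) : ofUnit y ∈ negLine :=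
  one_sub_inv_mem_negLine ⟨lt_of_le_of_ne y.2.1 fun h => hy (Subtype.ext h.symm), y.2.2⟩

theorem toUnit_ne_zero (z : ℂ) : toUnit z ≠ 0 := by
  intro h
  have h1 := congrArg Subtype.val h
  have h2 : (0 : ℝ) < 1 / (1 + |z.re|) := by positivity
  exact h2.ne' h1

theorem ae_mem_of_mem_probOn {S : Set ℂ} {μ : ProbabilityMeasure ℂ} (hμ : μ ∈ probOn S) :
    ∀ᵐ z ∂(μ : Measure ℂ), z ∈ S := hμ

theorem continuousAt_ofUnit {y : unitInterval} (hy : y ≠ 0) : ContinuousAt ofUnit y := by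
  have hy0 : (y : ℝ) ≠ 0 := fun h => hy (Subtype.ext h)
  unfold ofUnit
  exact Complex.continuous_ofReal.continuousAt.comp
    (continuousAt_const.sub (continuousAt_const.div continuous_subtype_val.continuousAt hy0))

theorem isOpen_ofUnit_preimage {G : Set ℂ} (hG : IsOpen G) :
    IsOpen {y : unitInterval | y ≠ 0 ∧ ofUnit y ∈ G} := by
  rw [isOpen_iff_mem_nhds]
  rintro y ⟨hy, hyG⟩
  exact Filter.inter_mem (isOpen_ne.mem_nhds hy)
    ((continuousAt_ofUnit hy).preimage_mem_nhds (hG.mem_nhds hyG))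

/-- The point `0` must be removed: `ofUnit 0` is the junk value `1`, and `ofUnit` is continuous only
away from `0`. -/
theorem coe_pushUnit_apply {μ : ProbabilityMeasure ℂ} (hμ : μ ∈ probOn negLine) {G : Set ℂ}
    (hG : IsOpen G) : (pushUnit μ : Measure unitInterval) {y | y ≠ 0 ∧ ofUnit y ∈ G} =
      (μ : Measure ℂ) G := by
  rw [pushUnit, ProbabilityMeasure.toMeasure_map,
    Measure.map_apply continuous_toUnit.measurable (isOpen_ofUnit_preimage hG).measurableSet]
  refine measure_congr ?_
  filter_upwards [ae_mem_of_mem_probOn hμ] with z hz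
  refine propext ?_
  change (toUnit z ≠ 0 ∧ ofUnit (toUnit z) ∈ G) ↔ z ∈ G
  rw [ofUnit_toUnit hz]
  exact and_iff_right (toUnit_ne_zero z)

/-- The inverse map is not continuous at `0`, so convergence is pulled back through the portmanteau
criterion on open sets; `coe_pushUnit_apply` computes the mass of an open set from an open subset of
`(0, 1]`. -/
theorem isInducing_pushUnit :
    IsInducing fun μ : probOn negLine => pushUnit (μ : ProbabilityMeasure ℂ) := by
  rw [isInducing_iff_nhds]
  intro μ
  refine le_antisymm ?_ ?_
  · exact (continuous_pushUnit.comp continuous_subtype_val).continuousAt.tendsto.le_comap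
  · rw [← tendsto_id', tendsto_subtype_rng]
    refine tendsto_of_forall_isOpen_le_liminf' fun G hG => ?_
    have h := ProbabilityMeasure.le_liminf_measure_open_of_tendsto
      (tendsto_comap (f := fun μ : probOn negLine => pushUnit (μ : ProbabilityMeasure ℂ))
        (x := 𝓝 (pushUnit (μ : ProbabilityMeasure ℂ)))) (isOpen_ofUnit_preimage hG)
    simp only [coe_pushUnit_apply (Subtype.prop _) hG] at h
    exact h

theorem exists_pushUnit_eq {ν : ProbabilityMeasure unitInterval}
    (hν : (ν : Measure unitInterval) {0} = 0) :
    ∃ μ ∈ probOn negLine, pushUnit μ = ν := by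
  have hne : ∀ᵐ y ∂(ν : Measure unitInterval), y ≠ 0 := by
    rw [ae_iff]; simpa using hν
  refine ⟨ν.map measurable_ofUnit.aemeasurable, ?_, ?_⟩
  · change ((ν.map measurable_ofUnit.aemeasurable : ProbabilityMeasure ℂ) : Measure ℂ) negLineᶜ = 0
    rw [ProbabilityMeasure.toMeasure_map,
      Measure.map_apply measurable_ofUnit isClosed_negLine.measurableSet.compl]
    refine measure_mono_null (fun y hy => ?_) hν
    by_contra h
    exact hy (ofUnit_mem_negLine h)
  · apply ProbabilityMeasure.toMeasure_injective
    rw [pushUnit, ProbabilityMeasure.toMeasure_map, ProbabilityMeasure.toMeasure_map,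
      Measure.map_map continuous_toUnit.measurable measurable_ofUnit]
    conv_rhs => rw [← Measure.map_id (μ := (ν : Measure unitInterval))]
    refine Measure.map_congr ?_
    filter_upwards [hne] with y hy using toUnit_ofUnit hy

theorem pushUnit_injOn : Set.InjOn pushUnit (probOn negLine) := by
  intro μ hμ ν hν h
  have h1 : ∀ ρ ∈ probOn negLine, ((pushUnit ρ : Measure unitInterval)).map ofUnit =
      (ρ : Measure ℂ) := by
    intro ρ hρ
    rw [pushUnit, ProbabilityMeasure.toMeasure_map,
      Measure.map_map measurable_ofUnit continuous_toUnit.measurable]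
    conv_rhs => rw [← Measure.map_id (μ := (ρ : Measure ℂ))]
    refine Measure.map_congr ?_
    filter_upwards [ae_mem_of_mem_probOn hρ] with z hz using ofUnit_toUnit hz
  apply ProbabilityMeasure.toMeasure_injective
  rw [← h1 μ hμ, ← h1 ν hν, h]

/-- The identity is `1 / (1 - a) - 1 / (1 - b) = (a - b) / ((1 - a) (1 - b))`; on the diagonal both
sides are `+∞`. -/
theorem logKernel_eq {z w : ℂ} (hz : z ∈ negLine) (hw : w ∈ negLine) :
    logKernel z w = -ENNReal.log (edist (toUnit z) (toUnit w)) := by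
  obtain ⟨a, ha, rfl⟩ := hz
  obtain ⟨b, hb, rfl⟩ := hw
  rw [Set.mem_Iic] at ha hb
  have ha1 : 0 < 1 - a := by linarith
  have hb1 : 0 < 1 - b := by linarith
  have hn : ∀ x : ℝ, ‖(x : ℂ)‖ₑ = ENNReal.ofReal |x| := fun x => by
    rw [← ofReal_norm, Complex.norm_real, Real.norm_eq_abs]
  have h1 : ‖(1 : ℂ) - a‖ₑ = ENNReal.ofReal (1 - a) := by
    rw [← abs_of_pos ha1, ← hn]; simp
  have h2 : ‖(1 : ℂ) - b‖ₑ = ENNReal.ofReal (1 - b) := by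
    rw [← abs_of_pos hb1, ← hn]; simp
  have h3 : ‖(a : ℂ) - b‖ₑ = ENNReal.ofReal |a - b| := by
    rw [← hn]; simp
  have h4 : edist (toUnit a) (toUnit b) = ENNReal.ofReal (|a - b| / ((1 - a) * (1 - b))) := by
    rw [edist_dist, Subtype.dist_eq, Real.dist_eq]
    simp only [toUnit, Complex.ofReal_re, abs_of_nonpos ha, abs_of_nonpos hb, ← sub_eq_add_neg]
    congr 1
    rw [div_sub_div _ _ ha1.ne' hb1.ne', abs_div, abs_of_pos (mul_pos ha1 hb1)]
    congr 2
    ring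
  rw [logKernel, h1, h2, h3, h4]
  rcases eq_or_ne a b with rfl | hab
  · simp [ENNReal.log_ofReal_of_pos ha1]
  · have h5 : 0 < |a - b| := abs_pos.2 (sub_ne_zero.2 hab)
    rw [ENNReal.log_ofReal_of_pos ha1, ENNReal.log_ofReal_of_pos hb1, ENNReal.log_ofReal_of_pos h5,
      ENNReal.log_ofReal_of_pos (by positivity), Real.log_div h5.ne' (by positivity),
      Real.log_mul ha1.ne' hb1.ne']
    norm_cast
    ring

theorem edist_unit_le_one (x y : unitInterval) : edist x y ≤ 1 := by
  rw [edist_dist, Subtype.dist_eq, Real.dist_eq, ENNReal.ofReal_le_one, abs_le]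
  have := x.2.1; have := x.2.2; have := y.2.1; have := y.2.2
  constructor <;> linarith

/-- On `ℝ₋` the kernel is nonnegative, since distances in `[0, 1]` are at most `1`; the negative
part of the integral vanishes. -/
theorem eintegral_logKernel {μ : ProbabilityMeasure ℂ} (hμ : μ ∈ probOn negLine) :
    eintegral ((μ : Measure ℂ).prod (μ : Measure ℂ)) (fun q => logKernel q.1 q.2) =
      (energy (pushUnit μ) : EReal) := by
  have hae : ∀ᵐ q ∂((μ : Measure ℂ).prod (μ : Measure ℂ)), q.1 ∈ negLine ∧ q.2 ∈ negLine := by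
    exact (Measure.quasiMeasurePreserving_fst.ae (ae_mem_of_mem_probOn hμ)).and
      (Measure.quasiMeasurePreserving_snd.ae (ae_mem_of_mem_probOn hμ))
  have h1 : ∫⁻ q, (logKernel q.1 q.2).toENNReal ∂((μ : Measure ℂ).prod (μ : Measure ℂ)) =
      energy (pushUnit μ) := by
    rw [energy, pushUnit, ProbabilityMeasure.toMeasure_map, Measure.map_prod_map _ _
      continuous_toUnit.measurable continuous_toUnit.measurable,
      lintegral_map continuous_unitKernel.measurable
        (continuous_toUnit.measurable.prodMap continuous_toUnit.measurable)]
    refine lintegral_congr_ae ?_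
    filter_upwards [hae] with q hq
    rw [logKernel_eq hq.1 hq.2]
    rfl
  have h2 : ∫⁻ q, (-logKernel q.1 q.2).toENNReal ∂((μ : Measure ℂ).prod (μ : Measure ℂ)) = 0 := by
    rw [← lintegral_zero (μ := (μ : Measure ℂ).prod (μ : Measure ℂ))]
    refine lintegral_congr_ae ?_
    filter_upwards [hae] with q hq
    rw [logKernel_eq hq.1 hq.2, neg_neg]
    exact EReal.toENNReal_of_nonpos (ENNReal.log_le_zero_iff.2 (edist_unit_le_one _ _))
  rw [eintegral, h1, h2]
  simp

/-! ### Empirical measures of samples -/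

theorem unitEmp_comp_perm {n : ℕ} (σ : Equiv.Perm (Fin n)) (y : Fin n → unitInterval) :
    unitEmp n (y ∘ σ) = unitEmp n y := by
  rcases eq_or_ne n 0 with rfl | hn
  · congr 1; exact Subsingleton.elim _ _
  · apply ProbabilityMeasure.toMeasure_injective
    rw [coe_unitEmp hn, coe_unitEmp hn]
    congr 1
    exact Equiv.sum_comp σ fun i => Measure.dirac (y i)

theorem tendsto_iff_forall_continuousMap {ι : Type*} {l : Filter ι}
    {μs : ι → ProbabilityMeasure unitInterval} {ν : ProbabilityMeasure unitInterval} :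
    Tendsto μs l (𝓝 ν) ↔ ∀ f : C(unitInterval, ℝ),
      Tendsto (fun i => ∫ x, f x ∂(μs i : Measure unitInterval)) l
        (𝓝 (∫ x, f x ∂(ν : Measure unitInterval))) := by
  rw [ProbabilityMeasure.tendsto_iff_forall_integral_tendsto]
  exact ⟨fun h f => h (BoundedContinuousFunction.mkOfCompact f), fun h f => h f.toContinuousMap⟩

/-- Continuous test functions on `[0, 1]` are uniformly continuous, so moving every point by at most
`δ n → 0` does not affect the limit. -/
theorem tendsto_unitEmp_of_close {x y : ∀ n, Fin n → unitInterval}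
    {ν : ProbabilityMeasure unitInterval} {δ : ℕ → ℝ}
    (hx : Tendsto (fun n => unitEmp n (x n)) atTop (𝓝 ν)) (hδ : Tendsto δ atTop (𝓝 0))
    (hy : ∀ᶠ n in atTop, ∀ i, dist (y n i) (x n i) ≤ δ n) :
    Tendsto (fun n => unitEmp n (y n)) atTop (𝓝 ν) := by
  rw [tendsto_iff_forall_continuousMap] at hx ⊢
  intro f
  refine (hx f).congr_dist ?_
  rw [Metric.tendsto_nhds]
  intro ε hε
  obtain ⟨d, hd, hfd⟩ := Metric.uniformContinuous_iff.1
    (CompactSpace.uniformContinuous_of_continuous f.continuous) (ε / 2) (half_pos hε)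
  filter_upwards [hy, hδ.eventually (gt_mem_nhds hd), eventually_ne_atTop 0] with n h1 h2 hn
  rw [integral_unitEmp hn, integral_unitEmp hn, dist_zero_right, Real.norm_eq_abs, abs_dist,
    dist_comm, Real.dist_eq, ← mul_sub, ← Finset.sum_sub_distrib, abs_mul,
    abs_of_nonneg (by positivity)]
  have hn0 : (0 : ℝ) < n := by positivity
  have h3 : |∑ i, (f (y n i) - f (x n i))| ≤ n * (ε / 2) := by
    refine (Finset.abs_sum_le_sum_abs _ _).trans ?_
    calc ∑ i, |f (y n i) - f (x n i)| ≤ ∑ _i : Fin n, ε / 2 :=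
          Finset.sum_le_sum fun i _ => (hfd ((h1 i).trans_lt h2)).le
      _ = n * (ε / 2) := by simp
  calc (n : ℝ)⁻¹ * |∑ i, (f (y n i) - f (x n i))| ≤ (n : ℝ)⁻¹ * (n * (ε / 2)) := by gcongr
    _ = ε / 2 := by field_simp
    _ < ε := half_lt_self hε

/-- The strong law is applied to a countable dense family of test functions, and uniform
approximation extends it to all of them on one almost sure event. -/
theorem ae_tendsto_unitEmp {Ω' : Type*} [MeasurableSpace Ω'] {Q : Measure Ω'}
    [IsProbabilityMeasure Q] {ν : ProbabilityMeasure unitInterval} {X : ℕ → Ω' → unitInterval}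
    (hX : ∀ i, Measurable (X i)) (hlaw : ∀ i, HasLaw (X i) (ν : Measure unitInterval) Q)
    (hindep : iIndepFun X Q) :
    ∀ᵐ ω ∂Q, Tendsto (fun n => unitEmp n fun i : Fin n => X i ω) atTop (𝓝 ν) := by
  have hlln : ∀ f : C(unitInterval, ℝ), ∀ᵐ ω ∂Q, Tendsto (fun n : ℕ =>
      ∫ x, f x ∂(unitEmp n fun i : Fin n => X i ω : Measure unitInterval)) atTop
        (𝓝 (∫ x, f x ∂(ν : Measure unitInterval))) := by
    intro f
    have hb : Integrable (fun ω => f (X 0 ω)) Q :=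
      Integrable.of_bound (f.continuous.measurable.comp (hX 0)).aestronglyMeasurable ‖f‖
        (ae_of_all _ fun ω => f.norm_coe_le_norm _)
    have h := strong_law_ae_real (μ := Q) (fun i ω => f (X i ω)) hb
      (fun i j hij => (hindep.indepFun hij).comp f.continuous.measurable f.continuous.measurable)
      (fun i => ((hlaw i).identDistrib (hlaw 0)).comp f.continuous.measurable)
    have hlawX : ∫ ω, f (X 0 ω) ∂Q = ∫ x, f x ∂(ν : Measure unitInterval) := by
      rw [← (hlaw 0).map_eq, integral_map (hX 0).aemeasurable f.continuous.aestronglyMeasurable]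
    filter_upwards [h] with ω hω
    rw [hlawX] at hω
    refine hω.congr' ?_
    filter_upwards [eventually_ne_atTop 0] with n hn
    rw [integral_unitEmp hn, Finset.sum_range, div_eq_inv_mul]
  have hall := ae_all_iff.2 fun k => hlln (TopologicalSpace.denseSeq C(unitInterval, ℝ) k)
  filter_upwards [hall] with ω hω
  rw [tendsto_iff_forall_continuousMap]
  intro f
  have hintegrable : ∀ (ρ : ProbabilityMeasure unitInterval) (f : C(unitInterval, ℝ)),
      Integrable f (ρ : Measure unitInterval) := fun ρ f =>
    Integrable.of_bound f.continuous.aestronglyMeasurable ‖f‖ (ae_of_all _ f.norm_coe_le_norm)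
  have hclose : ∀ (ρ : ProbabilityMeasure unitInterval) (g : C(unitInterval, ℝ)),
      |∫ x, f x ∂(ρ : Measure unitInterval) - ∫ x, g x ∂(ρ : Measure unitInterval)| ≤ dist f g := by
    intro ρ g
    rw [← integral_sub (hintegrable ρ f) (hintegrable ρ g)]
    have h := norm_integral_le_of_norm_le_const (μ := (ρ : Measure unitInterval))
      (f := fun x => f x - g x) (C := dist f g) (ae_of_all _ fun x => by
        rw [← dist_eq_norm]; exact ContinuousMap.dist_apply_le_dist x)
    simpa using h
  rw [Metric.tendsto_nhds]
  intro ε hε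
  obtain ⟨k, hk⟩ := (TopologicalSpace.denseRange_denseSeq C(unitInterval, ℝ)).exists_dist_lt f
    (show 0 < ε / 3 by positivity)
  filter_upwards [Metric.tendsto_nhds.1 (hω k) (ε / 3) (by positivity)] with n hn
  set g := TopologicalSpace.denseSeq C(unitInterval, ℝ) k
  have h1 := hclose (unitEmp n fun i : Fin n => X i ω) g
  have h2 := hclose ν g
  rw [Real.dist_eq] at hn ⊢
  rw [abs_le] at h1 h2
  rw [abs_lt] at hn ⊢
  constructor <;> linarith

/-! ### Energy of configurations -/

/-- The off-diagonal energy `∑_{i≠j} -log |xᵢ - xⱼ|`. -/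
def pairEnergy {n : ℕ} (x : Fin n → unitInterval) : ℝ≥0∞ :=
  ∑ i, ∑ j ∈ {i}ᶜ, unitKernel (x i, x j)

theorem pairEnergy_comp_perm {n : ℕ} (σ : Equiv.Perm (Fin n)) (x : Fin n → unitInterval) :
    pairEnergy (x ∘ σ) = pairEnergy x := by
  have h : ∀ x : Fin n → unitInterval, pairEnergy x =
      ∑ i, ∑ j, if j = i then 0 else unitKernel (x i, x j) := by
    intro x
    refine Finset.sum_congr rfl fun i _ => ?_
    rw [← Finset.sum_subset (Finset.subset_univ {i}ᶜ) (fun j _ hj => by simp at hj; simp [hj])]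
    exact Finset.sum_congr rfl fun j hj => by
      rw [if_neg (by simpa using hj)]
  rw [h, h]
  conv_rhs => rw [← Equiv.sum_comp σ]
  refine Finset.sum_congr rfl fun i _ => ?_
  conv_rhs => rw [← Equiv.sum_comp σ]
  simp

theorem unitKernel_eq_ofReal {a b : unitInterval} (h : a ≠ b) :
    unitKernel (a, b) = ENNReal.ofReal (-Real.log |(a : ℝ) - b|) := by
  have hab : 0 < |(a : ℝ) - b| := abs_pos.2 (sub_ne_zero.2 fun h' => h (Subtype.ext h'))
  rw [unitKernel, edist_dist, Subtype.dist_eq, Real.dist_eq, ENNReal.log_ofReal_of_pos hab,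
    ← EReal.coe_neg, EReal.toENNReal_of_ne_top (EReal.coe_ne_top _), EReal.toReal_coe]

theorem injective_of_pairEnergy_ne_top {n : ℕ} {x : Fin n → unitInterval}
    (h : pairEnergy x ≠ ∞) : Function.Injective x := by
  intro i j hij
  by_contra hne
  refine h (ENNReal.sum_eq_top.2 ⟨i, Finset.mem_univ _, ENNReal.sum_eq_top.2 ⟨j, ?_, ?_⟩⟩)
  · simpa using fun h => hne h.symm
  · simp [unitKernel, hij]

theorem neg_log_abs_sub_nonneg (a b : unitInterval) : 0 ≤ -Real.log |(a : ℝ) - b| := by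
  refine neg_nonneg.2 (Real.log_nonpos (abs_nonneg _) ?_)
  have := a.2.1; have := a.2.2; have := b.2.1; have := b.2.2
  rw [abs_le]; constructor <;> linarith

theorem pairEnergy_eq_ofReal {n : ℕ} {x : Fin n → unitInterval} (hx : Function.Injective x) :
    pairEnergy x = ENNReal.ofReal (∑ i, ∑ j ∈ {i}ᶜ, -Real.log |(x i : ℝ) - x j|) := by
  rw [ENNReal.ofReal_sum_of_nonneg fun i _ => Finset.sum_nonneg fun j _ =>
    neg_log_abs_sub_nonneg _ _]
  refine Finset.sum_congr rfl fun i _ => ?_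
  rw [ENNReal.ofReal_sum_of_nonneg fun j _ => neg_log_abs_sub_nonneg _ _]
  refine Finset.sum_congr rfl fun j hj => unitKernel_eq_ofReal fun h => ?_
  simp only [Finset.mem_compl, Finset.mem_singleton] at hj
  exact hj (hx h).symm

/-- `pairEnergy` counts each unordered pair twice, whence the factor `1 / 2`; the identity is proved
for squares. -/
theorem vdm_eq_exp {n : ℕ} {x : Fin n → unitInterval} (hx : Function.Injective x) :
    vdm (fun i => (x i : ℝ)) = Real.exp (-(pairEnergy x).toReal / 2) := by
  have hpos : 0 ≤ ∑ i, ∑ j ∈ {i}ᶜ, -Real.log |(x i : ℝ) - x j| :=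
    Finset.sum_nonneg fun i _ => Finset.sum_nonneg fun j _ => neg_log_abs_sub_nonneg _ _
  have hne : ∀ i j, j ∈ ({i}ᶜ : Finset (Fin n)) → 0 < |(x i : ℝ) - x j| := by
    intro i j hj
    simp only [Finset.mem_compl, Finset.mem_singleton] at hj
    exact abs_pos.2 (sub_ne_zero.2 fun h => hj (hx (Subtype.ext h)).symm)
  have hsq : vdm (fun i => (x i : ℝ)) ^ 2 = Real.exp (-(pairEnergy x).toReal) := by
    rw [pairEnergy_eq_ofReal hx, ENNReal.toReal_ofReal hpos]
    simp only [Finset.sum_neg_distrib, neg_neg, Real.exp_sum]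
    have h1 := Finset.prod_prod_Ioi_mul_eq_prod_prod_off_diag
      (fun j i : Fin n => |(x i : ℝ) - x j|)
    have h2 : ∏ i, ∏ j ∈ {i}ᶜ, Real.exp (Real.log |(x i : ℝ) - x j|) =
        ∏ i, ∏ j ∈ {i}ᶜ, |(x i : ℝ) - x j| :=
      Finset.prod_congr rfl fun i _ => Finset.prod_congr rfl fun j hj => Real.exp_log (hne i j hj)
    rw [h2, ← h1, vdm, ← Finset.prod_pow]
    refine Finset.prod_congr rfl fun i _ => ?_
    rw [← Finset.prod_pow]
    refine Finset.prod_congr rfl fun j _ => ?_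
    rw [abs_sub_comm (x i : ℝ) (x j), sq]
  have h3 : Real.exp (-(pairEnergy x).toReal) = Real.exp (-(pairEnergy x).toReal / 2) ^ 2 := by
    rw [← Real.exp_nat_mul]; congr 1; push_cast; ring
  rw [h3] at hsq
  exact (pow_left_inj₀ (vdm_nonneg _) (Real.exp_pos _).le two_ne_zero).1 hsq

/-- Each off-diagonal pair of independent points contributes exactly `energy ν` in expectation, and
there are at most `n ^ 2` such pairs. -/
theorem lintegral_pairEnergy_le {Ω' : Type*} [MeasurableSpace Ω'] {Q : Measure Ω'}
    [IsProbabilityMeasure Q] {ν : ProbabilityMeasure unitInterval} {X : ℕ → Ω' → unitInterval}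
    (hX : ∀ i, Measurable (X i)) (hlaw : ∀ i, HasLaw (X i) (ν : Measure unitInterval) Q)
    (hindep : iIndepFun X Q) (n : ℕ) :
    ∫⁻ ω, pairEnergy (fun i : Fin n => X i ω) ∂Q ≤ (n : ℝ≥0∞) ^ 2 * energy ν := by
  have hpair : ∀ i j : ℕ, i ≠ j → ∫⁻ ω, unitKernel (X i ω, X j ω) ∂Q = energy ν := by
    intro i j hij
    have h := (indepFun_iff_map_prod_eq_prod_map_map (hX i).aemeasurable (hX j).aemeasurable).1
      (hindep.indepFun hij)
    rw [(hlaw i).map_eq, (hlaw j).map_eq] at h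
    rw [energy, ← h, lintegral_map continuous_unitKernel.measurable ((hX i).prodMk (hX j))]
  have hm : ∀ i j : ℕ, Measurable fun ω => unitKernel (X i ω, X j ω) := fun i j =>
    continuous_unitKernel.measurable.comp ((hX i).prodMk (hX j))
  simp only [pairEnergy]
  rw [lintegral_finsetSum _ fun (i : Fin n) _ =>
    Finset.measurable_fun_sum _ fun (j : Fin n) _ => hm i j]
  calc ∑ i : Fin n, ∫⁻ ω, ∑ j ∈ {i}ᶜ, unitKernel (X i ω, X j ω) ∂Q
      ≤ ∑ i : Fin n, (n : ℝ≥0∞) * energy ν := by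
        refine Finset.sum_le_sum fun i _ => ?_
        rw [lintegral_finsetSum _ fun (j : Fin n) _ => hm i j, Finset.sum_congr rfl fun (j : Fin n) hj =>
          hpair i j fun h => by simp [Fin.ext_iff, h] at hj, Finset.sum_const, nsmul_eq_mul]
        gcongr
        exact_mod_cast (Finset.card_le_univ _).trans (by simp)
    _ = (n : ℝ≥0∞) ^ 2 * energy ν := by simp [sq, mul_assoc]

/-- Configurations with empirical measure stably near `ν` and almost minimal energy. -/
theorem eventually_exists_config {ν : ProbabilityMeasure unitInterval}
    {W : Set (ProbabilityMeasure unitInterval)} (hW : IsOpen W) (hν : ν ∈ W)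
    {η : ℝ≥0∞} (hη : η ≠ 0) :
    ∀ᶠ n : ℕ in atTop, ∃ x : Fin n → unitInterval, Monotone x ∧
      (∀ y : Fin n → unitInterval, (∀ i, dist (y i) (x i) ≤ 1 / ((n : ℝ) + 1)) →
        unitEmp n y ∈ W) ∧
      pairEnergy x ≤ (n : ℝ≥0∞) ^ 2 * (energy ν + η) := by
  obtain ⟨Ω', _, Q, X, hX, hlaw, hindep, _⟩ := exists_iid ℕ (ν : Measure unitInterval)
  set A : ℕ → Ω' → Prop := fun n ω => ∀ y : Fin n → unitInterval,
    (∀ i : Fin n, dist (y i) (X i ω) ≤ 1 / ((n : ℝ) + 1)) → unitEmp n y ∈ W with hA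
  -- If stability failed infinitely often, choosing a bad perturbation whenever one exists would
  -- give configurations close to the sample, hence converging to `ν`, yet outside `W` infinitely
  -- often.
  have hAe : ∀ᵐ ω ∂Q, ∀ᶠ n in atTop, A n ω := by
    filter_upwards [ae_tendsto_unitEmp hX hlaw hindep] with ω hω
    by_contra hcon
    have hbad : ∃ᶠ n in atTop, ¬ A n ω := not_eventually.1 hcon
    choose! y hy using fun n (h : ¬ A n ω) => (by
      simp only [hA, not_forall] at h
      obtain ⟨y, h1, h2⟩ := h
      exact ⟨y, h1, h2⟩ : ∃ y : Fin n → unitInterval,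
        (∀ i : Fin n, dist (y i) (X i ω) ≤ 1 / ((n : ℝ) + 1)) ∧ unitEmp n y ∉ W)
    classical
    set y' : ∀ n, Fin n → unitInterval := fun n => if A n ω then fun i => X i ω else y n with hy'
    have h1 : Tendsto (fun n => unitEmp n (y' n)) atTop (𝓝 ν) := by
      refine tendsto_unitEmp_of_close hω tendsto_one_div_add_atTop_nhds_zero_nat
        (Eventually.of_forall fun n i => ?_)
      by_cases h : A n ω
      · simp only [hy', if_pos h, dist_self]; positivity
      · simp only [hy', if_neg h]; exact (hy n h).1 i
    refine hbad ?_
    filter_upwards [h1.eventually (hW.mem_nhds hν)] with n hn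
    rw [not_not]
    by_contra h
    simp only [hy', if_neg h] at hn
    exact (hy n h).2 hn
  -- Otherwise, along a subsequence, the normalised pair energy would almost surely be eventually at
  -- least `energy ν + η`, and Fatou's lemma would contradict the bound `energy ν` on its
  -- expectation.
  have key : ∀ᶠ n : ℕ in atTop, ∃ ω, A n ω ∧
      pairEnergy (fun i : Fin n => X i ω) ≤ (n : ℝ≥0∞) ^ 2 * (energy ν + η) := by
    by_contra hcon
    have hfreq : ∃ᶠ n : ℕ in atTop, n ≠ 0 ∧ ∀ ω, A n ω →
        (n : ℝ≥0∞) ^ 2 * (energy ν + η) < pairEnergy (fun i : Fin n => X i ω) := by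
      have h1 : ∃ᶠ n : ℕ in atTop, ¬ ∃ ω, A n ω ∧
        pairEnergy (fun i : Fin n => X i ω) ≤ (n : ℝ≥0∞) ^ 2 * (energy ν + η) :=
          not_eventually.1 hcon
      refine (h1.and_eventually (eventually_ne_atTop 0)).mono fun n hn => ⟨hn.2, fun ω hω => ?_⟩
      by_contra hlt
      exact hn.1 ⟨ω, hω, not_lt.1 hlt⟩
    obtain ⟨φ, hφ, hφn⟩ := extraction_of_frequently_atTop hfreq
    set g : ℕ → Ω' → ℝ≥0∞ := fun k ω =>
      ((φ k : ℝ≥0∞) ^ 2)⁻¹ * pairEnergy (fun i : Fin (φ k) => X i ω) with hg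
    have hsq : ∀ k, (φ k : ℝ≥0∞) ^ 2 ≠ 0 := fun k => by simpa using (hφn k).1
    have hsqt : ∀ k, (φ k : ℝ≥0∞) ^ 2 ≠ ∞ := fun k => ENNReal.pow_ne_top (ENNReal.natCast_ne_top _)
    have hgm : ∀ k, Measurable (g k) := fun k => by
      refine Measurable.const_mul (Finset.measurable_fun_sum _ fun i _ =>
        Finset.measurable_fun_sum _ fun j _ => ?_) _
      exact continuous_unitKernel.measurable.comp ((hX i).prodMk (hX j))
    have hup : ∀ k, ∫⁻ ω, g k ω ∂Q ≤ energy ν := fun k => by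
      rw [lintegral_const_mul' _ _ (ENNReal.inv_ne_top.2 (hsq k))]
      calc _ ≤ ((φ k : ℝ≥0∞) ^ 2)⁻¹ * ((φ k : ℝ≥0∞) ^ 2 * energy ν) := by
            gcongr; exact lintegral_pairEnergy_le hX hlaw hindep _
        _ = energy ν := by rw [← mul_assoc, ENNReal.inv_mul_cancel (hsq k) (hsqt k), one_mul]
    have hlow : ∀ᵐ ω ∂Q, energy ν + η ≤ liminf (fun k => g k ω) atTop := by
      filter_upwards [hAe] with ω hω
      refine le_liminf_of_le (by isBoundedDefault) ?_
      filter_upwards [hφ.tendsto_atTop.eventually hω] with k hk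
      have := (hφn k).2 ω hk
      calc energy ν + η = ((φ k : ℝ≥0∞) ^ 2)⁻¹ * ((φ k : ℝ≥0∞) ^ 2 * (energy ν + η)) := by
            rw [← mul_assoc, ENNReal.inv_mul_cancel (hsq k) (hsqt k), one_mul]
        _ ≤ g k ω := by simp only [hg]; gcongr
    have hfin : energy ν + η ≤ energy ν := calc
      energy ν + η = ∫⁻ _, (energy ν + η) ∂Q := by simp
      _ ≤ ∫⁻ ω, liminf (fun k => g k ω) atTop ∂Q := lintegral_mono_ae hlow
      _ ≤ liminf (fun k => ∫⁻ ω, g k ω ∂Q) atTop := lintegral_liminf_le hgm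
      _ ≤ energy ν := by
        refine liminf_le_of_frequently_le' (Frequently.of_forall hup)
    -- With infinite energy the strict inequality in `hφn` would read `∞ < pairEnergy`, so only the
    -- finite case remains.
    have hEtop : energy ν ≠ ∞ := by
      intro h
      obtain ⟨ω, hω⟩ := hAe.exists
      obtain ⟨k, hk⟩ := (hφ.tendsto_atTop.eventually hω).exists
      have := (hφn k).2 ω hk
      rw [h, top_add, ENNReal.mul_top (hsq k)] at this
      exact not_top_lt this
    exact hη (by
      have := (ENNReal.add_le_add_iff_left hEtop).1 (hfin.trans (add_zero _).ge)
      exact le_antisymm this zero_le)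
  filter_upwards [key] with n ⟨ω, h1, h2⟩
  set x : Fin n → unitInterval := fun i => X i ω
  set σ := Tuple.sort x
  refine ⟨x ∘ σ, Tuple.monotone_sort x, fun y hy => ?_, by rwa [pairEnergy_comp_perm]⟩
  rw [← unitEmp_comp_perm σ.symm y]
  refine h1 _ fun i => ?_
  simpa using hy (σ.symm i)

/-! ### Lower bound -/

theorem pow_mul_vdm_le {n : ℕ} {c : ℝ} (hc0 : 0 ≤ c) (hc1 : c ≤ 1) {x y : Fin n → ℝ}
    (h : ∀ i j, i < j → c * |x j - x i| ≤ |y j - y i|) : c ^ (n ^ 2) * vdm x ≤ vdm y := by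
  have h1 : ∏ i : Fin n, ∏ j ∈ Finset.Ioi i, (c * |x j - x i|) ≤ vdm y :=
    Finset.prod_le_prod (fun i _ => Finset.prod_nonneg fun j _ => by positivity) fun i _ =>
      Finset.prod_le_prod (fun j _ => by positivity) fun j hj => h i j (Finset.mem_Ioi.1 hj)
  refine le_trans ?_ h1
  simp only [Finset.prod_mul_distrib, Finset.prod_const, Finset.prod_pow_eq_pow_sum]
  refine mul_le_mul_of_nonneg_right (pow_le_pow_of_le_one hc0 hc1 ?_) (vdm_nonneg x)
  calc ∑ i : Fin n, (Finset.Ioi i).card ≤ ∑ _i : Fin n, n :=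
        Finset.sum_le_sum fun i _ => (Finset.card_le_univ _).trans (by simp)
    _ = n ^ 2 := by simp [sq]

/-- The configuration `x` is contracted by `n / (n + 1)`, and the freed length `1 / (n + 1)` is cut
into `n` slots, one added to each point. Points of the resulting box stay ordered inside `(0, 1)`,
keep at least the contracted gaps, and lie within `1 / (n + 1)` of `x`. Points of `x` may coincide.
-/
theorem le_gasMass {n : ℕ} (hn : n ≠ 0) {W : Set (ProbabilityMeasure unitInterval)}
    {x : Fin n → unitInterval} (hx : Monotone x)
    (hbox : ∀ y : Fin n → unitInterval, (∀ i, dist (y i) (x i) ≤ 1 / ((n : ℝ) + 1)) →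
      unitEmp n y ∈ W) :
    ENNReal.ofReal ((n / (n + 1) : ℝ) ^ (n ^ 2) * vdm (fun i => (x i : ℝ)) *
      (1 / (n * (n + 1)) : ℝ) ^ n) ≤ gasMass n W := by
  have hn0 : (0 : ℝ) < n := by positivity
  set c : ℝ := n / (n + 1) with hc
  set δ : ℝ := 1 / ((n : ℝ) + 1) with hδ
  have hδ0 : 0 < δ := by positivity
  have hcδ : c + δ = 1 := by rw [hc, hδ]; field_simp
  have hc0 : 0 < c := by positivity
  set a : Fin n → ℝ := fun i => c * x i + δ * (i / n) with ha
  set b : Fin n → ℝ := fun i => c * x i + δ * ((i + 1) / n) with hb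
  have hi1 : ∀ i : Fin n, ((i : ℝ) + 1) / n ≤ 1 := fun i => by
    rw [div_le_one hn0]; exact_mod_cast i.2
  have hi0 : ∀ i : Fin n, 0 ≤ (i : ℝ) / n := fun i => by positivity
  have hB : ∀ y ∈ Set.univ.pi fun i => Set.Ioo (a i) (b i), y ∈ configsIn n W ∧
      c ^ (n ^ 2) * vdm (fun i => (x i : ℝ)) ≤ vdm y := by
    intro y hy
    have hya : ∀ i, a i < y i := fun i => (hy i trivial).1
    have hyb : ∀ i, y i < b i := fun i => (hy i trivial).2
    have hy01 : ∀ i, y i ∈ Set.Ioo (0 : ℝ) 1 := by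
      intro i
      have h1 := hya i; have h2 := hyb i
      have h3 := (x i).2.1; have h4 := (x i).2.2
      simp only [ha, hb] at h1 h2
      constructor
      · have := mul_nonneg hc0.le h3
        have := mul_nonneg hδ0.le (hi0 i)
        linarith
      · have := mul_le_mul_of_nonneg_left h4 hc0.le
        have := mul_le_mul_of_nonneg_left (hi1 i) hδ0.le
        linarith
    have hgap : ∀ i j, i < j → c * (x j - x i) < y j - y i := by
      intro i j hij
      have h1 := hya j; have h2 := hyb i
      simp only [ha, hb] at h1 h2
      have h3 : ((i : ℝ) + 1) / n ≤ j / n := by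
        gcongr
        exact_mod_cast hij
      have := mul_le_mul_of_nonneg_left h3 hδ0.le
      rw [mul_sub]
      linarith
    have hxij : ∀ i j, i < j → (0 : ℝ) ≤ x j - x i := fun i j hij =>
      sub_nonneg.2 (Subtype.coe_le_coe.2 (hx hij.le))
    refine ⟨⟨⟨fun i j hij => ?_, hy01⟩, hbox _ fun i => ?_⟩,
      pow_mul_vdm_le hc0.le (by linarith) fun i j hij => ?_⟩
    · have := mul_nonneg hc0.le (hxij i j hij)
      linarith [hgap i j hij]
    · rw [Subtype.dist_eq, coe_clampUnit ⟨(hy01 i).1.le, (hy01 i).2.le⟩, Real.dist_eq, abs_le]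
      have h1 := hya i; have h2 := hyb i
      have h3 := (x i).2.1; have h4 := (x i).2.2
      simp only [ha, hb] at h1 h2
      have hcc : c = 1 - δ := by linarith
      rw [hcc] at h1 h2
      have e1 := mul_nonneg hδ0.le h3
      have e2 := mul_le_mul_of_nonneg_left h4 hδ0.le
      have e3 := mul_nonneg hδ0.le (hi0 i)
      have e4 := mul_le_mul_of_nonneg_left (hi1 i) hδ0.le
      constructor <;> linarith
    · have h1 := hgap i j hij
      have h2 := hxij i j hij
      rw [abs_of_nonneg h2, abs_of_pos ((mul_nonneg hc0.le h2).trans_lt h1)]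
      exact h1.le
  have hvol : volume (Set.univ.pi fun i => Set.Ioo (a i) (b i)) =
      ENNReal.ofReal ((1 / (n * (n + 1)) : ℝ) ^ n) := by
    rw [Real.volume_pi_Ioo]
    have : ∀ i : Fin n, b i - a i = 1 / (n * (n + 1)) := fun i => by
      simp only [ha, hb, hδ]; field_simp; ring
    simp only [this, Finset.prod_const, Finset.card_univ, Fintype.card_fin]
    rw [ENNReal.ofReal_pow (by positivity)]
  calc ENNReal.ofReal (c ^ (n ^ 2) * vdm (fun i => (x i : ℝ)) * (1 / (n * (n + 1)) : ℝ) ^ n)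
      = ∫⁻ _ in Set.univ.pi fun i => Set.Ioo (a i) (b i),
          ENNReal.ofReal (c ^ (n ^ 2) * vdm (fun i => (x i : ℝ))) := by
        rw [setLIntegral_const, hvol, ← ENNReal.ofReal_mul
          (mul_nonneg (pow_nonneg hc0.le _) (vdm_nonneg _))]
    _ ≤ ∫⁻ y in Set.univ.pi fun i => Set.Ioo (a i) (b i), ENNReal.ofReal (vdm y) := by
        refine setLIntegral_mono' (MeasurableSet.univ_pi fun i => measurableSet_Ioo) fun y hy => ?_
        exact ENNReal.ofReal_le_ofReal (hB y hy).2
    _ ≤ ∫⁻ y in configsIn n W, ENNReal.ofReal (vdm y) :=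
        lintegral_mono_set fun y hy => (hB y hy).1
    _ ≤ gasMass n W := by
        rw [gasMass]
        exact le_mul_of_one_le_left zero_le (by exact_mod_cast Nat.factorial_pos n)

theorem gasMass_univ_pos {n : ℕ} (hn : n ≠ 0) : 0 < gasMass n Set.univ := by
  have hn0 : (0 : ℝ) < n := by positivity
  set x : Fin n → unitInterval := fun i => ⟨(i : ℝ) / n, by positivity, by
    rw [div_le_one hn0]; exact_mod_cast i.2.le⟩ with hx
  have hmono : StrictMono x := fun i j hij => by
    rw [← Subtype.coe_lt_coe]
    simp only [hx]
    gcongr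
    exact_mod_cast hij
  refine lt_of_lt_of_le ?_ (le_gasMass hn hmono.monotone fun y _ => Set.mem_univ _)
  rw [ENNReal.ofReal_pos, vdm_eq_exp hmono.injective]
  positivity

theorem exp_neg_le_div_pow (n : ℕ) : Real.exp (-n) ≤ (n / (n + 1) : ℝ) ^ (n ^ 2) := by
  rcases eq_or_ne n 0 with rfl | hn
  · simp
  have hn0 : (0 : ℝ) < n := by positivity
  have h1 : Real.exp (-(1 / n)) ≤ n / (n + 1) := by
    rw [Real.exp_neg, inv_le_comm₀ (Real.exp_pos _) (by positivity), inv_div]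
    have := Real.add_one_le_exp (1 / (n : ℝ))
    calc ((n : ℝ) + 1) / n = 1 / n + 1 := by field_simp; ring
      _ ≤ _ := this
  calc Real.exp (-n) = Real.exp (-(1 / n)) ^ (n ^ 2) := by
        rw [← Real.exp_nat_mul]; congr 1; push_cast; field_simp
    _ ≤ _ := by gcongr

/-- Box volumes, factorials and contraction factors cost at most `exp (O(n log n))`, invisible at
speed `n ^ 2`. -/
theorem tendsto_log_mul_div (c : ℝ) :
    Tendsto (fun n : ℕ => (c + n * Real.log (n * (n + 1)) + n) / (n : ℝ) ^ 2) atTop (𝓝 0) := by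
  have hlog : Tendsto (fun n : ℕ => Real.log n / n) atTop (𝓝 0) := by
    have := (Real.isLittleO_log_id_atTop.tendsto_div_nhds_zero).comp tendsto_natCast_atTop_atTop
    exact this
  have hlog1 : Tendsto (fun n : ℕ => Real.log (n + 1 : ℝ) / n) atTop (𝓝 0) := by
    have h1 := (hlog.comp (tendsto_add_atTop_nat 1)).mul
      (tendsto_const_nhds.add (tendsto_one_div_atTop_nhds_zero_nat (𝕜 := ℝ)) :
        Tendsto (fun n : ℕ => (1 : ℝ) + 1 / n) atTop (𝓝 (1 + 0)))
    rw [zero_mul] at h1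
    refine h1.congr' ?_
    filter_upwards [eventually_ne_atTop 0] with n hn
    have hn0 : (0 : ℝ) < n := by positivity
    simp only [Function.comp_apply]
    push_cast
    field_simp
  have hinv := tendsto_one_div_atTop_nhds_zero_nat (𝕜 := ℝ)
  have h := ((hinv.mul hinv).const_mul c).add ((hlog.add hlog1).add hinv)
  simp only [mul_zero, add_zero] at h
  refine h.congr' ?_
  filter_upwards [eventually_ne_atTop 0] with n hn
  have hn0 : (0 : ℝ) < n := by positivity
  rw [Real.log_mul hn0.ne' (by positivity)]
  field_simp
  ring

theorem eventually_exp_le_gasMass {W : Set (ProbabilityMeasure unitInterval)} (hW : IsOpen W)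
    {ν : ProbabilityMeasure unitInterval} (hν : ν ∈ W) (hE : energy ν ≠ ∞) {η : ℝ} (hη : 0 < η) :
    ∀ᶠ n : ℕ in atTop, ENNReal.ofReal
      (Real.exp (-((n : ℝ) ^ 2 * ((energy ν).toReal / 2 + η)))) ≤ gasMass n W := by
  have hη' : ENNReal.ofReal η ≠ 0 := (ENNReal.ofReal_pos.2 hη).ne'
  -- Excess energy `η` costs only `η / 2` in the exponent; the other half pays for the contraction
  -- and the box volume.
  filter_upwards [eventually_exists_config hW hν hη', eventually_ne_atTop 0,
    (tendsto_log_mul_div 0).eventually (gt_mem_nhds (half_pos hη))] with n ⟨x, hx, hbox, hxE⟩ hn hlog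
  refine le_trans (ENNReal.ofReal_le_ofReal ?_) (le_gasMass hn hx hbox)
  have hn0 : (0 : ℝ) < n := by positivity
  have htop : (n : ℝ≥0∞) ^ 2 * (energy ν + ENNReal.ofReal η) ≠ ∞ :=
    ENNReal.mul_ne_top (by simp) (ENNReal.add_ne_top.2 ⟨hE, ENNReal.ofReal_ne_top⟩)
  have hxt : pairEnergy x ≠ ∞ := (hxE.trans_lt htop.lt_top).ne
  have hxr : (pairEnergy x).toReal ≤ (n : ℝ) ^ 2 * ((energy ν).toReal + η) := by
    have := ENNReal.toReal_mono htop hxE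
    rwa [ENNReal.toReal_mul, ENNReal.toReal_add hE ENNReal.ofReal_ne_top,
      ENNReal.toReal_ofReal hη.le, ENNReal.toReal_pow, ENNReal.toReal_natCast] at this
  rw [vdm_eq_exp (injective_of_pairEnergy_ne_top hxt)]
  have h1 : (1 / (n * (n + 1)) : ℝ) ^ n = Real.exp (-(n * Real.log (n * (n + 1)))) := by
    rw [Real.exp_neg, Real.exp_nat_mul, Real.exp_log (by positivity), one_div, inv_pow]
  rw [h1]
  calc Real.exp (-((n : ℝ) ^ 2 * ((energy ν).toReal / 2 + η)))
      ≤ Real.exp (-n + -(pairEnergy x).toReal / 2 + -(n * Real.log (n * (n + 1)))) := by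
        rw [Real.exp_le_exp]
        rw [zero_add, div_lt_iff₀ (by positivity)] at hlog
        nlinarith
    _ = Real.exp (-n) * Real.exp (-(pairEnergy x).toReal / 2) *
          Real.exp (-(n * Real.log (n * (n + 1)))) := by rw [Real.exp_add, Real.exp_add]
    _ ≤ _ := by
        gcongr
        exact exp_neg_le_div_pow n

/-! ### Upper bound -/

/-- The closed set `F` is compact, and the increasing open sets `{c < truncEnergy M}` cover it; this
makes the truncation level uniform over `F`. -/
theorem exists_truncEnergy_gt {F : Set (ProbabilityMeasure unitInterval)} (hF : IsClosed F)
    {c : ℝ≥0∞} (hc : ∀ ν ∈ F, c < energy ν) : ∃ M, ∀ ν ∈ F, c < truncEnergy M ν := by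
  obtain ⟨M, hM⟩ := hF.isCompact.elim_directed_cover (fun M => {ν | c < truncEnergy M ν})
    (fun M => isOpen_lt continuous_const (continuous_truncEnergy M))
    (fun ν hν => by
      have := hc ν hν
      rw [energy_eq_iSup, lt_iSup_iff] at this
      exact Set.mem_iUnion.2 this)
    (directed_of_isDirected_le fun M N h ν hν => lt_of_lt_of_le hν (truncEnergy_mono ν h))
  exact ⟨M, fun ν hν => hM hν⟩

theorem lintegral_unitEmp {n : ℕ} (hn : n ≠ 0) (y : Fin n → unitInterval)
    {f : unitInterval → ℝ≥0∞} (hf : Measurable f) :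
    ∫⁻ x, f x ∂(unitEmp n y : Measure unitInterval) = (n : ℝ≥0∞)⁻¹ * ∑ i, f (y i) := by
  rw [coe_unitEmp hn, lintegral_smul_measure, lintegral_finsetSum_measure]
  simp [lintegral_dirac' _ hf]

/-- Truncation tames the diagonal: each of the `n` terms `i = j` is at most `M`, a total of order
`n`. -/
theorem truncEnergy_unitEmp_le {n : ℕ} (hn : n ≠ 0) (M : ℕ) (y : Fin n → unitInterval) :
    (n : ℝ≥0∞) ^ 2 * truncEnergy M (unitEmp n y) ≤ pairEnergy y + n * M := by
  have hm : Measurable fun q => min (unitKernel q) (M : ℝ≥0∞) :=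
    continuous_unitKernel.measurable.min measurable_const
  have hn0 : (n : ℝ≥0∞) ≠ 0 := by simpa using hn
  have h1 : truncEnergy M (unitEmp n y) =
      (n : ℝ≥0∞)⁻¹ * ∑ i, ((n : ℝ≥0∞)⁻¹ * ∑ j, min (unitKernel (y i, y j)) M) := by
    rw [truncEnergy, lintegral_prod _ hm.aemeasurable,
      lintegral_unitEmp hn y hm.lintegral_prod_right']
    congr 1
    exact Finset.sum_congr rfl fun i _ =>
      lintegral_unitEmp hn y (hm.comp (measurable_const.prodMk measurable_id))
  rw [h1, ← Finset.mul_sum, sq, mul_assoc, ← mul_assoc (n : ℝ≥0∞) (n : ℝ≥0∞)⁻¹,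
    ENNReal.mul_inv_cancel hn0 (ENNReal.natCast_ne_top n), one_mul, ← mul_assoc,
    ENNReal.mul_inv_cancel hn0 (ENNReal.natCast_ne_top n), one_mul]
  have h2 : ∀ i, ∑ j, min (unitKernel (y i, y j)) (M : ℝ≥0∞) ≤
      ∑ j ∈ {i}ᶜ, unitKernel (y i, y j) + M := by
    intro i
    rw [← Finset.sum_add_sum_compl {i}ᶜ, compl_compl, Finset.sum_singleton]
    exact add_le_add (Finset.sum_le_sum fun j _ => min_le_left _ _) (min_le_right _ _)
  calc ∑ i, ∑ j, min (unitKernel (y i, y j)) (M : ℝ≥0∞)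
      ≤ ∑ i, (∑ j ∈ {i}ᶜ, unitKernel (y i, y j) + M) := Finset.sum_le_sum fun i _ => h2 i
    _ = pairEnergy y + n * M := by rw [Finset.sum_add_distrib, pairEnergy]; simp

theorem volume_configsIn_le_one (n : ℕ) (A : Set (ProbabilityMeasure unitInterval)) :
    volume (configsIn n A) ≤ 1 := by
  calc volume (configsIn n A) ≤ volume (Set.univ.pi fun _ : Fin n => Set.Ioo (0 : ℝ) 1) :=
        measure_mono fun y hy i _ => hy.1.2 i
    _ = 1 := by rw [Real.volume_pi_Ioo]; simp

theorem eventually_gasMass_le_exp_of_trunc {F : Set (ProbabilityMeasure unitInterval)}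
    (hF : IsClosed F) {c : ℝ} (hc0 : 0 ≤ c) {M : ℕ}
    (hM : ∀ ν ∈ F, ENNReal.ofReal c ≤ truncEnergy M ν) {η : ℝ} (hη : 0 < η) :
    ∀ᶠ n : ℕ in atTop, gasMass n F ≤
      ENNReal.ofReal (Real.exp (-((n : ℝ) ^ 2 * (c / 2 - η)))) := by
  have hlim : Tendsto (fun n : ℕ => (0 + n * Real.log (n * (n + 1)) + n) / (n : ℝ) ^ 2 +
      (M / 2 : ℝ) * (1 / n)) atTop (𝓝 (0 + (M / 2 : ℝ) * 0)) :=
    (tendsto_log_mul_div 0).add (tendsto_one_div_atTop_nhds_zero_nat.const_mul _)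
  simp only [mul_zero, add_zero] at hlim
  filter_upwards [eventually_ne_atTop 0, hlim.eventually (gt_mem_nhds hη)] with n hn hlog
  have hn0 : (0 : ℝ) < n := by positivity
  have hpt : ∀ y ∈ configsIn n F, vdm y ≤ Real.exp (-((n : ℝ) ^ 2 * c - n * M) / 2) := by
    rintro y ⟨⟨hmono, hy⟩, hyF⟩
    set x : Fin n → unitInterval := fun i => clampUnit (y i)
    have hxy : (fun i => (x i : ℝ)) = y :=
      funext fun i => coe_clampUnit ⟨(hy i).1.le, (hy i).2.le⟩
    have hinj : Function.Injective x := fun i j hij => hmono.injective (by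
      have := congrArg Subtype.val hij
      rw [← hxy]; exact this)
    have hfin : pairEnergy x ≠ ∞ := by
      rw [pairEnergy_eq_ofReal hinj]; exact ENNReal.ofReal_ne_top
    have h1 : (n : ℝ≥0∞) ^ 2 * ENNReal.ofReal c ≤ pairEnergy x + n * M :=
      (mul_le_mul_right (hM _ hyF) _).trans (truncEnergy_unitEmp_le hn M x)
    have h2 := ENNReal.toReal_mono (ENNReal.add_ne_top.2 ⟨hfin, by finiteness⟩) h1
    rw [ENNReal.toReal_mul, ENNReal.toReal_add hfin (by finiteness), ENNReal.toReal_mul,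
      ENNReal.toReal_ofReal hc0, ENNReal.toReal_pow, ENNReal.toReal_natCast,
      ENNReal.toReal_natCast] at h2
    rw [← hxy, vdm_eq_exp hinj, Real.exp_le_exp]
    linarith
  have hfac : (n.factorial : ℝ) ≤ Real.exp (n * Real.log (n * (n + 1))) := by
    rw [Real.exp_nat_mul, Real.exp_log (by positivity)]
    calc (n.factorial : ℝ) ≤ (n : ℝ) ^ n := by exact_mod_cast Nat.factorial_le_pow n
      _ ≤ _ := by gcongr; nlinarith
  calc gasMass n F ≤ n.factorial * ∫⁻ _ in configsIn n F,
        ENNReal.ofReal (Real.exp (-((n : ℝ) ^ 2 * c - n * M) / 2)) := by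
        rw [gasMass]
        refine mul_le_mul_right (setLIntegral_mono' (measurableSet_configsIn_of_isClosed hF)
          fun y hy => ENNReal.ofReal_le_ofReal (hpt y hy)) _
    _ ≤ n.factorial * ENNReal.ofReal (Real.exp (-((n : ℝ) ^ 2 * c - n * M) / 2)) := by
        rw [setLIntegral_const]
        gcongr
        exact mul_le_of_le_one_right zero_le (volume_configsIn_le_one n F)
    _ = ENNReal.ofReal (n.factorial * Real.exp (-((n : ℝ) ^ 2 * c - n * M) / 2)) := by
        rw [ENNReal.ofReal_mul (by positivity), ENNReal.ofReal_natCast]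
    _ ≤ _ := by
        refine ENNReal.ofReal_le_ofReal ?_
        calc (n.factorial : ℝ) * Real.exp (-((n : ℝ) ^ 2 * c - n * M) / 2)
            ≤ Real.exp (n * Real.log (n * (n + 1))) *
                Real.exp (-((n : ℝ) ^ 2 * c - n * M) / 2) := by gcongr
          _ = Real.exp (n * Real.log (n * (n + 1)) + -((n : ℝ) ^ 2 * c - n * M) / 2) := by
              rw [Real.exp_add]
          _ ≤ _ := by
              rw [Real.exp_le_exp]
              have h3 : n * Real.log (n * (n + 1)) + n + M / 2 * n < η * (n : ℝ) ^ 2 := by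
                have := mul_lt_mul_of_pos_right hlog (show (0 : ℝ) < (n : ℝ) ^ 2 by positivity)
                refine lt_of_eq_of_lt ?_ this
                field_simp
                ring
              nlinarith

theorem eventually_gasMass_le_exp {F : Set (ProbabilityMeasure unitInterval)} (hF : IsClosed F)
    {c : ℝ} (hc : ∀ ν ∈ F, (c : EReal) < energy ν) {η : ℝ} (hη : 0 < η) :
    ∀ᶠ n : ℕ in atTop, gasMass n F ≤
      ENNReal.ofReal (Real.exp (-((n : ℝ) ^ 2 * (c / 2 - η)))) := by
  rcases le_total 0 c with hc0 | hc0
  · have hc' : ∀ ν ∈ F, ENNReal.ofReal c < energy ν := fun ν hν => by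
      have := hc ν hν
      rwa [← max_eq_left hc0, ← EReal.coe_ennreal_ofReal, EReal.coe_ennreal_lt_coe_ennreal_iff] at this
    obtain ⟨M, hM⟩ := exists_truncEnergy_gt hF hc'
    exact eventually_gasMass_le_exp_of_trunc hF hc0 (fun ν hν => (hM ν hν).le) hη
  -- A negative threshold carries no information, and the bound for threshold `0` is already
  -- stronger.
  · filter_upwards [eventually_gasMass_le_exp_of_trunc hF le_rfl (M := 0) (by simp) hη] with n hn
    refine hn.trans (ENNReal.ofReal_le_ofReal (Real.exp_le_exp.2 (neg_le_neg ?_)))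
    gcongr

end RandomZeros
end

noncomputable section

open scoped ComplexConjugate

namespace RandomZeros

/-! ### Strict convexity of the energy -/

/-- The point of the upper half of the unit circle with real part `2x - 1`. -/
def circlePt (x : unitInterval) : ℂ := ⟨2 * x - 1, 2 * √(x * (1 - x))⟩

theorem normSq_circlePt (x : unitInterval) : Complex.normSq (circlePt x) = 1 := by
  have h : 0 ≤ (x : ℝ) * (1 - x) := mul_nonneg x.2.1 (by linarith [x.2.2])
  rw [circlePt, Complex.normSq_mk]
  have := Real.mul_self_sqrt h
  nlinarith

theorem norm_circlePt (x : unitInterval) : ‖circlePt x‖ = 1 := by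
  rw [Complex.norm_def, normSq_circlePt, Real.sqrt_one]

theorem circlePt_mul_conj (x : unitInterval) : circlePt x * conj (circlePt x) = 1 := by
  rw [Complex.mul_conj, normSq_circlePt, Complex.ofReal_one]

theorem continuous_circlePt : Continuous circlePt := by
  have : circlePt = fun x : unitInterval =>
      ((2 * (x : ℝ) - 1 : ℝ) : ℂ) + ((2 * √((x : ℝ) * (1 - x)) : ℝ) : ℂ) * Complex.I := by
    funext x
    apply Complex.ext <;> simp [circlePt]
  rw [this]
  fun_prop

/-- `Re uᵏ` with `u = circlePt x`: the Chebyshev polynomial `Tₖ(2x - 1)`. -/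
def chebyshevFun (k : ℕ) : C(unitInterval, ℝ) :=
  ⟨fun x => (circlePt x ^ k).re, Complex.continuous_re.comp (continuous_circlePt.pow k)⟩

theorem chebyshevFun_apply (k : ℕ) (x : unitInterval) :
    chebyshevFun k x = (circlePt x ^ k).re := rfl

theorem abs_chebyshevFun_le_one (k : ℕ) (x : unitInterval) : |chebyshevFun k x| ≤ 1 := by
  refine (Complex.abs_re_le_norm _).trans ?_
  rw [norm_pow, norm_circlePt, one_pow]

theorem chebyshevFun_add_two (k : ℕ) (x : unitInterval) :
    chebyshevFun 1 x * chebyshevFun (k + 1) x =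
      (chebyshevFun (k + 2) x + chebyshevFun k x) / 2 := by
  have h : circlePt x ^ (k + 2) + circlePt x ^ k =
      ((2 * (circlePt x).re : ℝ) : ℂ) * circlePt x ^ (k + 1) := by
    rw [← Complex.add_conj]
    calc circlePt x ^ (k + 2) + circlePt x ^ k
        = circlePt x ^ (k + 2) + circlePt x ^ k * (circlePt x * conj (circlePt x)) := by
          rw [circlePt_mul_conj, mul_one]
      _ = _ := by ring
  have h2 := congrArg Complex.re h
  rw [Complex.add_re, Complex.re_ofReal_mul] at h2
  simp only [chebyshevFun_apply, pow_one]
  rw [h2]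
  ring

theorem integrable_continuousMap (μ : ProbabilityMeasure unitInterval) (f : C(unitInterval, ℝ)) :
    Integrable f (μ : Measure unitInterval) :=
  Integrable.of_bound f.continuous.aestronglyMeasurable ‖f‖ (ae_of_all _ f.norm_coe_le_norm)

theorem continuous_integral_continuousMap_left (μ : ProbabilityMeasure unitInterval) :
    Continuous fun f : C(unitInterval, ℝ) => ∫ x, f x ∂(μ : Measure unitInterval) := by
  refine (LipschitzWith.of_dist_le_mul (K := 1) fun f g => ?_).continuous
  rw [Real.dist_eq, ← integral_sub (integrable_continuousMap μ f) (integrable_continuousMap μ g)]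
  have h := norm_integral_le_of_norm_le_const (μ := (μ : Measure unitInterval))
    (f := fun x => f x - g x) (C := dist f g) (ae_of_all _ fun x => by
      rw [← dist_eq_norm]; exact ContinuousMap.dist_apply_le_dist x)
  simpa using h

/-- The recurrence `2 T₁ Tₖ₊₁ = Tₖ₊₂ + Tₖ` reduces the moments of `T₁ ^ n Tₖ` to Chebyshev moments.
Polynomials in `T₁` separate points, and Stone–Weierstrass finishes. -/
theorem ext_of_chebyshev_moments {μ ν : ProbabilityMeasure unitInterval}
    (h : ∀ k, ∫ x, chebyshevFun k x ∂(μ : Measure unitInterval) =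
      ∫ x, chebyshevFun k x ∂(ν : Measure unitInterval)) : μ = ν := by
  have hpow : ∀ n k, ∫ x, (chebyshevFun 1 ^ n * chebyshevFun k : C(unitInterval, ℝ)) x
      ∂(μ : Measure unitInterval) = ∫ x, (chebyshevFun 1 ^ n * chebyshevFun k :
        C(unitInterval, ℝ)) x ∂(ν : Measure unitInterval) := by
    intro n
    induction n with
    | zero => intro k; simpa using h k
    | succ n ih =>
      intro k
      cases k with
      | zero =>
        have : (chebyshevFun 1 ^ (n + 1) * chebyshevFun 0 : C(unitInterval, ℝ)) =
            chebyshevFun 1 ^ n * chebyshevFun 1 := by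
          ext x; simp [chebyshevFun_apply, pow_succ]
        rw [this]
        exact ih 1
      | succ k =>
        have : (chebyshevFun 1 ^ (n + 1) * chebyshevFun (k + 1) : C(unitInterval, ℝ)) =
            (1 / 2 : ℝ) • (chebyshevFun 1 ^ n * chebyshevFun (k + 2) +
              chebyshevFun 1 ^ n * chebyshevFun k) := by
          ext x
          have h1 := chebyshevFun_add_two k x
          simp only [ContinuousMap.mul_apply, ContinuousMap.pow_apply, ContinuousMap.smul_apply,
            ContinuousMap.add_apply, smul_eq_mul]
          rw [pow_succ, mul_assoc, h1]
          ring
        rw [this]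
        simp only [ContinuousMap.smul_apply, ContinuousMap.add_apply, smul_eq_mul]
        rw [integral_const_mul, integral_const_mul,
          integral_add (integrable_continuousMap μ _) (integrable_continuousMap μ _),
          integral_add (integrable_continuousMap ν _) (integrable_continuousMap ν _),
          ih (k + 2), ih k]
  have hadj : ∀ f ∈ Algebra.adjoin ℝ {chebyshevFun 1},
      ∫ x, f x ∂(μ : Measure unitInterval) = ∫ x, f x ∂(ν : Measure unitInterval) := by
    intro f hf
    rw [Algebra.adjoin_singleton_eq_range_aeval] at hf
    obtain ⟨q, rfl⟩ := hf
    change ∫ x, (aeval (chebyshevFun 1) q) x ∂(μ : Measure unitInterval) =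
      ∫ x, (aeval (chebyshevFun 1) q) x ∂(ν : Measure unitInterval)
    induction q using Polynomial.induction_on' with
    | add p q hp hq =>
      simp only [map_add, ContinuousMap.add_apply]
      rw [integral_add (integrable_continuousMap μ _) (integrable_continuousMap μ _),
        integral_add (integrable_continuousMap ν _) (integrable_continuousMap ν _), hp, hq]
    | monomial n a =>
      have h0 : (chebyshevFun 0 : C(unitInterval, ℝ)) = 1 := by
        ext x; simp [chebyshevFun_apply]
      have := hpow n 0
      rw [h0, mul_one] at this
      rw [aeval_monomial, ← Algebra.smul_def]
      simp only [ContinuousMap.smul_apply, smul_eq_mul]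
      rw [integral_const_mul, integral_const_mul, this]
  have hsep : (Algebra.adjoin ℝ {chebyshevFun 1}).SeparatesPoints := by
    intro x y hxy
    refine ⟨_, ⟨chebyshevFun 1, Algebra.subset_adjoin rfl, rfl⟩, fun hne => hxy ?_⟩
    simp only [chebyshevFun_apply, pow_one, circlePt] at hne
    exact Subtype.ext (by linarith)
  have hdense := ContinuousMap.subalgebra_topologicalClosure_eq_top_of_separatesPoints _ hsep
  have hall : ∀ f : C(unitInterval, ℝ),
      ∫ x, f x ∂(μ : Measure unitInterval) = ∫ x, f x ∂(ν : Measure unitInterval) := by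
    intro f
    have hf : f ∈ (Algebra.adjoin ℝ {chebyshevFun 1}).topologicalClosure := by
      rw [hdense]; trivial
    have hcl : IsClosed {f : C(unitInterval, ℝ) | ∫ x, f x ∂(μ : Measure unitInterval) =
        ∫ x, f x ∂(ν : Measure unitInterval)} :=
      isClosed_eq (continuous_integral_continuousMap_left μ)
        (continuous_integral_continuousMap_left ν)
    exact closure_minimal hadj hcl hf
  apply ProbabilityMeasure.toMeasure_injective
  exact ext_of_forall_integral_eq_of_IsFiniteMeasure fun f => hall f.toContinuousMap

/-- The Abel regularisation of `-log |x - y| - 2 log 2`. -/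
def abelKernel (r : ℝ) (q : unitInterval × unitInterval) : ℝ :=
  -Real.log ‖1 - r * (circlePt q.1 * circlePt q.2)‖ -
    Real.log ‖1 - r * (circlePt q.1 * conj (circlePt q.2))‖

/-- Real part of the Taylor series of `-log (1 - r w)`; the term `k = 0` vanishes because division
by zero gives `0`. -/
theorem hasSum_neg_log_norm {w : ℂ} (hw : ‖w‖ = 1) {r : ℝ} (hr0 : 0 ≤ r) (hr1 : r < 1) :
    HasSum (fun k : ℕ => r ^ k / k * (w ^ k).re) (-Real.log ‖1 - r * w‖) := by
  have hn : ‖(r : ℂ) * w‖ < 1 := by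
    rw [norm_mul, hw, mul_one, Complex.norm_real, Real.norm_of_nonneg hr0]; exact hr1
  have h := Complex.hasSum_re (Complex.hasSum_taylorSeries_neg_log hn)
  rw [Complex.neg_re, Complex.log_re] at h
  convert h using 1
  funext k
  rw [mul_pow, ← Complex.ofReal_pow, ← Complex.ofReal_natCast, mul_div_right_comm,
    ← Complex.ofReal_div, Complex.re_ofReal_mul]

/-- `Re (uv)ᵏ + Re (u v̄)ᵏ = 2 Re uᵏ Re vᵏ`, so the two logarithmic series add up to a diagonal
Chebyshev expansion with nonnegative coefficients. -/
theorem hasSum_abelKernel {r : ℝ} (hr0 : 0 ≤ r) (hr1 : r < 1) (q : unitInterval × unitInterval) :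
    HasSum (fun k : ℕ => 2 * r ^ k / k * (chebyshevFun k q.1 * chebyshevFun k q.2))
      (abelKernel r q) := by
  have h1 := hasSum_neg_log_norm (w := circlePt q.1 * circlePt q.2)
    (by rw [norm_mul, norm_circlePt, norm_circlePt, mul_one]) hr0 hr1
  have h2 := hasSum_neg_log_norm (w := circlePt q.1 * conj (circlePt q.2))
    (by rw [norm_mul, Complex.norm_conj, norm_circlePt, norm_circlePt, mul_one]) hr0 hr1
  have h := h1.add h2
  rw [← sub_eq_add_neg] at h
  refine Eq.mp (congrArg (fun F => HasSum F (abelKernel r q)) (funext fun k => ?_)) h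
  simp only [chebyshevFun_apply, mul_pow, ← map_pow, Complex.mul_re, Complex.conj_re,
    Complex.conj_im]
  ring

/-- The last bound comes from `‖1 - w‖ ≤ ‖1 - r w‖ + (1 - r)` and `1 - r ≤ ‖1 - r w‖`. Being uniform
in `r`, it supplies the majorant for dominated convergence. -/
theorem norm_one_sub_mul_bounds {w : ℂ} (hw : ‖w‖ = 1) {r : ℝ} (hr0 : 0 ≤ r) (hr1 : r < 1) :
    0 < ‖1 - r * w‖ ∧ ‖1 - r * w‖ ≤ 2 ∧ ‖1 - w‖ ≤ 2 * ‖1 - r * w‖ := by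
  have hn : ‖(r : ℂ) * w‖ = r := by
    rw [norm_mul, hw, mul_one, Complex.norm_real, Real.norm_of_nonneg hr0]
  have h1 : 1 - r ≤ ‖1 - r * w‖ := by
    have := norm_sub_norm_le (1 : ℂ) (r * w)
    rwa [hn, norm_one] at this
  refine ⟨by linarith, ?_, ?_⟩
  · have := norm_sub_le (1 : ℂ) (r * w)
    rw [hn, norm_one] at this
    linarith
  · have h2 : (1 : ℂ) - w = (1 - r * w) - ((1 - r : ℝ) : ℂ) * w := by push_cast; ring
    have h3 := norm_sub_le (1 - r * w) (((1 - r : ℝ) : ℂ) * w)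
    rw [← h2, norm_mul, hw, mul_one, Complex.norm_real, Real.norm_of_nonneg (by linarith)] at h3
    linarith

/-- With `u = e^{iθ}`, `v = e^{iφ}` the product `(1 - u v) (1 - u v̄)` equals `2 u (cos θ - cos φ)`.
This links the circle to `-log |x - y|`. -/
theorem norm_mul_norm_circlePt (x y : unitInterval) :
    ‖1 - circlePt x * circlePt y‖ * ‖1 - circlePt x * conj (circlePt y)‖ =
      4 * |(x : ℝ) - y| := by
  have h : (1 - circlePt x * circlePt y) * (1 - circlePt x * conj (circlePt y)) =
      circlePt x * ((4 * ((x : ℝ) - y) : ℝ) : ℂ) := by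
    have h1 : ((4 * ((x : ℝ) - y) : ℝ) : ℂ) = (circlePt x + conj (circlePt x)) -
        (circlePt y + conj (circlePt y)) := by
      rw [Complex.add_conj, Complex.add_conj, ← Complex.ofReal_sub]
      congr 1
      simp only [circlePt]; ring
    have hx := circlePt_mul_conj x
    have hy := circlePt_mul_conj y
    rw [h1]
    linear_combination (circlePt x) ^ 2 * hy - hx
  rw [← norm_mul, h, norm_mul, norm_circlePt, one_mul, Complex.norm_real, Real.norm_eq_abs,
    abs_mul, abs_of_pos (by norm_num : (0 : ℝ) < 4)]

theorem continuous_abelKernel {r : ℝ} (hr0 : 0 ≤ r) (hr1 : r < 1) :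
    Continuous (abelKernel r) := by
  have h1 : ∀ q : unitInterval × unitInterval,
      ‖1 - (r : ℂ) * (circlePt q.1 * circlePt q.2)‖ ≠ 0 := fun q =>
    (norm_one_sub_mul_bounds (by rw [norm_mul, norm_circlePt, norm_circlePt, mul_one])
      hr0 hr1).1.ne'
  have h2 : ∀ q : unitInterval × unitInterval,
      ‖1 - (r : ℂ) * (circlePt q.1 * conj (circlePt q.2))‖ ≠ 0 := fun q =>
    (norm_one_sub_mul_bounds (by
      rw [norm_mul, Complex.norm_conj, norm_circlePt, norm_circlePt, mul_one]) hr0 hr1).1.ne'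
  have hc1 := continuous_circlePt.comp (continuous_fst (X := unitInterval) (Y := unitInterval))
  have hc2 := continuous_circlePt.comp (continuous_snd (X := unitInterval) (Y := unitInterval))
  refine Continuous.sub (Continuous.neg (Continuous.log ?_ h1)) (Continuous.log ?_ h2)
  · exact (continuous_const.sub (continuous_const.mul (hc1.mul hc2))).norm
  · exact (continuous_const.sub (continuous_const.mul
      (hc1.mul (Complex.continuous_conj.comp hc2)))).norm

theorem abelKernel_lower {r : ℝ} (hr0 : 0 ≤ r) (hr1 : r < 1) (q : unitInterval × unitInterval) :
    0 ≤ abelKernel r q + 2 * Real.log 2 := by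
  obtain ⟨h1, h2, -⟩ := norm_one_sub_mul_bounds (w := circlePt q.1 * circlePt q.2)
    (by rw [norm_mul, norm_circlePt, norm_circlePt, mul_one]) hr0 hr1
  obtain ⟨h3, h4, -⟩ := norm_one_sub_mul_bounds (w := circlePt q.1 * conj (circlePt q.2))
    (by rw [norm_mul, Complex.norm_conj, norm_circlePt, norm_circlePt, mul_one]) hr0 hr1
  have := Real.log_le_log h1 h2
  have := Real.log_le_log h3 h4
  rw [abelKernel]
  linarith

theorem abelKernel_upper {r : ℝ} (hr0 : 0 ≤ r) (hr1 : r < 1) {q : unitInterval × unitInterval}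
    (hq : q.1 ≠ q.2) : abelKernel r q ≤ -Real.log |(q.1 : ℝ) - q.2| := by
  obtain ⟨h1, -, h2⟩ := norm_one_sub_mul_bounds (w := circlePt q.1 * circlePt q.2)
    (by rw [norm_mul, norm_circlePt, norm_circlePt, mul_one]) hr0 hr1
  obtain ⟨h3, -, h4⟩ := norm_one_sub_mul_bounds (w := circlePt q.1 * conj (circlePt q.2))
    (by rw [norm_mul, Complex.norm_conj, norm_circlePt, norm_circlePt, mul_one]) hr0 hr1
  have hpos : 0 < |(q.1 : ℝ) - q.2| := abs_pos.2 (sub_ne_zero.2 fun h => hq (Subtype.ext h))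
  have h5 : 4 * |(q.1 : ℝ) - q.2| ≤ 4 * (‖1 - (r : ℂ) * (circlePt q.1 * circlePt q.2)‖ *
      ‖1 - (r : ℂ) * (circlePt q.1 * conj (circlePt q.2))‖) := by
    rw [← norm_mul_norm_circlePt]
    calc _ ≤ _ := mul_le_mul h2 h4 (norm_nonneg _) (by positivity)
      _ = _ := by ring
  have h6 := Real.log_le_log hpos (le_of_mul_le_mul_left h5 (by norm_num))
  rw [Real.log_mul h1.ne' h3.ne'] at h6
  rw [abelKernel]
  linarith

theorem tendsto_abelKernel {r : ℕ → ℝ} (hr : Tendsto r atTop (𝓝 1))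
    {q : unitInterval × unitInterval} (hq : q.1 ≠ q.2) :
    Tendsto (fun n => abelKernel (r n) q + 2 * Real.log 2) atTop
      (𝓝 (-Real.log |(q.1 : ℝ) - q.2|)) := by
  have hpos : 0 < |(q.1 : ℝ) - q.2| := abs_pos.2 (sub_ne_zero.2 fun h => hq (Subtype.ext h))
  have hprod := norm_mul_norm_circlePt q.1 q.2
  have hne : ‖1 - circlePt q.1 * circlePt q.2‖ * ‖1 - circlePt q.1 * conj (circlePt q.2)‖ ≠ 0 := by
    rw [hprod]; positivity
  obtain ⟨hne1, hne2⟩ := mul_ne_zero_iff.1 hne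
  have hlim : ∀ w : ℂ, ‖1 - w‖ ≠ 0 → Tendsto (fun n => Real.log ‖1 - (r n : ℂ) * w‖) atTop
      (𝓝 (Real.log ‖1 - w‖)) := by
    intro w hw
    refine Tendsto.log ?_ hw
    have h1 : Tendsto (fun n => (r n : ℂ)) atTop (𝓝 ((1 : ℝ) : ℂ)) :=
      (Complex.continuous_ofReal.tendsto 1).comp hr
    have h2 := (tendsto_const_nhds (x := (1 : ℂ))).sub (h1.mul_const w)
    rw [Complex.ofReal_one, one_mul] at h2
    exact h2.norm
  have h := (((hlim _ hne1).neg.sub (hlim _ hne2)).add_const (2 * Real.log 2))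
  have heq : -Real.log ‖1 - circlePt q.1 * circlePt q.2‖ -
      Real.log ‖1 - circlePt q.1 * conj (circlePt q.2)‖ + 2 * Real.log 2 =
      -Real.log |(q.1 : ℝ) - q.2| := by
    have h1 := Real.log_mul hne1 hne2
    rw [hprod, Real.log_mul (by norm_num) hpos.ne', show (4 : ℝ) = 2 ^ 2 by norm_num,
      Real.log_pow] at h1
    push_cast at h1
    linarith
  rw [heq] at h
  exact h

/-- The energy of `μ` for `abelKernel`. -/
def abelEnergy (r : ℝ) (μ : ProbabilityMeasure unitInterval) : ℝ :=
  ∫ q, abelKernel r q ∂((μ : Measure unitInterval).prod (μ : Measure unitInterval))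

theorem hasSum_abelEnergy {r : ℝ} (hr0 : 0 ≤ r) (hr1 : r < 1)
    (μ : ProbabilityMeasure unitInterval) :
    HasSum (fun k : ℕ => 2 * r ^ k / k *
      (∫ x, chebyshevFun k x ∂(μ : Measure unitInterval)) ^ 2) (abelEnergy r μ) := by
  have hbd : ∀ (k : ℕ) (q : unitInterval × unitInterval),
      ‖2 * r ^ k / k * (chebyshevFun k q.1 * chebyshevFun k q.2)‖ ≤ 2 * r ^ k := by
    intro k q
    have hk : 2 * r ^ k / k ≤ 2 * r ^ k := by
      rcases eq_or_ne k 0 with rfl | hk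
      · simp
      · exact div_le_self (by positivity) (by exact_mod_cast Nat.one_le_iff_ne_zero.2 hk)
    rw [norm_mul, Real.norm_of_nonneg (by positivity), norm_mul]
    calc _ ≤ 2 * r ^ k * (1 * 1) := by
          gcongr
          · exact abs_chebyshevFun_le_one k q.1
          · exact abs_chebyshevFun_le_one k q.2
      _ = 2 * r ^ k := by ring
  have hcont : ∀ k : ℕ, Continuous fun q : unitInterval × unitInterval =>
      2 * r ^ k / k * (chebyshevFun k q.1 * chebyshevFun k q.2) := fun k => by fun_prop
  have hintegrable : ∀ k : ℕ, Integrable (fun q : unitInterval × unitInterval =>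
      2 * r ^ k / k * (chebyshevFun k q.1 * chebyshevFun k q.2))
      ((μ : Measure unitInterval).prod (μ : Measure unitInterval)) := fun k =>
    Integrable.of_bound (hcont k).aestronglyMeasurable (2 * r ^ k) (ae_of_all _ (hbd k))
  have hsum : Summable fun k : ℕ => ∫ q : unitInterval × unitInterval,
      ‖2 * r ^ k / k * (chebyshevFun k q.1 * chebyshevFun k q.2)‖
        ∂((μ : Measure unitInterval).prod (μ : Measure unitInterval)) := by
    refine Summable.of_nonneg_of_le (fun k => integral_nonneg fun q => norm_nonneg _) (fun k => ?_)
      ((summable_geometric_of_lt_one hr0 hr1).mul_left 2)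
    calc _ ≤ ∫ _ : unitInterval × unitInterval, 2 * r ^ k
          ∂((μ : Measure unitInterval).prod (μ : Measure unitInterval)) :=
          integral_mono (hintegrable k).norm (integrable_const _) (hbd k)
      _ = 2 * r ^ k := by simp
  have h := hasSum_integral_of_summable_integral_norm hintegrable hsum
  have h2 : ∀ q, ∑' k : ℕ, 2 * r ^ k / k * (chebyshevFun k q.1 * chebyshevFun k q.2) =
      abelKernel r q := fun q => (hasSum_abelKernel hr0 hr1 q).tsum_eq
  simp only [h2] at h
  refine Eq.mp (congrArg (fun F => HasSum F (abelEnergy r μ)) (funext fun k => ?_)) h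
  rw [integral_const_mul, integral_prod_mul, sq]

theorem integrable_abelKernel {r : ℝ} (hr0 : 0 ≤ r) (hr1 : r < 1)
    (μ : ProbabilityMeasure unitInterval) :
    Integrable (abelKernel r) ((μ : Measure unitInterval).prod (μ : Measure unitInterval)) := by
  obtain ⟨C, hC⟩ := isCompact_univ.exists_bound_of_continuousOn
    (continuous_abelKernel hr0 hr1).continuousOn
  exact Integrable.of_bound (continuous_abelKernel hr0 hr1).aestronglyMeasurable C
    (ae_of_all _ fun q => hC q trivial)

theorem integral_abelKernel_add {r : ℝ} (hr0 : 0 ≤ r) (hr1 : r < 1)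
    (μ : ProbabilityMeasure unitInterval) :
    ∫ q, (abelKernel r q + 2 * Real.log 2)
      ∂((μ : Measure unitInterval).prod (μ : Measure unitInterval)) =
      abelEnergy r μ + 2 * Real.log 2 := by
  rw [integral_add (integrable_abelKernel hr0 hr1 μ) (integrable_const _)]
  simp [abelEnergy]

theorem abelEnergy_lower {r : ℝ} (hr0 : 0 ≤ r) (hr1 : r < 1)
    (μ : ProbabilityMeasure unitInterval) : 0 ≤ abelEnergy r μ + 2 * Real.log 2 := by
  rw [← integral_abelKernel_add hr0 hr1]
  exact integral_nonneg fun q => abelKernel_lower hr0 hr1 q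

theorem lintegral_abelKernel {r : ℝ} (hr0 : 0 ≤ r) (hr1 : r < 1)
    (μ : ProbabilityMeasure unitInterval) :
    ∫⁻ q, ENNReal.ofReal (abelKernel r q + 2 * Real.log 2)
      ∂((μ : Measure unitInterval).prod (μ : Measure unitInterval)) =
      ENNReal.ofReal (abelEnergy r μ + 2 * Real.log 2) := by
  rw [← integral_abelKernel_add hr0 hr1]
  exact (ofReal_integral_eq_lintegral_ofReal
    ((integrable_abelKernel hr0 hr1 μ).add (integrable_const (2 * Real.log 2)))
    (ae_of_all _ (abelKernel_lower hr0 hr1))).symm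

theorem ae_prod_ne {μ : ProbabilityMeasure unitInterval}
    (hμ : ∀ x, (μ : Measure unitInterval) {x} = 0) :
    ∀ᵐ q ∂((μ : Measure unitInterval).prod (μ : Measure unitInterval)), q.1 ≠ q.2 := by
  have hm : MeasurableSet {q : unitInterval × unitInterval | q.1 ≠ q.2}ᶜ :=
    (measurableSet_eq_fun measurable_fst measurable_snd).compl.compl
  rw [ae_iff]
  change ((μ : Measure unitInterval).prod (μ : Measure unitInterval))
    {q : unitInterval × unitInterval | q.1 ≠ q.2}ᶜ = 0
  rw [Measure.prod_apply hm]
  have : ∀ x : unitInterval, Prod.mk x ⁻¹' {q : unitInterval × unitInterval | q.1 ≠ q.2}ᶜ = {x} := by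
    intro x; ext y; simp [eq_comm]
  simp [this, hμ]

theorem tendsto_abelEnergy {r : ℕ → ℝ} (hr0 : ∀ n, 0 ≤ r n) (hr1 : ∀ n, r n < 1)
    (hr : Tendsto r atTop (𝓝 1)) {μ : ProbabilityMeasure unitInterval} (hμ : energy μ ≠ ∞) :
    Tendsto (fun n => abelEnergy (r n) μ + 2 * Real.log 2) atTop (𝓝 (energy μ).toReal) := by
  have hne := ae_prod_ne (measure_singleton_eq_zero_of_energy_ne_top hμ)
  have hlog : 0 ≤ Real.log 2 := Real.log_nonneg (by norm_num)
  have h := tendsto_lintegral_of_dominated_convergence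
    (μ := (μ : Measure unitInterval).prod (μ : Measure unitInterval))
    (F := fun n q => ENNReal.ofReal (abelKernel (r n) q + 2 * Real.log 2)) (f := unitKernel)
    (fun q => unitKernel q + ENNReal.ofReal (2 * Real.log 2))
    (fun n => ((continuous_abelKernel (hr0 n) (hr1 n)).add
      continuous_const).measurable.ennreal_ofReal)
    (fun n => by
      filter_upwards [hne] with q hq
      rw [show q = (q.1, q.2) from rfl, unitKernel_eq_ofReal hq,
        ← ENNReal.ofReal_add (neg_log_abs_sub_nonneg _ _) (by positivity)]
      refine ENNReal.ofReal_le_ofReal ?_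
      linarith [abelKernel_upper (hr0 n) (hr1 n) hq])
    (by
      rw [lintegral_add_right _ measurable_const]
      exact ENNReal.add_ne_top.2 ⟨hμ, by
        rw [lintegral_const, measure_univ, mul_one]; exact ENNReal.ofReal_ne_top⟩)
    (by
      filter_upwards [hne] with q hq
      rw [show q = (q.1, q.2) from rfl, unitKernel_eq_ofReal hq]
      exact (ENNReal.continuous_ofReal.tendsto _).comp (tendsto_abelKernel hr hq))
  simp only [lintegral_abelKernel (hr0 _) (hr1 _)] at h
  have h2 := (ENNReal.tendsto_toReal hμ).comp h
  refine h2.congr fun n => ?_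
  simp only [Function.comp_apply]
  rw [ENNReal.toReal_ofReal (abelEnergy_lower (hr0 n) (hr1 n) μ)]

/-- Fatou's lemma needs no finite energy, only absence of atoms; it is applied to a midpoint
measure, whose energy is not yet known to be finite. -/
theorem energy_le_liminf {r : ℕ → ℝ} (hr0 : ∀ n, 0 ≤ r n) (hr1 : ∀ n, r n < 1)
    (hr : Tendsto r atTop (𝓝 1)) {μ : ProbabilityMeasure unitInterval}
    (hμ : ∀ x, (μ : Measure unitInterval) {x} = 0) :
    energy μ ≤ liminf (fun n => ENNReal.ofReal (abelEnergy (r n) μ + 2 * Real.log 2)) atTop := by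
  have h := lintegral_liminf_le (u := atTop)
    (μ := (μ : Measure unitInterval).prod (μ : Measure unitInterval))
    (f := fun n q => ENNReal.ofReal (abelKernel (r n) q + 2 * Real.log 2))
    (fun n => ((continuous_abelKernel (hr0 n) (hr1 n)).add
      continuous_const).measurable.ennreal_ofReal)
  simp only [lintegral_abelKernel (hr0 _) (hr1 _)] at h
  refine le_trans (le_of_eq (lintegral_congr_ae ?_)) h
  filter_upwards [ae_prod_ne hμ] with q hq
  rw [show q = (q.1, q.2) from rfl, unitKernel_eq_ofReal hq]
  exact ((ENNReal.continuous_ofReal.tendsto _).comp (tendsto_abelKernel hr hq)).liminf_eq.symm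

/-- The midpoint of two probability measures. -/
def midpointMeasure (μ ν : ProbabilityMeasure unitInterval) : ProbabilityMeasure unitInterval :=
  ⟨(2 : ℝ≥0∞)⁻¹ • ((μ : Measure unitInterval) + (ν : Measure unitInterval)), ⟨by
    simp only [Measure.smul_apply, Measure.add_apply, measure_univ, smul_eq_mul]
    rw [one_add_one_eq_two, ENNReal.inv_mul_cancel two_ne_zero ENNReal.ofNat_ne_top]⟩⟩

theorem integral_midpointMeasure (μ ν : ProbabilityMeasure unitInterval)
    (f : C(unitInterval, ℝ)) :
    ∫ x, f x ∂(midpointMeasure μ ν : Measure unitInterval) =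
      (∫ x, f x ∂(μ : Measure unitInterval) + ∫ x, f x ∂(ν : Measure unitInterval)) / 2 := by
  change ∫ x, f x ∂((2 : ℝ≥0∞)⁻¹ • ((μ : Measure unitInterval) + (ν : Measure unitInterval))) = _
  rw [integral_smul_measure, integral_add_measure (integrable_continuousMap μ f)
    (integrable_continuousMap ν f)]
  simp
  ring

/-- Termwise parallelogram identity `(a² + b²) / 2 - ((a + b) / 2)² = (a - b)² / 4` in the moment
expansion; all defects are nonnegative and only the `k`-th is kept. -/
theorem abelEnergy_midpoint_le {r : ℝ} (hr0 : 0 ≤ r) (hr1 : r < 1)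
    (μ ν : ProbabilityMeasure unitInterval) (k : ℕ) :
    abelEnergy r (midpointMeasure μ ν) + r ^ k / (2 * k) *
      (∫ x, chebyshevFun k x ∂(μ : Measure unitInterval) -
        ∫ x, chebyshevFun k x ∂(ν : Measure unitInterval)) ^ 2 ≤
      (abelEnergy r μ + abelEnergy r ν) / 2 := by
  have h := (((hasSum_abelEnergy hr0 hr1 μ).add (hasSum_abelEnergy hr0 hr1 ν)).div_const 2).sub
    (hasSum_abelEnergy hr0 hr1 (midpointMeasure μ ν))
  simp only [integral_midpointMeasure] at h
  have h2 : HasSum (fun k : ℕ => r ^ k / (2 * k) *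
      (∫ x, chebyshevFun k x ∂(μ : Measure unitInterval) -
        ∫ x, chebyshevFun k x ∂(ν : Measure unitInterval)) ^ 2) ((abelEnergy r μ +
      abelEnergy r ν) / 2 - abelEnergy r (midpointMeasure μ ν)) := by
    refine Eq.mp (congrArg (fun F => HasSum F _) (funext fun j => ?_)) h
    rcases eq_or_ne j 0 with rfl | hj
    · simp
    · have : (j : ℝ) ≠ 0 := by exact_mod_cast hj
      field_simp
      ring
  have h3 := le_hasSum h2 k fun j _ => by positivity
  linarith

/-- A minimiser of the energy is unique. -/
theorem energy_minimizer_unique {μ ν : ProbabilityMeasure unitInterval} (hμ : energy μ ≠ ∞)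
    (hν : energy ν ≠ ∞) (hμmin : ∀ ρ, energy μ ≤ energy ρ) (hνmin : ∀ ρ, energy ν ≤ energy ρ) :
    μ = ν := by
  have heq : energy μ = energy ν := le_antisymm (hμmin ν) (hνmin μ)
  set r : ℕ → ℝ := fun n => 1 - 1 / ((n : ℝ) + 1) with hrdef
  have hr0 : ∀ n, 0 ≤ r n := fun n => by
    simp only [hrdef, sub_nonneg]
    rw [div_le_one (by positivity)]
    linarith [(Nat.cast_nonneg n : (0 : ℝ) ≤ n)]
  have hr1 : ∀ n, r n < 1 := fun n => by
    have : (0 : ℝ) < 1 / ((n : ℝ) + 1) := by positivity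
    simp only [hrdef]; linarith
  have hr : Tendsto r atTop (𝓝 1) := by
    have := (tendsto_const_nhds (x := (1 : ℝ))).sub
      (tendsto_one_div_add_atTop_nhds_zero_nat (𝕜 := ℝ))
    rwa [sub_zero] at this
  refine ext_of_chebyshev_moments fun k => ?_
  rcases eq_or_ne k 0 with rfl | hk
  · simp [chebyshevFun_apply]
  set d := ∫ x, chebyshevFun k x ∂(μ : Measure unitInterval) -
    ∫ x, chebyshevFun k x ∂(ν : Measure unitInterval) with hd
  set ρ := midpointMeasure μ ν
  have hρatom : ∀ x, (ρ : Measure unitInterval) {x} = 0 := fun x => by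
    change ((2 : ℝ≥0∞)⁻¹ • ((μ : Measure unitInterval) + (ν : Measure unitInterval))) {x} = 0
    simp [measure_singleton_eq_zero_of_energy_ne_top hμ,
      measure_singleton_eq_zero_of_energy_ne_top hν]
  have hreal : Tendsto (fun n => ((abelEnergy (r n) μ + 2 * Real.log 2) +
      (abelEnergy (r n) ν + 2 * Real.log 2)) / 2 - r n ^ k / (2 * k) * d ^ 2) atTop
      (𝓝 (((energy μ).toReal + (energy ν).toReal) / 2 - 1 ^ k / (2 * k) * d ^ 2)) :=
    (((tendsto_abelEnergy hr0 hr1 hr hμ).add (tendsto_abelEnergy hr0 hr1 hr hν)).div_const 2).sub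
      (((hr.pow k).div_const _).mul_const _)
  have hmid : ∀ n, abelEnergy (r n) ρ + 2 * Real.log 2 ≤ ((abelEnergy (r n) μ + 2 * Real.log 2) +
      (abelEnergy (r n) ν + 2 * Real.log 2)) / 2 - r n ^ k / (2 * k) * d ^ 2 := fun n => by
    have := abelEnergy_midpoint_le (hr0 n) (hr1 n) μ ν k
    linarith
  have hnonneg : 0 ≤ ((energy μ).toReal + (energy ν).toReal) / 2 - 1 ^ k / (2 * k) * d ^ 2 :=
    ge_of_tendsto' hreal fun n => (abelEnergy_lower (hr0 n) (hr1 n) ρ).trans (hmid n)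
  have hlim := (ENNReal.continuous_ofReal.tendsto _).comp hreal
  -- Minimality is tested on the midpoint as `r → 1`: the common minimum is at most itself minus `d
  -- ^ 2 / (2 k)`, so `d = 0`.
  have h1 : energy μ ≤ ENNReal.ofReal (((energy μ).toReal + (energy ν).toReal) / 2 -
        1 ^ k / (2 * k) * d ^ 2) := by
    refine ((hμmin ρ).trans (energy_le_liminf hr0 hr1 hr hρatom)).trans ?_
    rw [← hlim.liminf_eq]
    refine liminf_le_liminf (Eventually.of_forall fun n => ENNReal.ofReal_le_ofReal (hmid n))
  have hpos : 0 ≤ 1 ^ k / (2 * (k : ℝ)) * d ^ 2 := by positivity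
  have h3 := ENNReal.toReal_mono ENNReal.ofReal_ne_top h1
  rw [ENNReal.toReal_ofReal hnonneg, ← heq] at h3
  have h2 : 1 ^ k / (2 * (k : ℝ)) * d ^ 2 = 0 := by linarith
  have hk0 : (k : ℝ) ≠ 0 := by exact_mod_cast hk
  rw [mul_eq_zero] at h2
  rcases h2 with h2 | h2
  · exact absurd h2 (by positivity)
  · exact sub_eq_zero.1 (pow_eq_zero_iff two_ne_zero |>.1 h2)

/-! ### The minimiser of the energy -/

/-- Lebesgue measure works, since `log` is integrable on `[-1, 1]`. -/
theorem exists_energy_ne_top : ∃ ν : ProbabilityMeasure unitInterval, energy ν ≠ ∞ := by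
  set lam : ProbabilityMeasure unitInterval := ⟨volume, inferInstance⟩
  set g : ℝ → ℝ≥0∞ := fun t => ENNReal.ofReal (-Real.log |t|) with hg
  have hgm : Measurable g := by fun_prop
  have hfin : ∫⁻ t in Set.Icc (-1 : ℝ) 1, g t ≠ ∞ := by
    have h1 : IntegrableOn Real.log (Set.Icc (-1 : ℝ) 1) := by
      rw [integrableOn_Icc_iff_integrableOn_Ioc,
        ← intervalIntegrable_iff_integrableOn_Ioc_of_le (by norm_num)]
      exact intervalIntegral.intervalIntegrable_log'
    have h2 := h1.neg.lintegral_lt_top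
    simp only [hg, Real.log_abs]
    exact h2.ne
  have hker : ∀ x : unitInterval, ∫⁻ y, unitKernel (x, y) ≤ ∫⁻ t in Set.Icc (-1 : ℝ) 1, g t := by
    intro x
    have h1 : ∫⁻ y, unitKernel (x, y) = ∫⁻ y : unitInterval, g (x - (y : ℝ)) := by
      refine lintegral_congr_ae ?_
      have : ∀ᵐ y : unitInterval, y ≠ x := by
        rw [ae_iff]; simp
      filter_upwards [this] with y hy
      exact unitKernel_eq_ofReal hy.symm
    rw [h1, unitInterval.measurePreserving_coe.lintegral_comp (f := fun t => g (x - t))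
      (by fun_prop), ← lintegral_indicator measurableSet_Icc, ← lintegral_indicator measurableSet_Icc,
      ← lintegral_sub_left_eq_self _ (x : ℝ)]
    refine lintegral_mono fun t => ?_
    by_cases ht : (x : ℝ) - t ∈ unitInterval
    · have h2 : t ∈ Set.Icc (-1 : ℝ) 1 := by
        have := x.2.1; have := x.2.2; have := ht.1; have := ht.2
        constructor <;> linarith
      rw [Set.indicator_of_mem ht, Set.indicator_of_mem h2, sub_sub_cancel]
    · rw [Set.indicator_of_notMem ht]; exact zero_le
  refine ⟨lam, ?_⟩
  have h : energy lam ≤ ∫⁻ t in Set.Icc (-1 : ℝ) 1, g t := by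
    rw [energy, lintegral_prod _ continuous_unitKernel.measurable.aemeasurable]
    calc ∫⁻ x, ∫⁻ y, unitKernel (x, y) ∂(lam : Measure unitInterval) ∂(lam : Measure unitInterval)
        ≤ ∫⁻ _, (∫⁻ t in Set.Icc (-1 : ℝ) 1, g t) ∂(lam : Measure unitInterval) :=
          lintegral_mono fun x => hker x
      _ = _ := by simp
  exact (h.trans_lt hfin.lt_top).ne

theorem exists_energy_minimizer : ∃ ν : ProbabilityMeasure unitInterval,
    energy ν ≠ ∞ ∧ ∀ ρ, energy ν ≤ energy ρ := by
  obtain ⟨lam, hlam⟩ := exists_energy_ne_top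
  obtain ⟨ν, -, hν⟩ := LowerSemicontinuousOn.exists_isMinOn (s := Set.univ) ⟨lam, trivial⟩
    isCompact_univ (lowerSemicontinuous_energy.lowerSemicontinuousOn _)
  exact ⟨ν, ((hν (Set.mem_univ lam)).trans_lt hlam.lt_top).ne, fun ρ => hν (Set.mem_univ ρ)⟩

/-! ### The rate function on the negative half-line -/

/-- Any image measure is a limit of empirical measures of points of `(0, 1)`, and the corresponding
`bernoulliPoly` has positive coefficients. Hence the value `∞` off `classP` never intervenes on
`ℝ₋`. -/
theorem mem_classP_of_mem_probOn {μ : ProbabilityMeasure ℂ} (hμ : μ ∈ probOn negLine) :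
    μ ∈ classP := by
  rw [classP, mem_closure_iff]
  intro U hU hμU
  obtain ⟨W, hW, hWU⟩ := isInducing_pushUnit.isOpen_iff.1
    (hU.preimage (continuous_subtype_val (p := fun μ => μ ∈ probOn negLine)))
  have hmem : ∀ ν (hν : ν ∈ probOn negLine), pushUnit ν ∈ W ↔ ν ∈ U := fun ν hν => by
    have := Set.ext_iff.1 hWU ⟨ν, hν⟩
    exact this
  obtain ⟨n, ⟨x, -, hbox, -⟩, hn⟩ := ((eventually_exists_config hW ((hmem μ hμ).2 hμU)
    one_ne_zero).and (eventually_ne_atTop 0)).exists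
  have hn0 : (0 : ℝ) < n := by positivity
  -- Averaging with `1 / 2` at weight `1 / (n + 1)` moves the points off the endpoints while staying
  -- within the stability radius.
  set y : Fin n → ℝ := fun i => (n * x i + 1 / 2) / (n + 1) with hy
  have hy01 : ∀ i, y i ∈ Set.Ioo (0 : ℝ) 1 := fun i => by
    have h1 := (x i).2.1; have h2 := (x i).2.2
    refine ⟨by simp only [hy]; positivity, ?_⟩
    simp only [hy]
    rw [div_lt_one (by positivity)]
    nlinarith
  have hyW : unitEmp n (fun i => clampUnit (y i)) ∈ W := by
    refine hbox _ fun i => ?_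
    have h1 := (x i).2.1; have h2 := (x i).2.2
    rw [Subtype.dist_eq, coe_clampUnit ⟨(hy01 i).1.le, (hy01 i).2.le⟩, Real.dist_eq]
    have : y i - x i = (1 / 2 - x i) / (n + 1) := by simp only [hy]; field_simp; ring
    rw [this, abs_div, abs_of_pos (by positivity : (0 : ℝ) < n + 1)]
    gcongr
    rw [abs_le]; constructor <;> linarith
  have hdeg := natDegree_C_mul_bernoulliPoly one_pos hy01
  refine ⟨empiricalMeasure (C 1 * bernoulliPoly y), ?_, C 1 * bernoulliPoly y, ⟨?_, ?_⟩, rfl⟩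
  · rw [← hmem _ (empiricalMeasure_bernoulliPoly_mem hn one_pos hy01),
      pushUnit_empiricalMeasure_bernoulliPoly hn one_pos hy01]
    exact hyW
  · rwa [hdeg]
  · intro k hk
    rw [hdeg] at hk
    rw [map_one, one_mul]
    exact coeff_bernoulliPoly_pos hy01 hk

theorem rateI_eq {μ : ProbabilityMeasure ℂ} (hμ : μ ∈ probOn negLine) :
    rateI μ = (energy (pushUnit μ) : EReal) / 2 := by
  rw [rateI, if_pos (mem_classP_of_mem_probOn hμ), eintegral_logKernel hμ]

theorem rateI_eq_coe {μ : ProbabilityMeasure ℂ} (hμ : μ ∈ probOn negLine)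
    (h : energy (pushUnit μ) ≠ ∞) :
    rateI μ = (((energy (pushUnit μ)).toReal / 2 : ℝ) : EReal) := by
  rw [rateI_eq hμ, EReal.coe_div, EReal.coe_ennreal_toReal h]
  rfl

theorem rateI_eq_top {μ : ProbabilityMeasure ℂ} (hμ : μ ∈ probOn negLine)
    (h : energy (pushUnit μ) = ∞) : rateI μ = ⊤ := by
  rw [rateI_eq hμ, h, EReal.coe_ennreal_top]
  exact EReal.top_div_of_pos_ne_top (by norm_num) (EReal.coe_ne_top 2)

theorem infRate_eq {ν₀ : ProbabilityMeasure unitInterval} (h0 : energy ν₀ ≠ ∞)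
    (hmin : ∀ ρ, energy ν₀ ≤ energy ρ) : infRate = (((energy ν₀).toReal / 2 : ℝ) : EReal) := by
  refine le_antisymm ?_ (le_iInf₂ fun μ hμ => ?_)
  · obtain ⟨μ, hμ, rfl⟩ := exists_pushUnit_eq (measure_singleton_eq_zero_of_energy_ne_top h0 0)
    rw [← rateI_eq_coe hμ h0]
    exact iInf₂_le μ hμ
  · by_cases h : energy (pushUnit μ) = ∞
    · rw [rateI_eq_top hμ h]; exact le_top
    · rw [rateI_eq_coe hμ h, EReal.coe_le_coe_iff]
      have := ENNReal.toReal_mono h (hmin (pushUnit μ))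
      linarith

theorem rate_sub_eq_coe {ν₀ : ProbabilityMeasure unitInterval} (h0 : energy ν₀ ≠ ∞)
    (hmin : ∀ ρ, energy ν₀ ≤ energy ρ) (μ : probOn negLine) (h : energy (pushUnit μ) ≠ ∞) :
    rateI μ - infRate =
      (((energy (pushUnit μ)).toReal / 2 - (energy ν₀).toReal / 2 : ℝ) : EReal) := by
  rw [rateI_eq_coe μ.2 h, infRate_eq h0 hmin, ← EReal.coe_sub]

theorem rate_sub_eq_top {ν₀ : ProbabilityMeasure unitInterval} (h0 : energy ν₀ ≠ ∞)
    (hmin : ∀ ρ, energy ν₀ ≤ energy ρ) (μ : probOn negLine) (h : energy (pushUnit μ) = ∞) :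
    rateI μ - infRate = ⊤ := by
  rw [rateI_eq_top μ.2 h, infRate_eq h0 hmin]
  exact EReal.top_sub_coe _

/-- The separate sign condition is needed because `ENNReal.ofReal` sends negative numbers to `0`. -/
theorem rate_sub_le_iff {ν₀ : ProbabilityMeasure unitInterval} (h0 : energy ν₀ ≠ ∞)
    (hmin : ∀ ρ, energy ν₀ ≤ energy ρ) (μ : probOn negLine) (M : ℝ) :
    rateI μ - infRate ≤ (M : EReal) ↔ pushUnit μ ∈ {ν | 0 ≤ 2 * M + (energy ν₀).toReal ∧
      energy ν ≤ ENNReal.ofReal (2 * M + (energy ν₀).toReal)} := by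
  by_cases h : energy (pushUnit μ) = ∞
  · rw [rate_sub_eq_top h0 hmin μ h]
    simp [h]
  · rw [rate_sub_eq_coe h0 hmin μ h, EReal.coe_le_coe_iff]
    have h1 := ENNReal.toReal_nonneg (a := energy (pushUnit μ))
    constructor
    · intro h2
      have h3 : 0 ≤ 2 * M + (energy ν₀).toReal := by linarith
      refine ⟨h3, ?_⟩
      rw [ENNReal.le_ofReal_iff_toReal_le h h3]
      linarith
    · rintro ⟨h3, h4⟩
      rw [ENNReal.le_ofReal_iff_toReal_le h h3] at h4
      linarith

theorem isGoodRateFunction_rate {ν₀ : ProbabilityMeasure unitInterval} (h0 : energy ν₀ ≠ ∞)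
    (hmin : ∀ ρ, energy ν₀ ≤ energy ρ) :
    IsGoodRateFunction fun μ : probOn negLine => rateI μ - infRate := by
  have hclosed : ∀ M : ℝ, IsClosed {ν : ProbabilityMeasure unitInterval |
      0 ≤ 2 * M + (energy ν₀).toReal ∧
        energy ν ≤ ENNReal.ofReal (2 * M + (energy ν₀).toReal)} := by
    intro M
    by_cases hM : 0 ≤ 2 * M + (energy ν₀).toReal
    · simp only [hM, true_and]
      exact lowerSemicontinuous_energy.isClosed_preimage _
    · simp only [hM, false_and]
      exact isClosed_empty
  have hnonneg : ∀ μ : probOn negLine, 0 ≤ rateI μ - infRate := by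
    intro μ
    by_cases h : energy (pushUnit μ) = ∞
    · rw [rate_sub_eq_top h0 hmin μ h]; exact le_top
    · rw [rate_sub_eq_coe h0 hmin μ h, ← EReal.coe_zero, EReal.coe_le_coe_iff]
      have := ENNReal.toReal_mono h (hmin (pushUnit μ))
      linarith
  refine ⟨?_, hnonneg, fun M => ?_⟩
  · rw [lowerSemicontinuous_iff_isClosed_preimage]
    intro y
    induction y with
    | bot =>
      convert! isClosed_empty
      ext μ
      simp only [Set.mem_preimage, Set.mem_Iic, le_bot_iff, Set.mem_empty_iff_false, iff_false]
      exact fun h => absurd (hnonneg μ) (by rw [h]; simp)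
    | top => simp
    | coe M =>
      have := (hclosed M).preimage (continuous_pushUnit.comp
        (continuous_subtype_val (p := fun μ => μ ∈ probOn negLine)))
      convert this using 1
      ext μ
      exact rate_sub_le_iff h0 hmin μ M
  -- Energy sublevel sets are compact in `M₁([0, 1])` and contain only measures without mass at `0`,
  -- so they lie wholly in the image of `pushUnit`: no mass escapes to `-∞`.
  · rw [isInducing_pushUnit.isCompact_iff]
    convert (hclosed M).isCompact using 1
    ext ν
    constructor
    · rintro ⟨μ, hμ, rfl⟩
      exact (rate_sub_le_iff h0 hmin μ M).1 hμ
    · intro hν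
      have hν1 : energy ν ≠ ∞ := (hν.2.trans_lt ENNReal.ofReal_lt_top).ne
      obtain ⟨μ, hμ, rfl⟩ := exists_pushUnit_eq (measure_singleton_eq_zero_of_energy_ne_top hν1 0)
      exact ⟨⟨μ, hμ⟩, (rate_sub_le_iff h0 hmin ⟨μ, hμ⟩ M).2 hν, rfl⟩

/-! ### Exponential estimates -/

theorem limsup_log_div_le {Q : ℕ → ℝ≥0∞} {b : ℝ}
    (h : ∀ᶠ n : ℕ in atTop, Q n ≤ ENNReal.ofReal (Real.exp (-((n : ℝ) ^ 2 * b)))) :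
    limsup (fun n => ENNReal.log (Q n) / (((n : ℝ) ^ 2 : ℝ) : EReal)) atTop ≤ ((-b : ℝ) : EReal) := by
  refine limsup_le_of_le (by isBoundedDefault) ?_
  filter_upwards [h, eventually_ne_atTop 0] with n hn hn0
  have hn1 : (0 : ℝ) < (n : ℝ) ^ 2 := by positivity
  calc ENNReal.log (Q n) / (((n : ℝ) ^ 2 : ℝ) : EReal)
      ≤ ENNReal.log (ENNReal.ofReal (Real.exp (-((n : ℝ) ^ 2 * b)))) /
          (((n : ℝ) ^ 2 : ℝ) : EReal) :=
        EReal.div_le_div_right_of_nonneg (by exact_mod_cast hn1.le) (ENNReal.log_monotone hn)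
    _ = ((-b : ℝ) : EReal) := by
        rw [ENNReal.log_ofReal_of_pos (Real.exp_pos _), Real.log_exp, ← EReal.coe_div]
        congr 1
        field_simp

theorem le_liminf_log_div {Q : ℕ → ℝ≥0∞} {b : ℝ}
    (h : ∀ᶠ n : ℕ in atTop, ENNReal.ofReal (Real.exp (-((n : ℝ) ^ 2 * b))) ≤ Q n) :
    ((-b : ℝ) : EReal) ≤ liminf (fun n => ENNReal.log (Q n) / (((n : ℝ) ^ 2 : ℝ) : EReal)) atTop := by
  refine le_liminf_of_le (by isBoundedDefault) ?_
  filter_upwards [h, eventually_ne_atTop 0] with n hn hn0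
  have hn1 : (0 : ℝ) < (n : ℝ) ^ 2 := by positivity
  calc ((-b : ℝ) : EReal) = ENNReal.log (ENNReal.ofReal (Real.exp (-((n : ℝ) ^ 2 * b)))) /
          (((n : ℝ) ^ 2 : ℝ) : EReal) := by
        rw [ENNReal.log_ofReal_of_pos (Real.exp_pos _), Real.log_exp, ← EReal.coe_div]
        congr 1
        field_simp
    _ ≤ _ := EReal.div_le_div_right_of_nonneg (by exact_mod_cast hn1.le) (ENNReal.log_monotone hn)

theorem inv_ofReal_exp_mul (s t : ℝ) : (ENNReal.ofReal (Real.exp s))⁻¹ *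
    ENNReal.ofReal (Real.exp t) = ENNReal.ofReal (Real.exp (t - s)) := by
  rw [← ENNReal.ofReal_inv_of_pos (Real.exp_pos _), ← ENNReal.ofReal_mul (by positivity),
    ← Real.exp_neg, ← Real.exp_add]
  congr 2
  ring

theorem eventually_ratio_le {ν₀ : ProbabilityMeasure unitInterval} (h0 : energy ν₀ ≠ ∞)
    {F : Set (ProbabilityMeasure unitInterval)} (hF : IsClosed F)
    {c : ℝ} (hc : ∀ ν ∈ F, (c : EReal) < energy ν) {b : ℝ}
    (hb : b < c / 2 - (energy ν₀).toReal / 2) :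
    ∀ᶠ n : ℕ in atTop, (gasMass n Set.univ)⁻¹ * gasMass n F ≤
      ENNReal.ofReal (Real.exp (-((n : ℝ) ^ 2 * b))) := by
  -- One half of the slack goes to the numerator, the other to the normalising constant.
  set η := (c / 2 - (energy ν₀).toReal / 2 - b) / 2 with hη
  have hη0 : 0 < η := by rw [hη]; linarith
  filter_upwards [eventually_gasMass_le_exp hF hc hη0,
    eventually_exp_le_gasMass isOpen_univ (Set.mem_univ ν₀) h0 hη0] with n h1 h2
  refine (mul_le_mul' (ENNReal.inv_le_inv.2 h2) h1).trans ?_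
  rw [inv_ofReal_exp_mul]
  refine ENNReal.ofReal_le_ofReal (Real.exp_le_exp.2 (le_of_eq ?_))
  rw [hη]
  ring

theorem eventually_le_ratio {ν₀ : ProbabilityMeasure unitInterval} (h0 : energy ν₀ ≠ ∞)
    (hmin : ∀ ρ, energy ν₀ ≤ energy ρ) {W : Set (ProbabilityMeasure unitInterval)} (hW : IsOpen W)
    {ν : ProbabilityMeasure unitInterval} (hν : ν ∈ W) (hE : energy ν ≠ ∞) {b : ℝ}
    (hb : (energy ν).toReal / 2 - (energy ν₀).toReal / 2 < b) :
    ∀ᶠ n : ℕ in atTop, ENNReal.ofReal (Real.exp (-((n : ℝ) ^ 2 * b))) ≤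
      (gasMass n Set.univ)⁻¹ * gasMass n W := by
  -- One third of the slack serves the numerator; the normalising constant takes two, one of them to
  -- make the energy threshold strict.
  set η := (b - ((energy ν).toReal / 2 - (energy ν₀).toReal / 2)) / 3 with hη
  have hη0 : 0 < η := by rw [hη]; linarith
  have hc : ∀ ρ ∈ (Set.univ : Set (ProbabilityMeasure unitInterval)),
      (((energy ν₀).toReal - 2 * η : ℝ) : EReal) < energy ρ := fun ρ _ => by
    refine lt_of_lt_of_le ?_ (EReal.coe_ennreal_le_coe_ennreal_iff.2 (hmin ρ))
    rw [← EReal.coe_ennreal_toReal h0, EReal.coe_lt_coe_iff]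
    linarith
  filter_upwards [eventually_gasMass_le_exp isClosed_univ hc hη0,
    eventually_exp_le_gasMass hW hν hE hη0] with n h1 h2
  refine le_trans ?_ (mul_le_mul' (ENNReal.inv_le_inv.2 h1) h2)
  rw [inv_ofReal_exp_mul]
  refine ENNReal.ofReal_le_ofReal (Real.exp_le_exp.2 (le_of_eq ?_))
  rw [hη]
  ring

/-! ### Conditional probabilities -/

section Cond

variable {Ω : Type*} [MeasurableSpace Ω] {P : Measure Ω} [IsProbabilityMeasure P]
  {ξ : ℕ → Ω → ℝ}

theorem measure_mem_probOn (hmeas : ∀ j, Measurable (ξ j))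
    (hlaw : ∀ j, HasLaw (ξ j) (expMeasure 1) P) (hindep : iIndepFun ξ P)
    {n : ℕ} (hn : n ≠ 0) {S : Set ℂ} (hS : IsClosed S)
    (hS1 : negLine ⊆ S) (hS2 : S ⊆ realLine) :
    P {ω | empL ξ n ω ∈ probOn S} = gasMass n Set.univ := by
  have := measure_event_eq_gasMass hmeas hlaw hindep hn hS hS1 hS2
    (measurableSet_configsIn_of_isOpen isOpen_univ)
  simpa only [Set.mem_univ, and_true] using this

/-- The conditioning event has the same probability for every admissible `S`, and only `configsIn n
W` has to be measurable, not `A`. -/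
theorem condProb_eq (hmeas : ∀ j, Measurable (ξ j))
    (hlaw : ∀ j, HasLaw (ξ j) (expMeasure 1) P) (hindep : iIndepFun ξ P)
    {n : ℕ} (hn : n ≠ 0) {S : Set ℂ} (hS : IsClosed S)
    (hS1 : negLine ⊆ S) (hS2 : S ⊆ realLine) {A : Set (ProbabilityMeasure ℂ)}
    {W : Set (ProbabilityMeasure unitInterval)} (hW : MeasurableSet (configsIn n W))
    (hAW : ∀ μ ∈ probOn negLine, pushUnit μ ∈ W ↔ μ ∈ A) :
    condProb P ξ S n A = (gasMass n Set.univ)⁻¹ * gasMass n W := by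
  have hae : {ω | empL ξ n ω ∈ probOn S} =ᵐ[P] {ω | empL ξ n ω ∈ probOn negLine} := by
    have h1 := event_ae_eq hmeas hlaw hindep hn hS hS1 hS2 Set.univ
    have h2 := event_ae_eq hmeas hlaw hindep hn isClosed_negLine subset_rfl
      negLine_subset_realLine Set.univ
    simp only [Set.mem_univ, and_true] at h1 h2
    exact h1.trans h2.symm
  rw [condProb, ProbabilityTheory.cond, Measure.smul_apply, smul_eq_mul,
    measure_mem_probOn hmeas hlaw hindep hn hS hS1 hS2,
    Measure.restrict_apply₀' (nullMeasurableSet_event hmeas hlaw hindep hn hS hS1 hS2),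
    ← measure_event_eq_gasMass hmeas hlaw hindep hn isClosed_negLine subset_rfl
      negLine_subset_realLine hW, measure_congr ((ae_eq_refl _).inter hae)]
  congr 2
  ext ω
  simp only [Set.mem_inter_iff, Set.mem_ofPred_eq]
  constructor
  · rintro ⟨h1, h2⟩; exact ⟨h2, (hAW _ h2).2 h1⟩
  · rintro ⟨h1, h2⟩; exact ⟨(hAW _ h1).1 h2, h1⟩

end Cond

theorem gasMass_univ_le (n : ℕ) (W : Set (ProbabilityMeasure unitInterval)) :
    gasMass n Set.univ ≤ gasMass n W + gasMass n Wᶜ := by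
  have : configsIn n Set.univ ⊆ configsIn n W ∪ configsIn n Wᶜ := fun y hy => by
    by_cases h : unitEmp n (fun i => clampUnit (y i)) ∈ W
    · exact Or.inl ⟨hy.1, h⟩
    · exact Or.inr ⟨hy.1, h⟩
  rw [gasMass, gasMass, gasMass, ← mul_add]
  gcongr
  exact (lintegral_mono_set this).trans (lintegral_union_le _ _ _)

theorem gasMass_mono (n : ℕ) {V W : Set (ProbabilityMeasure unitInterval)} (h : V ⊆ W) :
    gasMass n V ≤ gasMass n W := by
  rw [gasMass, gasMass]
  gcongr
  exact fun y hy => ⟨hy.1, h hy.2⟩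

/-! ### Large deviation bounds for the gas in the unit interval -/

variable {ν₀ : ProbabilityMeasure unitInterval}

theorem neg_rate_le_liminf (h0 : energy ν₀ ≠ ∞) (hmin : ∀ ρ, energy ν₀ ≤ energy ρ)
    {W : Set (ProbabilityMeasure unitInterval)} (hW : IsOpen W) (μ : probOn negLine)
    (hμ : pushUnit μ ∈ W) :
    -(rateI μ - infRate) ≤ liminf (fun n => ENNReal.log
      ((gasMass n Set.univ)⁻¹ * gasMass n W) / (((n : ℝ) ^ 2 : ℝ) : EReal)) atTop := by
  by_cases h : energy (pushUnit μ) = ∞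
  · rw [rate_sub_eq_top h0 hmin μ h, EReal.neg_top]
    exact bot_le
  · rw [rate_sub_eq_coe h0 hmin μ h, ← EReal.coe_neg]
    refine le_of_forall_lt_imp_le_of_dense fun a ha => ?_
    obtain ⟨b, hab, hb⟩ := EReal.lt_iff_exists_real_btwn.1 ha
    rw [EReal.coe_lt_coe_iff] at hb
    refine hab.le.trans ?_
    have := le_liminf_log_div (eventually_le_ratio h0 hmin hW hμ h (b := -b) (by linarith))
    rwa [neg_neg] at this

theorem limsup_le_of_rate_le (h0 : energy ν₀ ≠ ∞) (hmin : ∀ ρ, energy ν₀ ≤ energy ρ)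
    {F : Set (ProbabilityMeasure unitInterval)} (hF : IsClosed F) {r : EReal}
    (hr : ∀ μ : probOn negLine, pushUnit μ ∈ F → r ≤ rateI μ - infRate) :
    limsup (fun n => ENNReal.log
      ((gasMass n Set.univ)⁻¹ * gasMass n F) / (((n : ℝ) ^ 2 : ℝ) : EReal)) atTop ≤ -r := by
  rw [EReal.le_neg]
  refine le_of_forall_lt_imp_le_of_dense fun a ha => ?_
  obtain ⟨b, hab, hb⟩ := EReal.lt_iff_exists_real_btwn.1 ha
  obtain ⟨c, hbc, hc⟩ := EReal.lt_iff_exists_real_btwn.1 hb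
  rw [EReal.coe_lt_coe_iff] at hbc
  refine hab.le.trans ?_
  rw [EReal.le_neg]
  -- Measures of infinite energy satisfy this trivially; all others come from `M₁(ℝ₋)`, where `hr`
  -- applies. The closed set may thus contain measures charging `0`.
  have hlow : ∀ ν ∈ F, ((2 * c + (energy ν₀).toReal : ℝ) : EReal) < energy ν := by
    intro ν hν
    by_cases h : energy ν = ∞
    · rw [h]; exact EReal.coe_lt_top _
    · obtain ⟨μ, hμ, rfl⟩ := exists_pushUnit_eq (measure_singleton_eq_zero_of_energy_ne_top h 0)
      have h1 := hc.trans_le (hr ⟨μ, hμ⟩ hν)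
      rw [rate_sub_eq_coe h0 hmin ⟨μ, hμ⟩ h, EReal.coe_lt_coe_iff] at h1
      rw [← EReal.coe_ennreal_toReal h, EReal.coe_lt_coe_iff]
      dsimp only at h1
      linarith
  exact_mod_cast limsup_log_div_le (eventually_ratio_le h0 hF hlow (b := b) (by linarith))

theorem tendsto_ratio_zero (h0 : energy ν₀ ≠ ∞) (hmin : ∀ ρ, energy ν₀ ≤ energy ρ)
    {F : Set (ProbabilityMeasure unitInterval)} (hF : IsClosed F) (hν₀ : ν₀ ∉ F) :
    Tendsto (fun n => (gasMass n Set.univ)⁻¹ * gasMass n F) atTop (𝓝 0) := by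
  -- The energy attains its minimum on the compact set `F`, and by uniqueness of the global
  -- minimiser that minimum exceeds `energy ν₀` strictly.
  obtain ⟨c, hc0, hc⟩ : ∃ c : ℝ, (energy ν₀).toReal < c ∧ ∀ ν ∈ F, (c : EReal) < energy ν := by
    rcases F.eq_empty_or_nonempty with rfl | hne
    · exact ⟨(energy ν₀).toReal + 1, by linarith, by simp⟩
    obtain ⟨ν, hν, hνmin⟩ := LowerSemicontinuousOn.exists_isMinOn hne hF.isCompact
      (lowerSemicontinuous_energy.lowerSemicontinuousOn _)
    have hlt : energy ν₀ < energy ν := by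
      refine (hmin ν).lt_of_ne fun heq => hν₀ ?_
      rwa [energy_minimizer_unique h0 (heq ▸ h0) hmin fun ρ => heq ▸ hmin ρ]
    have hlt' : (((energy ν₀).toReal : ℝ) : EReal) < energy ν := by
      rw [EReal.coe_ennreal_toReal h0]
      exact_mod_cast hlt
    obtain ⟨c, h1, h2⟩ := EReal.lt_iff_exists_real_btwn.1 hlt'
    refine ⟨c, by exact_mod_cast h1, fun ρ hρ => h2.trans_le ?_⟩
    exact_mod_cast hνmin hρ
  set b := (c - (energy ν₀).toReal) / 4 with hb
  have hb0 : 0 < b := by rw [hb]; linarith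
  have hlim : Tendsto (fun n : ℕ => ENNReal.ofReal (Real.exp (-((n : ℝ) ^ 2 * b)))) atTop (𝓝 0) := by
    rw [← ENNReal.ofReal_zero]
    refine (ENNReal.continuous_ofReal.tendsto 0).comp (Real.tendsto_exp_neg_atTop_nhds_zero.comp ?_)
    exact ((tendsto_pow_atTop two_ne_zero).comp tendsto_natCast_atTop_atTop).atTop_mul_const hb0
  refine tendsto_of_tendsto_of_tendsto_of_le_of_le' tendsto_const_nhds hlim
    (Eventually.of_forall fun n => zero_le) ?_
  exact eventually_ratio_le h0 hF hc (by rw [hb]; linarith)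

theorem tendsto_ratio_one (h0 : energy ν₀ ≠ ∞) (hmin : ∀ ρ, energy ν₀ ≤ energy ρ)
    (hfin : ∀ n ≠ 0, gasMass n Set.univ ≠ ∞)
    {W : Set (ProbabilityMeasure unitInterval)} (hW : IsOpen W) (hν₀ : ν₀ ∈ W) :
    Tendsto (fun n => (gasMass n Set.univ)⁻¹ * gasMass n W) atTop (𝓝 1) := by
  have h1 := ENNReal.Tendsto.sub (tendsto_const_nhds (x := (1 : ℝ≥0∞)))
    (tendsto_ratio_zero h0 hmin hW.isClosed_compl (fun h => h hν₀)) (Or.inl ENNReal.one_ne_top)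
  rw [tsub_zero] at h1
  refine tendsto_of_tendsto_of_tendsto_of_le_of_le' h1 tendsto_const_nhds ?_ ?_
  · filter_upwards [eventually_ne_atTop 0] with n hn
    rw [tsub_le_iff_right, ← mul_add,
      ← ENNReal.inv_mul_cancel (gasMass_univ_pos hn).ne' (hfin n hn)]
    gcongr
    exact gasMass_univ_le n W
  · filter_upwards [eventually_ne_atTop 0] with n hn
    rw [← ENNReal.inv_mul_cancel (gasMass_univ_pos hn).ne' (hfin n hn)]
    gcongr
    exact gasMass_mono n (Set.subset_univ W)

end RandomZeros
end

/-! ### Transfer to the zeros and proof of the theorem -/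

open RandomZeros in
theorem theorem1p2 {Ω : Type*} [MeasurableSpace Ω] (P : Measure Ω) [IsProbabilityMeasure P]
    (ξ : ℕ → Ω → ℝ) (hmeas : ∀ j, Measurable (ξ j))
    (hlaw : ∀ j, HasLaw (ξ j) (expMeasure 1) P) (hindep : iIndepFun ξ P) :
    (∀ n : ℕ, 1 ≤ n → 0 < P {ω | RandomZeros.empL ξ n ω ∈ RandomZeros.probOn RandomZeros.negLine}) ∧
    RandomZeros.SatisfiesLDP (E := RandomZeros.probOn RandomZeros.negLine)
      (fun n A => RandomZeros.condProb P ξ RandomZeros.negLine n (Subtype.val '' A))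
      (fun n => (n : ℝ) ^ 2)
      (fun μ => RandomZeros.rateI μ - RandomZeros.infRate) ∧
    ∃ μR ∈ RandomZeros.probOn RandomZeros.negLine,
      RandomZeros.rateI μR = RandomZeros.infRate ∧
      (∀ ν ∈ RandomZeros.probOn RandomZeros.negLine,
        RandomZeros.rateI ν = RandomZeros.infRate → ν = μR) ∧
      (∀ U : Set (ProbabilityMeasure ℂ), IsOpen U → μR ∈ U →
        Tendsto (fun n => RandomZeros.condProb P ξ RandomZeros.negLine n U) atTop (𝓝 1) ∧
        Tendsto (fun n => RandomZeros.condProb P ξ RandomZeros.realLine n U) atTop (𝓝 1)) := by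
  obtain ⟨ν₀, h0, hmin⟩ := exists_energy_minimizer
  have hprob : ∀ n ≠ 0, P {ω | empL ξ n ω ∈ probOn negLine} = gasMass n Set.univ := fun n hn =>
    measure_mem_probOn hmeas hlaw hindep hn isClosed_negLine subset_rfl negLine_subset_realLine
  have hval : ∀ {A : Set (probOn negLine)} {W : Set (ProbabilityMeasure unitInterval)},
      (fun μ : probOn negLine => pushUnit (μ : ProbabilityMeasure ℂ)) ⁻¹' W = A →
      ∀ μ ∈ probOn negLine, pushUnit μ ∈ W ↔ μ ∈ Subtype.val '' A := by
    rintro A W rfl μ hμ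
    exact ⟨fun h => ⟨⟨μ, hμ⟩, h, rfl⟩, by rintro ⟨μ, h, rfl⟩; exact h⟩
  refine ⟨fun n hn => ?_, ⟨isGoodRateFunction_rate h0 hmin, fun O hO => ?_, fun F hF => ?_⟩, ?_⟩
  · rw [hprob n (by omega)]
    exact gasMass_univ_pos (by omega)
  · obtain ⟨W, hW, hWO⟩ := isInducing_pushUnit.isOpen_iff.1 hO
    rw [liminf_congr (v := fun n : ℕ => ENNReal.log ((gasMass n Set.univ)⁻¹ * gasMass n W) /
      (((n : ℝ) ^ 2 : ℝ) : EReal))]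
    · rw [EReal.neg_le]
      refine le_iInf₂ fun μ hμ => ?_
      rw [EReal.neg_le]
      exact neg_rate_le_liminf h0 hmin hW μ (by rw [← hWO] at hμ; exact hμ)
    · filter_upwards [eventually_ne_atTop 0] with n hn
      rw [condProb_eq hmeas hlaw hindep hn isClosed_negLine subset_rfl negLine_subset_realLine
        (measurableSet_configsIn_of_isOpen hW) (hval hWO)]
  · obtain ⟨W, hW, hWF⟩ := isInducing_pushUnit.isClosed_iff.1 hF
    rw [limsup_congr (v := fun n : ℕ => ENNReal.log ((gasMass n Set.univ)⁻¹ * gasMass n W) /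
      (((n : ℝ) ^ 2 : ℝ) : EReal))]
    · exact limsup_le_of_rate_le h0 hmin hW fun μ hμ => iInf₂_le μ (by rw [← hWF]; exact hμ)
    · filter_upwards [eventually_ne_atTop 0] with n hn
      rw [condProb_eq hmeas hlaw hindep hn isClosed_negLine subset_rfl negLine_subset_realLine
        (measurableSet_configsIn_of_isClosed hW) (hval hWF)]
  · obtain ⟨μR, hμR, rfl⟩ := exists_pushUnit_eq (measure_singleton_eq_zero_of_energy_ne_top h0 0)
    refine ⟨μR, hμR, ?_, fun ν hν h => ?_, fun U hU hμU => ?_⟩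
    · rw [rateI_eq_coe hμR h0, infRate_eq h0 hmin]
    · rw [infRate_eq h0 hmin] at h
      have hne : energy (pushUnit ν) ≠ ∞ := fun htop => by
        rw [rateI_eq_top hν htop] at h
        exact EReal.coe_ne_top _ h.symm
      rw [rateI_eq_coe hν hne, EReal.coe_eq_coe_iff] at h
      have heq : energy (pushUnit ν) = energy (pushUnit μR) :=
        (ENNReal.toReal_eq_toReal_iff' hne h0).1 (by linarith)
      exact pushUnit_injOn hν hμR (energy_minimizer_unique hne h0 (fun ρ => heq ▸ hmin ρ) hmin)
    · obtain ⟨W, hW, hWU⟩ := isInducing_pushUnit.isOpen_iff.1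
        (hU.preimage (continuous_subtype_val (p := fun μ => μ ∈ probOn negLine)))
      have hmem : ∀ ν ∈ probOn negLine, pushUnit ν ∈ W ↔ ν ∈ U := fun ν hν =>
        Set.ext_iff.1 hWU ⟨ν, hν⟩
      -- The total gas mass is finite because it is a probability.
      have hlim := tendsto_ratio_one h0 hmin
        (fun n hn => hprob n hn ▸ measure_ne_top P _) hW ((hmem μR hμR).2 hμU)
      have hcond : ∀ S : Set ℂ, IsClosed S → negLine ⊆ S → S ⊆ realLine →
          Tendsto (fun n => condProb P ξ S n U) atTop (𝓝 1) := fun S hS hS1 hS2 => by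
        refine hlim.congr' ?_
        filter_upwards [eventually_ne_atTop 0] with n hn
        rw [condProb_eq hmeas hlaw hindep hn hS hS1 hS2
          (measurableSet_configsIn_of_isOpen hW) hmem]
      exact ⟨hcond _ isClosed_negLine subset_rfl negLine_subset_realLine,
        hcond _ isClosed_realLine negLine_subset_realLine subset_rfl⟩
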